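/- Let $(M,g)$ be a compact connected smooth Riemannian manifold of dimension $d$, possibly with boundary or corners, whose Riemannian volume measure, written $dx$ or $dy$, is normalized to $\mathrm{vol}(M)=1$. Let $n \ge 0$ and let $\phi_1,\dots,\phi_n : M \to \mathbb{R}$ be Laplacian eigenfunctions that are orthonormal in $L^2(M)$ (for example, the first $n$ elements of an orthonormal basis of eigenfunctions): each $\phi_k$ is smooth in the interior of $M$ and satisfies there $-\Delta \phi_k = \lambda_k \phi_k$ for some $\lambda_k \in \mathbb{R}$, where $\Delta$ is the Laplace–Beltrami operator, $\phi_k \in L^2(M)$, and $\int_M \phi_j(y)\phi_k(y)\,dy = \delta_{jk}$ for $1 \le j,k \le n$. No boundary condition is needed; if $M$ has no boundary, its interior is all of $M$. Set $$\mathbb{A}^{(n)}(x,y) = \sum_{k=1}^n \operatorname{sgn}(\phi_k(x))\, \phi_k(y), \qquad x,y\in M,$$ where $\operatorname{sgn}(z)$ is $1$, $0$ or $-1$ according to whether $z>0$, $z=0$ or $z<0$. Then $\mathbb{A}^{(n)}(x,\cdot)^2$ is integrable on $M$ for every $x \in M$, $(\mathbb{A}^{(n)})^2$ is integrable on $M\times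 M$, $$\forall x \in M: \quad \int_M \mathbb{A}^{(n)}(x,y)^2\,dy \le n, \qquad\text{and}\qquad \int_M\int_M \mathbb{A}^{(n)}(x,y)^2\,dy\,dx = n.$$ -/

import Mathlib

open scoped Manifold ContDiff
open MeasureTheory

noncomputable section

/-! Throughout, `M` is a `d`-dimensional smooth manifold, modelled on `EuclideanSpace ℝ (Fin d)`
through a model with corners `I` (so that boundary and corners are allowed), and `g` is a smooth
Riemannian metric on `M`. The local coordinates around `x : M` are `extChartAt I x`, with
inverse `(extChartAt I x).symm` defined on `(extChartAt I x).target`. -/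

namespace Riemann

/-- Smooth Riemannian metrics on the manifold `M`. -/
abbrev Metric {d : ℕ} {H : Type*} [TopologicalSpace H]
    (I : ModelWithCorners ℝ (EuclideanSpace ℝ (Fin d)) H)
    (M : Type*) [TopologicalSpace M] [ChartedSpace H M] [IsManifold I ∞ M] : Type _ :=
  Bundle.ContMDiffRiemannianMetric I ∞ (EuclideanSpace ℝ (Fin d)) (fun p : M => TangentSpace I p)

variable {d : ℕ} {H : Type*} [TopologicalSpace H]
  {I : ModelWithCorners ℝ (EuclideanSpace ℝ (Fin d)) H}
  {M : Type*} [TopologicalSpace M] [ChartedSpace H M] [IsManifold I ∞ M]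

/-- The coordinate vector field `∂ᵢ` of the chart around `x`, at the point of `M` with
coordinates `y`. -/
def coordVec (I : ModelWithCorners ℝ (EuclideanSpace ℝ (Fin d)) H)
    (x : M) (i : Fin d) (y : EuclideanSpace ℝ (Fin d)) :
    TangentSpace I ((extChartAt I x).symm y) :=
  mfderivWithin 𝓘(ℝ, EuclideanSpace ℝ (Fin d)) I (extChartAt I x).symm (Set.range I) y
    (EuclideanSpace.single i (1 : ℝ) : EuclideanSpace ℝ (Fin d))

/-- The matrix `gᵢⱼ = g(∂ᵢ, ∂ⱼ)` of the metric in the chart around `x`, at coordinates `y`. -/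
def gram (g : Metric I M) (x : M) (y : EuclideanSpace ℝ (Fin d)) : Matrix (Fin d) (Fin d) ℝ :=
  Matrix.of fun i j => g.inner ((extChartAt I x).symm y) (coordVec I x i y) (coordVec I x j y)

/-- The Riemannian volume density `√(det gᵢⱼ)` in the chart around `x`. -/
def density (g : Metric I M) (x : M) (y : EuclideanSpace ℝ (Fin d)) : ℝ :=
  √(gram g x y).det

/-- The Riemannian volume of the domain of the chart around `x`, as a measure on `M`: the image
of `√(det gᵢⱼ) dy` under the inverse of the chart. -/
def chartVol [MeasurableSpace M] (g : Metric I M) (x : M) : Measure M :=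
  ((volume.restrict (extChartAt I x).target).withDensity
    (fun y => ENNReal.ofReal (density g x y))).map (extChartAt I x).symm

/-- The Riemannian volume measure of `(M, g)`. By the change of variables formula the measures
`chartVol g x` agree on overlaps of chart domains; the measure that they glue to is their
supremum, that is, the least measure on `M` that is at least each of them. -/
def vol [MeasurableSpace M] (g : Metric I M) : Measure M :=
  ⨆ x : M, chartVol g x

/-- The partial derivative `∂ᵢ` on `ℝᵈ`. -/
def pderiv (i : Fin d) (u : EuclideanSpace ℝ (Fin d) → ℝ) (y : EuclideanSpace ℝ (Fin d)) : ℝ :=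
  fderiv ℝ u y (EuclideanSpace.single i (1 : ℝ))

/-- The Laplace–Beltrami operator in the chart around `x`, at coordinates `y`:
`Δ f = (det g)^(-1/2) ∑ᵢ ∂ᵢ ((det g)^(1/2) ∑ⱼ gⁱʲ ∂ⱼ f)`. -/
def laplacian (g : Metric I M) (x : M) (f : M → ℝ) (y : EuclideanSpace ℝ (Fin d)) : ℝ :=
  (density g x y)⁻¹ * ∑ i, pderiv i (fun z => density g x z *
    ∑ j, (gram g x z)⁻¹ i j * pderiv j (fun w => f ((extChartAt I x).symm w)) z) y

/-- `f` is smooth on the interior of `M` and satisfies `-Δ f = lam * f` there, in all charts. If `M`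
has no boundary, the interior is all of `M`. No boundary condition is imposed. -/
structure IsEigenfunction (g : Metric I M) (lam : ℝ) (f : M → ℝ) : Prop where
  smooth : ContMDiffOn I 𝓘(ℝ, ℝ) ∞ f (I.interior M)
  eigen : ∀ x : M, ∀ y ∈ interior (extChartAt I x).target,
    -laplacian g x f y = lam * f ((extChartAt I x).symm y)

end Riemann

/-- The kernel `𝔸⁽ⁿ⁾(x,y) = ∑ₖ sgn(φₖ(x)) φₖ(y)` of `n` functions `φ₁, …, φₙ`
(`Real.sign` takes the value `0` at `0`). -/
def signKernel {M : Type*} {n : ℕ} (φ : Fin n → M → ℝ) (x y : M) : ℝ :=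
  ∑ k, Real.sign (φ k x) * φ k y

end

/-!
By Pythagoras, `∫ 𝔸(x,y)² dy = ∑ₖ sgn(φₖ(x))²` for every `x`, which is at most `n`, and equal to `n`
as soon as no `φₖ(x)` vanishes (`signKernel_of_orthonormal_of_ae_ne_zero`). What remains is that
the nodal set of an eigenfunction which is not almost everywhere zero is a null set
(`Riemann.IsEigenfunction.ae_ne_zero`).

In a chart the eigenvalue equation implies `|div (A ∇f)| ≤ Λ |f|` locally, with `A` smooth and
positive definite. If the zero set of `f` has positive measure, then at almost all of its points
all derivatives of `f` vanish: the derivative of a function vanishes at the density points of its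
zero set, and this can be iterated (`Riemann.ae_iterPderiv_eq_zero`). At such a point `x₀` strong
unique continuation (`Riemann.eventually_eq_zero_of_vanishesToOrder`) shows that `f` vanishes in a
neighbourhood. Vanishing near a point then propagates, first inside a chart, where all derivatives
vanish on the closure of the set where `f` vanishes locally, and then through the connected
manifold, also along boundary points, because the range of a model with corners is convex with
dense interior (`Riemann.IsEigenfunction.exists_nhds`). Hence `f` vanishes in the whole interior of
the manifold, whose complement is null, and this contradicts `∫ f² = 1`.

Strong unique continuation rests on a Carleman estimate (`Riemann.IsPolar.carleman_estimate`): with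
`s` the logarithm of the distance to `x₀`, measured by the matrix `A(x₀)⁻¹`,
`h(s) = s - K eˢ` and `τ` large,
`τ³ ∫ e^{-ds - 2τh(s)} eˢ u² ≤ ∫ e^{-ds - 2τh(s)} (e^{2s} div (A ∇u))²`
for `u` supported near `x₀` and away from it. To prove it, conjugate with `e^{τh(s)}` and integrate
the conjugated operator against `a ∂_β v + b v`, where `β = e^{2s} A ∇s` is the radial field, which
agrees with `x - x₀` to first order. The second derivatives cancel by the identity of Rellich
(`Riemann.along_flux_along`), the concavity of `h` makes the remaining form positive, and the
deviations of `A` from a constant matrix, of relative size `eˢ`, are absorbed when `K` is large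
(`Riemann.carleman_pointwise`). Applied to `f` times a cutoff, with the inner cutoff radius tending
to zero, the estimate forces `f` to vanish near `x₀` as `τ → ∞`.
-/

noncomputable section

/-! ### Sign kernels of orthonormal families -/

/-- The theorem of Pythagoras for a combination of orthonormal functions. -/
theorem integrable_and_integral_sq_sum_mul_of_orthonormal {X : Type*} [MeasurableSpace X]
    {μ : Measure X} {n : ℕ} {φ : Fin n → X → ℝ} (hL2 : ∀ k, MemLp (φ k) 2 μ)
    (horth : ∀ j k, ∫ y, φ j y * φ k y ∂μ = if j = k then 1 else 0) (c : Fin n → ℝ) :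
    Integrable (fun y => (∑ k, c k * φ k y) ^ 2) μ ∧
      ∫ y, (∑ k, c k * φ k y) ^ 2 ∂μ = ∑ k, c k ^ 2 := by
  have hint : ∀ j k, Integrable (fun y => c j * c k * (φ j y * φ k y)) μ := fun j k =>
    ((hL2 j).integrable_mul (hL2 k)).const_mul _
  have hexp : (fun y => (∑ k, c k * φ k y) ^ 2) =
      fun y => ∑ j, ∑ k, c j * c k * (φ j y * φ k y) := by
    funext y
    rw [sq, Finset.sum_mul_sum]
    exact Finset.sum_congr rfl fun j _ => Finset.sum_congr rfl fun k _ => by ring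
  rw [hexp]
  refine ⟨integrable_finsetSum _ fun j _ => integrable_finsetSum _ fun k _ => hint j k, ?_⟩
  rw [integral_finsetSum _ fun j _ => integrable_finsetSum _ fun k _ => hint j k]
  refine Finset.sum_congr rfl fun j _ => ?_
  rw [integral_finsetSum _ fun k _ => hint j k]
  simp only [integral_const_mul, horth]
  simp [sq]

theorem Real.sign_sq_le_one (x : ℝ) : Real.sign x ^ 2 ≤ 1 := by
  rcases Real.sign_apply_eq x with h | h | h <;> rw [h] <;> norm_num

theorem Real.sign_sq_of_ne_zero {x : ℝ} (hx : x ≠ 0) : Real.sign x ^ 2 = 1 := by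
  rcases Real.sign_apply_eq_of_ne_zero x hx with h | h <;> rw [h] <;> norm_num

theorem Real.measurable_sign : Measurable Real.sign := by
  unfold Real.sign
  exact Measurable.ite measurableSet_Iio measurable_const
    (Measurable.ite measurableSet_Ioi measurable_const measurable_const)

/-- If no `φ k` vanishes on a set of positive measure, then `∑ₖ sgn(φₖ(x))² = n` for almost
every `x`, and the sign kernel of an orthonormal family has total mass `n`. -/
theorem signKernel_of_orthonormal_of_ae_ne_zero {X : Type*} [MeasurableSpace X]
    {μ : Measure X} [IsProbabilityMeasure μ] {n : ℕ} {φ : Fin n → X → ℝ}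
    (hL2 : ∀ k, MemLp (φ k) 2 μ)
    (horth : ∀ j k, ∫ y, φ j y * φ k y ∂μ = if j = k then 1 else 0)
    (hne : ∀ k, ∀ᵐ x ∂μ, φ k x ≠ 0) :
    (∀ x : X, Integrable (fun y => signKernel φ x y ^ 2) μ ∧
      ∫ y, signKernel φ x y ^ 2 ∂μ ≤ n) ∧
    Integrable (fun p : X × X => signKernel φ p.1 p.2 ^ 2) (μ.prod μ) ∧
    ∫ x, ∫ y, signKernel φ x y ^ 2 ∂μ ∂μ = n := by
  have key := fun x => integrable_and_integral_sq_sum_mul_of_orthonormal hL2 horth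
    (fun k => Real.sign (φ k x))
  refine ⟨fun x => ⟨(key x).1, ?_⟩, ?_, ?_⟩
  · refine (key x).2.trans_le ?_
    calc ∑ k, Real.sign (φ k x) ^ 2 ≤ ∑ _k : Fin n, (1 : ℝ) :=
          Finset.sum_le_sum fun k _ => Real.sign_sq_le_one _
      _ = n := by simp
  · have hexp : (fun p : X × X => signKernel φ p.1 p.2 ^ 2) = fun p => ∑ j, ∑ k,
        (Real.sign (φ j p.1) * Real.sign (φ k p.1)) * (φ j p.2 * φ k p.2) := by
      funext p
      rw [signKernel, sq, Finset.sum_mul_sum]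
      exact Finset.sum_congr rfl fun j _ => Finset.sum_congr rfl fun k _ => by ring
    rw [hexp]
    refine integrable_finsetSum _ fun j _ => integrable_finsetSum _ fun k _ => ?_
    have hs : ∀ k, AEStronglyMeasurable (fun x => Real.sign (φ k x)) μ := fun k =>
      (Real.measurable_sign.comp_aemeasurable
        (hL2 k).aestronglyMeasurable.aemeasurable).aestronglyMeasurable
    have hb : ∀ k x, ‖Real.sign (φ k x)‖ ≤ 1 := fun k x => by
      rw [Real.norm_eq_abs, ← sq_le_one_iff_abs_le_one]
      exact Real.sign_sq_le_one _
    refine Integrable.mul_prod (f := fun x => Real.sign (φ j x) * Real.sign (φ k x))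
      (g := fun y => φ j y * φ k y) ?_ ((hL2 j).integrable_mul (hL2 k))
    refine Integrable.of_bound ((hs j).mul (hs k)) 1 (.of_forall fun x => ?_)
    rw [norm_mul]
    exact mul_le_one₀ (hb j x) (norm_nonneg _) (hb k x)
  · have h1 : ∀ᵐ x ∂μ, ∫ y, signKernel φ x y ^ 2 ∂μ = n := by
      filter_upwards [ae_all_iff.2 hne] with x hx
      refine (key x).2.trans ?_
      simp [Real.sign_sq_of_ne_zero (hx _)]
    rw [integral_congr_ae h1]
    simp

/-! ### Divergence-form calculus on Euclidean space -/

namespace Riemann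

/-- Euclidean space `ℝᵈ`. -/
abbrev Euc (d : ℕ) : Type := EuclideanSpace ℝ (Fin d)

variable {d : ℕ}

theorem pderiv_add {f g : Euc d → ℝ} {x : Euc d} (hf : DifferentiableAt ℝ f x)
    (hg : DifferentiableAt ℝ g x) (i : Fin d) :
    pderiv i (fun y => f y + g y) x = pderiv i f x + pderiv i g x := by
  simp [pderiv, fderiv_fun_add hf hg]

theorem pderiv_sub {f g : Euc d → ℝ} {x : Euc d} (hf : DifferentiableAt ℝ f x)
    (hg : DifferentiableAt ℝ g x) (i : Fin d) :
    pderiv i (fun y => f y - g y) x = pderiv i f x - pderiv i g x := by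
  simp [pderiv, fderiv_fun_sub hf hg]

theorem pderiv_mul {f g : Euc d → ℝ} {x : Euc d} (hf : DifferentiableAt ℝ f x)
    (hg : DifferentiableAt ℝ g x) (i : Fin d) :
    pderiv i (fun y => f y * g y) x = pderiv i f x * g x + f x * pderiv i g x := by
  simp [pderiv, fderiv_fun_mul hf hg]; ring

theorem pderiv_const (c : ℝ) (x : Euc d) (i : Fin d) :
    pderiv i (fun _ => c) x = 0 := by
  simp [pderiv]

theorem pderiv_const_mul {f : Euc d → ℝ} {x : Euc d} (hf : DifferentiableAt ℝ f x)
    (c : ℝ) (i : Fin d) :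
    pderiv i (fun y => c * f y) x = c * pderiv i f x := by
  rw [pderiv_mul (differentiableAt_const c) hf, pderiv_const, zero_mul, zero_add]

theorem pderiv_sum {ι : Type*} {u : Finset ι} {f : ι → Euc d → ℝ} {x : Euc d}
    (hf : ∀ j ∈ u, DifferentiableAt ℝ (f j) x) (i : Fin d) :
    pderiv i (fun y => ∑ j ∈ u, f j y) x = ∑ j ∈ u, pderiv i (f j) x := by
  simp [pderiv, fderiv_fun_sum hf]

theorem pderiv_comp {k : ℝ → ℝ} {k' : ℝ} {s : Euc d → ℝ} {x : Euc d} (hk : HasDerivAt k k' (s x))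
    (hs : DifferentiableAt ℝ s x) (i : Fin d) :
    pderiv i (fun y => k (s y)) x = k' * pderiv i s x := by
  have h := (hk.comp_hasFDerivAt x hs.hasFDerivAt).fderiv
  have h' : fderiv ℝ (fun y => k (s y)) x = k' • fderiv ℝ s x := h
  simp [pderiv, h']

theorem pderiv_congr {f g : Euc d → ℝ} {x : Euc d} (h : f =ᶠ[nhds x] g) (i : Fin d) :
    pderiv i f x = pderiv i g x := by
  rw [pderiv, pderiv, h.fderiv_eq]

theorem eventuallyEq_pderiv {f g : Euc d → ℝ} {x : Euc d} (h : f =ᶠ[nhds x] g) (i : Fin d) :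
    pderiv i f =ᶠ[nhds x] pderiv i g := by
  filter_upwards [eventually_eventually_nhds.2 h] with y hy
  exact pderiv_congr hy i

theorem contDiffAt_pderiv {f : Euc d → ℝ} {x : Euc d} (hf : ContDiffAt ℝ ∞ f x) (i : Fin d) :
    ContDiffAt ℝ ∞ (pderiv i f) x :=
  (hf.fderiv_right (m := ∞) (by simp)).clm_apply contDiffAt_const

theorem pderiv_comm {f : Euc d → ℝ} {x : Euc d} (hf : ContDiffAt ℝ ∞ f x) (i j : Fin d) :
    pderiv i (pderiv j f) x = pderiv j (pderiv i f) x := by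
  have hd : DifferentiableAt ℝ (fderiv ℝ f) x :=
    (hf.fderiv_right (m := ∞) (by simp)).differentiableAt (by simp)
  have h2 : ∀ i j : Fin d, pderiv i (pderiv j f) x =
      fderiv ℝ (fderiv ℝ f) x (EuclideanSpace.single i 1) (EuclideanSpace.single j 1) := by
    intro i j
    have : pderiv j f = fun y => fderiv ℝ f y (EuclideanSpace.single j 1) := rfl
    rw [this, pderiv, fderiv_clm_apply hd (differentiableAt_const _)]
    simp
  rw [h2, h2]
  exact (hf.isSymmSndFDerivAt
    (by rw [minSmoothness_of_isRCLikeNormedField]; exact WithTop.coe_le_coe.2 le_top)).eq _ _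

/-- The divergence of a vector field on `ℝᵈ`. -/
def divg (W : Fin d → Euc d → ℝ) (x : Euc d) : ℝ := ∑ i, pderiv i (W i) x

/-- The derivative of `u` along the vector field `β`. -/
def along (β : Fin d → Euc d → ℝ) (u : Euc d → ℝ) (x : Euc d) : ℝ := ∑ i, β i x * pderiv i u x

/-- The vector field `A ∇u`. -/
def flux (A : Fin d → Fin d → Euc d → ℝ) (u : Euc d → ℝ) (i : Fin d) (x : Euc d) : ℝ :=
  ∑ j, A i j x * pderiv j u x

/-- The squared length `⟨A ∇u, ∇u⟩` of the gradient of `u`. -/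
def energy (A : Fin d → Fin d → Euc d → ℝ) (u : Euc d → ℝ) (x : Euc d) : ℝ :=
  ∑ i, flux A u i x * pderiv i u x

/-- The operator `div (A ∇u)`. -/
def ellip (A : Fin d → Fin d → Euc d → ℝ) (u : Euc d → ℝ) (x : Euc d) : ℝ := divg (flux A u) x

section Regularity

variable {A : Fin d → Fin d → Euc d → ℝ} {β : Fin d → Euc d → ℝ} {u : Euc d → ℝ} {x : Euc d}

theorem contDiffAt_finset_sum {ι : Type*} {t : Finset ι} {f : ι → Euc d → ℝ}
    (h : ∀ i ∈ t, ContDiffAt ℝ ∞ (f i) x) : ContDiffAt ℝ ∞ (fun y => ∑ i ∈ t, f i y) x :=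
  ContDiffAt.sum h

theorem contDiffAt_divg (h : ∀ i, ContDiffAt ℝ ∞ (β i) x) : ContDiffAt ℝ ∞ (divg β) x :=
  contDiffAt_finset_sum fun i _ => contDiffAt_pderiv (h i) i

theorem contDiffAt_along (h : ∀ i, ContDiffAt ℝ ∞ (β i) x) (hu : ContDiffAt ℝ ∞ u x) :
    ContDiffAt ℝ ∞ (along β u) x :=
  contDiffAt_finset_sum fun i _ => (h i).mul (contDiffAt_pderiv hu i)

theorem contDiffAt_flux (hA : ∀ i j, ContDiffAt ℝ ∞ (A i j) x) (hu : ContDiffAt ℝ ∞ u x)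
    (i : Fin d) : ContDiffAt ℝ ∞ (flux A u i) x :=
  contDiffAt_finset_sum fun j _ => (hA i j).mul (contDiffAt_pderiv hu j)

theorem contDiffAt_energy (hA : ∀ i j, ContDiffAt ℝ ∞ (A i j) x) (hu : ContDiffAt ℝ ∞ u x) :
    ContDiffAt ℝ ∞ (energy A u) x :=
  contDiffAt_finset_sum fun i _ => (contDiffAt_flux hA hu i).mul (contDiffAt_pderiv hu i)

theorem contDiffAt_ellip (hA : ∀ i j, ContDiffAt ℝ ∞ (A i j) x) (hu : ContDiffAt ℝ ∞ u x) :
    ContDiffAt ℝ ∞ (ellip A u) x :=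
  contDiffAt_divg fun i => contDiffAt_flux hA hu i

theorem _root_.ContDiffAt.differentiableAt_infty {f : Euc d → ℝ} (h : ContDiffAt ℝ ∞ f x) :
    DifferentiableAt ℝ f x := h.differentiableAt (by simp)

end Regularity

section Leibniz

variable {A : Fin d → Fin d → Euc d → ℝ} {β : Fin d → Euc d → ℝ} {u v f : Euc d → ℝ} {x : Euc d}

theorem divg_mul (hf : DifferentiableAt ℝ f x) (hβ : ∀ i, DifferentiableAt ℝ (β i) x) :
    divg (fun i y => f y * β i y) x = f x * divg β x + along β f x := by
  simp only [divg, along, Finset.mul_sum, ← Finset.sum_add_distrib]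
  exact Finset.sum_congr rfl fun i _ => by rw [pderiv_mul hf (hβ i)]; ring

theorem divg_add {β γ : Fin d → Euc d → ℝ} (hβ : ∀ i, DifferentiableAt ℝ (β i) x)
    (hγ : ∀ i, DifferentiableAt ℝ (γ i) x) :
    divg (fun i y => β i y + γ i y) x = divg β x + divg γ x := by
  simp only [divg, ← Finset.sum_add_distrib]
  exact Finset.sum_congr rfl fun i _ => pderiv_add (hβ i) (hγ i) i

theorem along_add (hu : DifferentiableAt ℝ u x) (hv : DifferentiableAt ℝ v x) :
    along β (fun y => u y + v y) x = along β u x + along β v x := by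
  simp only [along, ← Finset.sum_add_distrib]
  exact Finset.sum_congr rfl fun i _ => by rw [pderiv_add hu hv]; ring

theorem along_sub (hu : DifferentiableAt ℝ u x) (hv : DifferentiableAt ℝ v x) :
    along β (fun y => u y - v y) x = along β u x - along β v x := by
  simp only [along, ← Finset.sum_sub_distrib]
  exact Finset.sum_congr rfl fun i _ => by rw [pderiv_sub hu hv]; ring

theorem along_mul (hu : DifferentiableAt ℝ u x) (hv : DifferentiableAt ℝ v x) :
    along β (fun y => u y * v y) x = along β u x * v x + u x * along β v x := by
  simp only [along, Finset.mul_sum, Finset.sum_mul, ← Finset.sum_add_distrib]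
  exact Finset.sum_congr rfl fun i _ => by rw [pderiv_mul hu hv]; ring

theorem along_const_mul (hu : DifferentiableAt ℝ u x) (c : ℝ) :
    along β (fun y => c * u y) x = c * along β u x := by
  simp only [along, Finset.mul_sum]
  exact Finset.sum_congr rfl fun i _ => by rw [pderiv_const_mul hu]; ring

theorem along_comp {k : ℝ → ℝ} {k' : ℝ} (hk : HasDerivAt k k' (u x))
    (hu : DifferentiableAt ℝ u x) :
    along β (fun y => k (u y)) x = k' * along β u x := by
  simp only [along, Finset.mul_sum]
  exact Finset.sum_congr rfl fun i _ => by rw [pderiv_comp hk hu]; ring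

/-- The bilinear form `⟨A ∇u, ∇v⟩` is symmetric. -/
theorem along_flux_comm (hsymm : ∀ i j, A i j x = A j i x) :
    along (flux A u) v x = along (flux A v) u x := by
  simp only [along, flux, Finset.sum_mul]
  rw [Finset.sum_comm]
  exact Finset.sum_congr rfl fun i _ => Finset.sum_congr rfl fun j _ => by rw [hsymm]; ring

theorem flux_mul (hu : DifferentiableAt ℝ u x) (hv : DifferentiableAt ℝ v x) (i : Fin d) :
    flux A (fun y => u y * v y) i x = u x * flux A v i x + v x * flux A u i x := by
  simp only [flux, Finset.mul_sum, ← Finset.sum_add_distrib]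
  exact Finset.sum_congr rfl fun j _ => by rw [pderiv_mul hu hv]; ring

theorem divg_congr {β γ : Fin d → Euc d → ℝ} (h : ∀ i, β i =ᶠ[nhds x] γ i) :
    divg β x = divg γ x :=
  Finset.sum_congr rfl fun i _ => pderiv_congr (h i) i

theorem eventuallyEq_flux (h : u =ᶠ[nhds x] v) (i : Fin d) :
    flux A u i =ᶠ[nhds x] flux A v i := by
  have h' : ∀ j, pderiv j u =ᶠ[nhds x] pderiv j v := fun j => eventuallyEq_pderiv h j
  filter_upwards [Filter.eventually_all.2 h'] with y hy
  simp [flux, hy]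

theorem ellip_congr (h : u =ᶠ[nhds x] v) : ellip A u x = ellip A v x :=
  divg_congr fun i => eventuallyEq_flux h i

theorem flux_eq_zero (h : u =ᶠ[nhds x] fun _ => 0) (i : Fin d) : flux A u i x = 0 := by
  rw [(eventuallyEq_flux h i).eq_of_nhds]
  simp [flux, pderiv_const]

theorem ellip_eq_zero (h : u =ᶠ[nhds x] fun _ => 0) : ellip A u x = 0 := by
  have : flux A (fun _ => (0 : ℝ)) = fun _ _ => 0 := by
    funext i y; simp [flux, pderiv_const]
  rw [ellip_congr h]
  simp [ellip, this, divg, pderiv_const]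

theorem along_congr (h : u =ᶠ[nhds x] v) : along β u x = along β v x :=
  Finset.sum_congr rfl fun i _ => by rw [pderiv_congr h]

theorem _root_.ContDiffAt.eventually_infty {f : Euc d → ℝ} (h : ContDiffAt ℝ ∞ f x) :
    ∀ᶠ y in nhds x, DifferentiableAt ℝ f y := by
  have h1 : ContDiffAt ℝ 1 f x := h.of_le (by exact_mod_cast le_top)
  filter_upwards [h1.eventually (by simp)] with y hy
  exact hy.differentiableAt (by simp)

/-- The Leibniz rule `div (A ∇(uv)) = u div (A ∇v) + 2 ⟨A ∇u, ∇v⟩ + v div (A ∇u)`. -/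
theorem ellip_mul (hA : ∀ i j, ContDiffAt ℝ ∞ (A i j) x) (hsymm : ∀ i j, A i j x = A j i x)
    (hu : ContDiffAt ℝ ∞ u x) (hv : ContDiffAt ℝ ∞ v x) :
    ellip A (fun y => u y * v y) x =
      u x * ellip A v x + 2 * along (flux A u) v x + v x * ellip A u x := by
  have h1 : ∀ i, flux A (fun y => u y * v y) i =ᶠ[nhds x]
      fun y => u y * flux A v i y + v y * flux A u i y := fun i => by
    filter_upwards [hu.eventually_infty, hv.eventually_infty] with y hy1 hy2
    exact flux_mul hy1 hy2 i
  have fu := fun i => (contDiffAt_flux hA hu i).differentiableAt_infty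
  have fv := fun i => (contDiffAt_flux hA hv i).differentiableAt_infty
  rw [ellip, divg_congr h1, divg_add (fun i => hu.differentiableAt_infty.fun_mul (fv i))
    (fun i => hv.differentiableAt_infty.fun_mul (fu i)), divg_mul hu.differentiableAt_infty fv,
    divg_mul hv.differentiableAt_infty fu, along_flux_comm hsymm (u := v), ellip, ellip]
  ring

end Leibniz

section Rellich

variable {A : Fin d → Fin d → Euc d → ℝ} {β : Fin d → Euc d → ℝ} {v : Euc d → ℝ} {x : Euc d}

/-- The quadratic form `∑ (∂ᵢ βₖ) ∂ₖv (A ∇v)ᵢ` of the gradient of `v`, coming from the derivatives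
of the vector field `β`. -/
def stretch (A : Fin d → Fin d → Euc d → ℝ) (β : Fin d → Euc d → ℝ) (v : Euc d → ℝ)
    (x : Euc d) : ℝ :=
  ∑ i, ∑ k, pderiv i (β k) x * pderiv k v x * flux A v i x

/-- The quadratic form `⟨(∂_β A) ∇v, ∇v⟩` of the gradient of `v`, coming from the derivative of
`A` along the vector field `β`. -/
def drift (A : Fin d → Fin d → Euc d → ℝ) (β : Fin d → Euc d → ℝ) (v : Euc d → ℝ)
    (x : Euc d) : ℝ :=
  ∑ i, ∑ j, along β (A i j) x * pderiv i v x * pderiv j v x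

/-- The identity of Rellich: the second derivatives of `v` cancel in
`⟨A ∇v, ∇(∂_β v)⟩ - ½ ∂_β ⟨A ∇v, ∇v⟩`. -/
theorem along_flux_along (hA : ∀ i j, ContDiffAt ℝ ∞ (A i j) x)
    (hsymm : ∀ i j, A i j x = A j i x) (hβ : ∀ i, ContDiffAt ℝ ∞ (β i) x)
    (hv : ContDiffAt ℝ ∞ v x) :
    2 * along (flux A v) (along β v) x - along β (energy A v) x =
      2 * stretch A β v x - drift A β v x := by
  have dv := fun i => (contDiffAt_pderiv hv i).differentiableAt_infty
  have dA := fun i j => (hA i j).differentiableAt_infty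
  have dβ := fun i => (hβ i).differentiableAt_infty
  have h1 : along (flux A v) (along β v) x = stretch A β v x +
      ∑ i, ∑ k, flux A v i x * (β k x * pderiv k (pderiv i v) x) := by
    simp only [along, stretch, ← Finset.sum_add_distrib]
    refine Finset.sum_congr rfl fun i _ => ?_
    have : pderiv i (along β v) x =
        ∑ k, (pderiv i (β k) x * pderiv k v x + β k x * pderiv k (pderiv i v) x) := by
      change pderiv i (fun y => ∑ k, β k y * pderiv k v y) x = _
      rw [pderiv_sum fun k _ => (dβ k).fun_mul (dv k)]
      refine Finset.sum_congr rfl fun k _ => ?_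
      rw [pderiv_mul (dβ k) (dv k), pderiv_comm hv i k]
    rw [this, Finset.mul_sum]
    exact Finset.sum_congr rfl fun k _ => by ring
  have h2 : along β (energy A v) x = drift A β v x +
      2 * ∑ i, ∑ k, flux A v i x * (β k x * pderiv k (pderiv i v) x) := by
    have he : energy A v = fun y => ∑ i, ∑ j, A i j y * (pderiv i v y * pderiv j v y) := by
      funext y
      simp only [energy, flux, Finset.sum_mul]
      exact Finset.sum_congr rfl fun i _ => Finset.sum_congr rfl fun j _ => by ring
    have hp : ∀ k, pderiv k (energy A v) x = ∑ i, ∑ j,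
        (pderiv k (A i j) x * (pderiv i v x * pderiv j v x) +
          (A i j x * pderiv j v x * pderiv k (pderiv i v) x +
            A i j x * pderiv i v x * pderiv k (pderiv j v) x)) := by
      intro k
      rw [he, pderiv_sum fun i _ => DifferentiableAt.fun_sum fun j _ =>
        (dA i j).fun_mul ((dv i).fun_mul (dv j))]
      refine Finset.sum_congr rfl fun i _ => ?_
      rw [pderiv_sum fun j _ => (dA i j).fun_mul ((dv i).fun_mul (dv j))]
      refine Finset.sum_congr rfl fun j _ => ?_
      rw [pderiv_mul (dA i j) ((dv i).fun_mul (dv j)), pderiv_mul (dv i) (dv j)]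
      ring
    have e1 : ∑ k, β k x * ∑ i, ∑ j, pderiv k (A i j) x * (pderiv i v x * pderiv j v x) =
        drift A β v x := by
      simp only [drift, along, Finset.mul_sum, Finset.sum_mul]
      rw [Finset.sum_comm]
      refine Finset.sum_congr rfl fun i _ => ?_
      rw [Finset.sum_comm]
      exact Finset.sum_congr rfl fun j _ => Finset.sum_congr rfl fun k _ => by ring
    have e2 : ∑ k, β k x * ∑ i, ∑ j, A i j x * pderiv j v x * pderiv k (pderiv i v) x =
        ∑ i, ∑ k, flux A v i x * (β k x * pderiv k (pderiv i v) x) := by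
      simp only [flux, Finset.mul_sum, Finset.sum_mul]
      rw [Finset.sum_comm]
      exact Finset.sum_congr rfl fun i _ => Finset.sum_congr rfl fun k _ =>
        Finset.sum_congr rfl fun j _ => by ring
    have e3 : ∑ k, β k x * ∑ i, ∑ j, A i j x * pderiv i v x * pderiv k (pderiv j v) x =
        ∑ i, ∑ k, flux A v i x * (β k x * pderiv k (pderiv i v) x) := by
      rw [← e2]
      refine Finset.sum_congr rfl fun k _ => ?_
      rw [Finset.sum_comm]
      exact congrArg _ (Finset.sum_congr rfl fun i _ => Finset.sum_congr rfl fun j _ => by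
        rw [hsymm])
    have : along β (energy A v) x = ∑ k, β k x * pderiv k (energy A v) x := rfl
    rw [this, two_mul]
    nth_rewrite 1 [← e2]
    rw [← e3, ← e1]
    simp only [hp, Finset.sum_add_distrib, mul_add]
  rw [h1, h2]
  ring

end Rellich

section Integration

theorem continuous_of_eq_zero_off {X : Type*} [TopologicalSpace X] {f : X → ℝ} {K U : Set X}
    (hK : IsClosed K) (hU : IsOpen U) (hKU : K ⊆ U) (hf : ContinuousOn f U)
    (h0 : ∀ x ∉ K, f x = 0) : Continuous f := by
  rw [continuous_iff_continuousAt]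
  intro x
  by_cases hx : x ∈ U
  · exact hf.continuousAt (hU.mem_nhds hx)
  · have : f =ᶠ[nhds x] fun _ => 0 := by
      filter_upwards [hK.isOpen_compl.mem_nhds fun h => hx (hKU h)] with y hy using h0 y hy
    exact continuousAt_const.congr this.symm

theorem integrable_of_eq_zero_off {f : Euc d → ℝ} {K U : Set (Euc d)}
    (hK : IsCompact K) (hU : IsOpen U) (hKU : K ⊆ U) (hf : ContinuousOn f U)
    (h0 : ∀ x ∉ K, f x = 0) : Integrable f :=
  (continuous_of_eq_zero_off hK.isClosed hU hKU hf h0).integrable_of_hasCompactSupport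
    (HasCompactSupport.intro hK h0)

/-- The divergence theorem for a smooth vector field supported in a compact subset of `U`. -/
theorem integral_divg_eq_zero {W : Fin d → Euc d → ℝ} {K U : Set (Euc d)}
    (hK : IsCompact K) (hU : IsOpen U) (hKU : K ⊆ U)
    (hW : ∀ i, ∀ x ∈ U, ContDiffAt ℝ ∞ (W i) x) (h0 : ∀ i, ∀ x ∉ K, W i x = 0) :
    Integrable (divg W) ∧ ∫ x, divg W x = 0 := by
  have hsm : ∀ i x, ContDiffAt ℝ ∞ (W i) x := by
    intro i x
    by_cases hx : x ∈ U
    · exact hW i x hx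
    · have : W i =ᶠ[nhds x] fun _ => 0 := by
        filter_upwards [hK.isClosed.isOpen_compl.mem_nhds fun h => hx (hKU h)] with y hy
          using h0 i y hy
      exact contDiffAt_const.congr_of_eventuallyEq this
  have hp0 : ∀ i, ∀ x ∉ K, pderiv i (W i) x = 0 := by
    intro i x hx
    have : W i =ᶠ[nhds x] fun _ => 0 := by
      filter_upwards [hK.isClosed.isOpen_compl.mem_nhds hx] with y hy using h0 i y hy
    rw [pderiv_congr this, pderiv_const]
  have hint : ∀ i, Integrable (pderiv i (W i)) := fun i =>
    integrable_of_eq_zero_off hK hU hKU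
      (fun x hx => (contDiffAt_pderiv (hW i x hx) i).continuousAt.continuousWithinAt) (hp0 i)
  refine ⟨integrable_finsetSum _ fun i _ => hint i, ?_⟩
  have h1 : ∀ i, ∫ x, pderiv i (W i) x = 0 := by
    intro i
    have hi := integrable_of_eq_zero_off hK hU hKU
      (fun x hx => (hW i x hx).continuousAt.continuousWithinAt) (h0 i)
    -- integration by parts against the constant function `1`
    have := integral_mul_fderiv_eq_neg_fderiv_mul_of_integrable (μ := volume)
      (f := fun _ : Euc d => (1 : ℝ)) (g := W i) (v := EuclideanSpace.single i (1 : ℝ))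
      (by simp) (by simp only [one_mul]; exact hint i) (by simpa using hi)
      (fun x _ => differentiableAt_const _)
      (fun x _ => (hsm i x).differentiableAt_infty)
    simpa [pderiv] using this
  simp only [divg]
  rw [integral_finsetSum _ fun i _ => hint i]
  simp [h1]

end Integration

end Riemann

/-! ### The pointwise Carleman inequality -/

namespace Riemann

theorem abs_mul_le_of_abs_le {x y a b : ℝ} (hx : |x| ≤ a) (hy : |y| ≤ b) : |x * y| ≤ a * b := by
  rw [abs_mul]
  exact mul_le_mul hx hy (abs_nonneg y) ((abs_nonneg x).trans hx)

/-- The constants `100` and `1000` here and below are not optimized. -/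
theorem mul_le_of_mul_sq_le {C τ : ℝ} (hC : 1 ≤ C) (hτ : 1000 * C ^ 2 ≤ τ) : 1000 * C ≤ τ := by
  nlinarith

/-- The coefficient of the squared gradient is nonnegative. -/
theorem carleman_gradient_nonneg {C ε κ α γ E t₂ t₃ k τ : ℝ} (hC : 1 ≤ C) (hε : 0 ≤ ε)
    (hκ : |κ| ≤ C) (hk : k = 100 * C * ε) (hk8 : k ≤ 1 / 8) (hα : |α| ≤ ε) (hγ : |γ| ≤ ε)
    (hE : 0 ≤ E) (ht₂ : |t₂| ≤ ε * E) (ht₃ : |t₃| ≤ ε * E) (hτ : 0 ≤ τ) :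
    0 ≤ -(2 * τ * (1 - k) * (E + t₂))
      + τ * ((-k - κ * (1 - k)) * (1 + α) + (1 - k) * (γ + κ + 2)) * E
      + τ * (1 - k) * t₃ + 2 * τ * k * E := by
  have hk0 : 0 ≤ k := by rw [hk]; positivity
  have hCε : ε ≤ C * ε := by nlinarith
  have hκα : |κ * α| ≤ C * ε := abs_mul_le_of_abs_le hκ hα
  have e : -(2 * τ * (1 - k) * (E + t₂))
      + τ * ((-k - κ * (1 - k)) * (1 + α) + (1 - k) * (γ + κ + 2)) * E
      + τ * (1 - k) * t₃ + 2 * τ * k * E =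
      τ * (k * (1 - α) * E + (1 - k) * ((γ - κ * α) * E - 2 * t₂ + t₃)) := by ring
  rw [e]
  refine mul_nonneg hτ ?_
  have h1 : -(5 * (C * ε)) * E ≤ (γ - κ * α) * E - 2 * t₂ + t₃ := by
    have a1 : -(2 * (C * ε)) * E ≤ (γ - κ * α) * E := by
      refine mul_le_mul_of_nonneg_right ?_ hE
      linarith [(abs_le.1 hγ).1, (abs_le.1 hκα).2]
    have a2 : ε * E ≤ C * ε * E := mul_le_mul_of_nonneg_right hCε hE
    nlinarith [(abs_le.1 ht₂).2, (abs_le.1 ht₃).1]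
  have h2 : 50 * (C * ε) * E ≤ k * (1 - α) * E := by
    refine mul_le_mul_of_nonneg_right ?_ hE
    have : 1 / 2 ≤ 1 - α := by nlinarith [(abs_le.1 hα).2]
    nlinarith
  have h3 : 0 ≤ C * ε * E := by positivity
  nlinarith [mul_le_mul_of_nonneg_left h1 (show (0 : ℝ) ≤ 1 - k by linarith)]

/-- The coefficient of the product of `v` with its radial derivative is small. -/
theorem carleman_cross_le {C ε κ α γ k τ : ℝ} (hC : 1 ≤ C) (hε : 0 ≤ ε)
    (hκ : |κ| ≤ C) (hk : k = 100 * C * ε) (hk8 : k ≤ 1 / 8) (hα : |α| ≤ ε) (hγ : |γ| ≤ ε)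
    (hτ : 1000 * C ^ 2 ≤ τ) :
    |2 * τ ^ 2 * (1 - k) * (k * (1 - α) + (1 - k) * (γ - 2 * α)) + 2 * τ * k * (1 - κ)|
      ≤ 3 * τ ^ 2 * k := by
  have hk0 : 0 ≤ k := by rw [hk]; positivity
  have hεk : 100 * ε ≤ k := by nlinarith
  have hτ0 : 0 < τ := by linarith [mul_le_of_mul_sq_le hC hτ]
  have h1 : |k * (1 - α) + (1 - k) * (γ - 2 * α)| ≤ 5 / 4 * k := by
    have a1 : |γ - 2 * α| ≤ 3 * ε := by
      rw [abs_le] at *; constructor <;> linarith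
    have a2 : |(1 - k) * (γ - 2 * α)| ≤ 1 * (3 * ε) :=
      abs_mul_le_of_abs_le (by rw [abs_le]; constructor <;> linarith) a1
    have a3 : |k * (1 - α)| ≤ k * (11 / 10) :=
      abs_mul_le_of_abs_le (abs_of_nonneg hk0).le (by
        rw [abs_le] at *; constructor <;> linarith)
    refine (abs_add_le _ _).trans ?_
    linarith
  have h2 : |2 * τ ^ 2 * (1 - k) * (k * (1 - α) + (1 - k) * (γ - 2 * α))|
      ≤ 2 * τ ^ 2 * (5 / 4 * k) :=
    abs_mul_le_of_abs_le (by
      rw [abs_of_nonneg (by have : 0 ≤ 1 - k := by linarith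
                            positivity)]
      nlinarith [sq_nonneg τ]) h1
  have h3 : |2 * τ * k * (1 - κ)| ≤ 2 * τ * k * (2 * C) :=
    abs_mul_le_of_abs_le (abs_of_nonneg (by positivity)).le (by
      rw [abs_le] at *; constructor <;> linarith)
  have h4 : 2 * τ * k * (2 * C) ≤ 1 / 2 * τ ^ 2 * k := by
    have : 8 * C ≤ τ := by linarith [mul_le_of_mul_sq_le hC hτ]
    nlinarith [mul_le_mul_of_nonneg_left this (show 0 ≤ τ * k by positivity)]
  refine (abs_add_le _ _).trans ?_
  linarith

/-- The coefficient of `v²` is dominated by its leading part, of order `τ³`. -/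
theorem carleman_potential_ge {C ε κ α γ S k τ : ℝ} (hC : 1 ≤ C) (hε : 0 ≤ ε)
    (hκ : |κ| ≤ C) (hk : k = 100 * C * ε) (hk8 : k ≤ 1 / 8) (hα : |α| ≤ ε) (hγ : |γ| ≤ ε)
    (hS : |S| ≤ ε) (hτ : 1000 * C ^ 2 ≤ τ) :
    40 * C * ε * τ ^ 3 ≤
      τ ^ 3 * ((1 - k) ^ 2 * k * (3 * (1 + α) ^ 2 - 2 * (1 + α))
        - (1 - k) ^ 3 * ((1 + α) * (γ - (κ + 2) * α) + S))
      + τ ^ 2 * (-2 * k * (-k * (1 + α) + (1 - k) * (γ + κ - 2 * α)) - 4 * k ^ 2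
        - κ * (1 - k) ^ 2 * (γ - (κ + 2) * α) + 2 * κ * (1 + α) * (1 - k) * k) := by
  have hk0 : 0 ≤ k := by rw [hk]; positivity
  have hC0 : 0 ≤ C := by linarith
  have hεk : 100 * ε ≤ k := by nlinarith
  have hε8 : ε ≤ 1 / 800 := by linarith
  have hCε : ε ≤ C * ε := by nlinarith
  have hτ0 : 0 < τ := by linarith [mul_le_of_mul_sq_le hC hτ]
  have a0 : |(κ + 2) * α| ≤ 3 * C * ε := abs_mul_le_of_abs_le (by
    rw [abs_le] at *; constructor <;> linarith) hα
  have a1 : |γ - (κ + 2) * α| ≤ 4 * C * ε := by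
    rw [abs_le] at *; constructor <;> linarith
  have a2 : |1 + α| ≤ 9 / 8 := by rw [abs_le] at *; constructor <;> linarith
  have a3 : |(1 + α) * (γ - (κ + 2) * α) + S| ≤ 6 * C * ε := by
    have := abs_mul_le_of_abs_le a2 a1
    refine (abs_add_le _ _).trans ?_
    nlinarith
  have b1 : |1 - k| ≤ 1 := by rw [abs_le]; constructor <;> linarith
  have b3 : |(1 - k) ^ 3| ≤ 1 := by rw [abs_pow]; exact pow_le_one₀ (abs_nonneg _) b1
  have b2 : |(1 - k) ^ 2| ≤ 1 := by rw [abs_pow]; exact pow_le_one₀ (abs_nonneg _) b1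
  have c1 : |(1 - k) ^ 3 * ((1 + α) * (γ - (κ + 2) * α) + S)| ≤ 1 * (6 * C * ε) :=
    abs_mul_le_of_abs_le b3 a3
  have c2 : 60 * C * ε ≤ (1 - k) ^ 2 * k * (3 * (1 + α) ^ 2 - 2 * (1 + α)) := by
    have e1 : 49 / 64 ≤ (1 - k) ^ 2 := by nlinarith
    have e2 : 9 / 10 ≤ 3 * (1 + α) ^ 2 - 2 * (1 + α) := by
      rw [abs_le] at hα; nlinarith [sq_nonneg α]
    have e3 : 49 / 64 * k ≤ (1 - k) ^ 2 * k := mul_le_mul_of_nonneg_right e1 hk0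
    have e4 : 49 / 64 * k * (9 / 10) ≤ (1 - k) ^ 2 * k * (3 * (1 + α) ^ 2 - 2 * (1 + α)) :=
      mul_le_mul e3 e2 (by norm_num) (by positivity)
    have : 0 ≤ C * ε := by positivity
    linarith
  have d1 : |(-2 * k) * (-k * (1 + α) + (1 - k) * (γ + κ - 2 * α))| ≤ 2 * k * (4 * C) := by
    refine abs_mul_le_of_abs_le (by rw [abs_le]; constructor <;> linarith) ?_
    have f1 : |-k * (1 + α)| ≤ 1 / 8 * (9 / 8) :=
      abs_mul_le_of_abs_le (by rw [abs_le]; constructor <;> linarith) a2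
    have f2 : |(1 - k) * (γ + κ - 2 * α)| ≤ 1 * (C + 1 / 8) :=
      abs_mul_le_of_abs_le b1 (by rw [abs_le] at *; constructor <;> linarith)
    refine (abs_add_le _ _).trans ?_
    linarith
  have d2 : |κ * (1 - k) ^ 2 * (γ - (κ + 2) * α)| ≤ C * 1 * (4 * C * ε) :=
    abs_mul_le_of_abs_le (abs_mul_le_of_abs_le hκ b2) a1
  have d3 : |2 * κ * (1 + α) * (1 - k) * k| ≤ 2 * C * (9 / 8) * 1 * k :=
    abs_mul_le_of_abs_le (abs_mul_le_of_abs_le (abs_mul_le_of_abs_le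
      (by rw [abs_le] at *; constructor <;> linarith) a2) b1) (abs_of_nonneg hk0).le
  have d4 : 4 * k ^ 2 ≤ k := by nlinarith
  have g2 : -(1500 * C ^ 2 * ε) ≤
      -2 * k * (-k * (1 + α) + (1 - k) * (γ + κ - 2 * α)) - 4 * k ^ 2
        - κ * (1 - k) ^ 2 * (γ - (κ + 2) * α) + 2 * κ * (1 + α) * (1 - k) * k := by
    have i1 := (abs_le.1 d1).1
    have i2 := (abs_le.1 d2).2
    have i3 := (abs_le.1 d3).1
    have hkC : k * C = 100 * (C ^ 2 * ε) := by rw [hk]; ring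
    have hkk : k ≤ k * C := by nlinarith
    nlinarith
  have g3 : 54 * C * ε ≤ (1 - k) ^ 2 * k * (3 * (1 + α) ^ 2 - 2 * (1 + α))
        - (1 - k) ^ 3 * ((1 + α) * (γ - (κ + 2) * α) + S) := by
    linarith [(abs_le.1 c1).2]
  have j3 := mul_le_mul_of_nonneg_left g3 (show 0 ≤ τ ^ 3 by positivity)
  have j2 := mul_le_mul_of_nonneg_left g2 (show 0 ≤ τ ^ 2 by positivity)
  have j1 : 1500 * C ^ 2 * ε * τ ^ 2 ≤ 14 * C * ε * τ ^ 3 := by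
    have h : 1500 * C ≤ 14 * τ := by linarith [mul_le_of_mul_sq_le hC hτ]
    calc 1500 * C ^ 2 * ε * τ ^ 2 = (C * ε * τ ^ 2) * (1500 * C) := by ring
      _ ≤ (C * ε * τ ^ 2) * (14 * τ) := mul_le_mul_of_nonneg_left h (by positivity)
      _ = 14 * C * ε * τ ^ 3 := by ring
  linarith

/-- The pointwise inequality behind the Carleman estimate. Here `P = e^{2s} div (A ∇v)`,
`D` is the radial derivative of `v`, `E = e^{2s} ⟨A ∇v, ∇v⟩`, the weight is `h(s) = s - K eˢ` with
`k = K eˢ`, so that `h' = 1 - k` and `h'' = h''' = -k`, and `κ = d - 2`. The numbers `α`, `γ`, `S`,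
`t₂`, `t₃` are the deviations from the flat case of `∂_β s`, `div β`, `∂_β ∂_β s`, `stretch` and
`drift`; all are of relative size `ε = C eˢ`. On the left stands the divergence of the
vector field of the multiplier method, divided by `e^{-ds}`. The positive terms are multiples of
`k`, so the factor `100` in `k = 100 C ε` makes them absorb the errors. -/
theorem carleman_pointwise {C ε κ α γ S E t₂ t₃ k τ P D v : ℝ} (hC : 1 ≤ C) (hε : 0 ≤ ε)
    (hκ : |κ| ≤ C) (hk : k = 100 * C * ε) (hk8 : k ≤ 1 / 8) (hα : |α| ≤ ε) (hγ : |γ| ≤ ε)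
    (hS : |S| ≤ ε) (hE : 0 ≤ E) (ht₂ : |t₂| ≤ ε * E) (ht₃ : |t₃| ≤ ε * E)
    (hτ : 1000 * C ^ 2 ≤ τ) :
    (2 * τ * (1 - k) * D * P + 2 * τ * (-k - κ * (1 - k)) * D ^ 2
      + 2 * τ * (1 - k) * (E + t₂)
      - τ * ((-k - κ * (1 - k)) * (1 + α) + (1 - k) * (γ + κ + 2)) * E
      - τ * (1 - k) * t₃
      + 2 * τ * (-k) * v * P + 2 * τ * (-k) * E + 2 * τ * (-k - κ * (-k)) * v * D
      + 2 * (τ ^ 3 * (1 - k) ^ 3 * (1 + α) + τ ^ 2 * κ * (1 - k) ^ 2) * v * D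
      + v ^ 2 * ((τ ^ 3 * (1 - k) ^ 3 * (1 + α) + τ ^ 2 * κ * (1 - k) ^ 2) * (γ + κ + 2)
        + τ ^ 3 * (3 * (1 - k) ^ 2 * (-k) * (1 + α) ^ 2 + (1 - k) ^ 3 * S
          - (κ + 2) * (1 - k) ^ 3 * (1 + α) ^ 2)
        + τ ^ 2 * κ * (1 + α) * (2 * (1 - k) * (-k) - (κ + 2) * (1 - k) ^ 2)))
      + 10 * C * ε * τ ^ 3 * v ^ 2 ≤
    (P + 2 * τ * (1 - k) * D + (τ ^ 2 * (1 - k) ^ 2 * (1 + α)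
      + τ * (-k * (1 + α) + (1 - k) * (γ + κ - 2 * α))) * v) ^ 2 / 2 := by
  have hk0 : 0 ≤ k := by rw [hk]; positivity
  have hτ0 : 0 < τ := by linarith [mul_le_of_mul_sq_le hC hτ]
  have hC0 : 0 ≤ C := by linarith
  have hG := carleman_gradient_nonneg hC hε hκ hk hk8 hα hγ hE ht₂ ht₃ hτ0.le
  have hX := carleman_cross_le hC hε hκ hk hk8 hα hγ hτ
  have hV := carleman_potential_ge hC hε hκ hk hk8 hα hγ hS hτ
  set G := -(2 * τ * (1 - k) * (E + t₂))
      + τ * ((-k - κ * (1 - k)) * (1 + α) + (1 - k) * (γ + κ + 2)) * E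
      + τ * (1 - k) * t₃ + 2 * τ * k * E with hGdef
  set X := 2 * τ ^ 2 * (1 - k) * (k * (1 - α) + (1 - k) * (γ - 2 * α))
    + 2 * τ * k * (1 - κ) with hXdef
  set V := τ ^ 3 * ((1 - k) ^ 2 * k * (3 * (1 + α) ^ 2 - 2 * (1 + α))
        - (1 - k) ^ 3 * ((1 + α) * (γ - (κ + 2) * α) + S))
      + τ ^ 2 * (-2 * k * (-k * (1 + α) + (1 - k) * (γ + κ - 2 * α)) - 4 * k ^ 2
        - κ * (1 - k) ^ 2 * (γ - (κ + 2) * α) + 2 * κ * (1 + α) * (1 - k) * k) with hVdef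
  set F := P + 2 * τ * (1 - k) * D + (τ ^ 2 * (1 - k) ^ 2 * (1 + α)
      + τ * (-k * (1 + α) + (1 - k) * (γ + κ - 2 * α))) * v with hF
  set Y := 2 * τ * (1 - k) * D - 2 * τ * k * v with hY
  -- completing the square in `F - Y`
  have hid : F ^ 2 / 2 - (2 * τ * (1 - k) * D * P + 2 * τ * (-k - κ * (1 - k)) * D ^ 2
      + 2 * τ * (1 - k) * (E + t₂)
      - τ * ((-k - κ * (1 - k)) * (1 + α) + (1 - k) * (γ + κ + 2)) * E
      - τ * (1 - k) * t₃
      + 2 * τ * (-k) * v * P + 2 * τ * (-k) * E + 2 * τ * (-k - κ * (-k)) * v * D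
      + 2 * (τ ^ 3 * (1 - k) ^ 3 * (1 + α) + τ ^ 2 * κ * (1 - k) ^ 2) * v * D
      + v ^ 2 * ((τ ^ 3 * (1 - k) ^ 3 * (1 + α) + τ ^ 2 * κ * (1 - k) ^ 2) * (γ + κ + 2)
        + τ ^ 3 * (3 * (1 - k) ^ 2 * (-k) * (1 + α) ^ 2 + (1 - k) ^ 3 * S
          - (κ + 2) * (1 - k) ^ 3 * (1 + α) ^ 2)
        + τ ^ 2 * κ * (1 + α) * (2 * (1 - k) * (-k) - (κ + 2) * (1 - k) ^ 2))) =
      (F - Y) ^ 2 / 2 + Y ^ 2 / 2 + G + X * (v * D) + V * v ^ 2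
        + 2 * τ * (k + κ * (1 - k)) * D ^ 2 := by
    rw [hF, hY, hGdef, hXdef, hVdef]; ring
  have h1 : τ ^ 2 * (49 / 64) * D ^ 2 - 2 * τ ^ 2 * k ^ 2 * v ^ 2 ≤ Y ^ 2 / 2 := by
    have : τ ^ 2 * (1 - k) ^ 2 * D ^ 2 - 2 * τ ^ 2 * k ^ 2 * v ^ 2 ≤ Y ^ 2 / 2 := by
      rw [hY]; linarith [sq_nonneg (τ * (1 - k) * D - 2 * τ * k * v)]
    have h2 : (49 / 64 : ℝ) ≤ (1 - k) ^ 2 := by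
      have := pow_le_pow_left₀ (by norm_num) (show 7 / 8 ≤ 1 - k by linarith) 2
      linarith
    linarith [mul_le_mul_of_nonneg_left h2 (show 0 ≤ τ ^ 2 * D ^ 2 by positivity)]
  have h2 : -(4 * C * τ) * D ^ 2 ≤ 2 * τ * (k + κ * (1 - k)) * D ^ 2 := by
    refine mul_le_mul_of_nonneg_right ?_ (sq_nonneg D)
    have : |κ * (1 - k)| ≤ C * 1 :=
      abs_mul_le_of_abs_le hκ (by rw [abs_le]; constructor <;> linarith)
    have i : -(4 * C) ≤ 2 * (k + κ * (1 - k)) := by linarith [(abs_le.1 this).1]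
    calc -(4 * C * τ) = τ * -(4 * C) := by ring
      _ ≤ τ * (2 * (k + κ * (1 - k))) := mul_le_mul_of_nonneg_left i hτ0.le
      _ = 2 * τ * (k + κ * (1 - k)) := by ring
  have h3 : -(τ ^ 2 * (1 / 2) * D ^ 2 + 9 / 2 * τ ^ 2 * k ^ 2 * v ^ 2) ≤ X * (v * D) := by
    have i1 : |X * (v * D)| ≤ 3 * τ ^ 2 * k * |v * D| := by
      rw [abs_mul]; exact mul_le_mul_of_nonneg_right hX (abs_nonneg _)
    have i2 : 3 * τ ^ 2 * k * |v * D| ≤ τ ^ 2 * (1 / 2) * D ^ 2 + 9 / 2 * τ ^ 2 * k ^ 2 * v ^ 2 := by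
      rw [abs_mul, ← sq_abs D, ← sq_abs v]
      linarith [mul_nonneg (sq_nonneg τ) (sq_nonneg (|D| - 3 * k * |v|))]
    linarith [(abs_le.1 (i1.trans i2)).1]
  have h4 : 40 * C * ε * τ ^ 3 * v ^ 2 ≤ V * v ^ 2 :=
    mul_le_mul_of_nonneg_right hV (sq_nonneg v)
  have h5 : 4 * C * τ * D ^ 2 ≤ τ ^ 2 * (1 / 4) * D ^ 2 := by
    refine mul_le_mul_of_nonneg_right ?_ (sq_nonneg D)
    have i : 16 * C ≤ τ := by linarith [mul_le_of_mul_sq_le hC hτ]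
    calc 4 * C * τ = (1 / 4 * τ) * (16 * C) := by ring
      _ ≤ (1 / 4 * τ) * τ := mul_le_mul_of_nonneg_left i (by positivity)
      _ = τ ^ 2 * (1 / 4) := by ring
  have h6 : 13 / 2 * τ ^ 2 * k ^ 2 * v ^ 2 ≤ 30 * C * ε * τ ^ 3 * v ^ 2 := by
    have i1 : k ^ 2 ≤ 1 / 8 * k := by
      rw [sq]; exact mul_le_mul_of_nonneg_right hk8 hk0
    have i2 : (13 : ℝ) ≤ τ := by linarith [mul_le_of_mul_sq_le hC hτ]
    refine mul_le_mul_of_nonneg_right ?_ (sq_nonneg v)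
    calc 13 / 2 * τ ^ 2 * k ^ 2 ≤ 13 / 2 * τ ^ 2 * (1 / 8 * k) :=
          mul_le_mul_of_nonneg_left i1 (by positivity)
      _ = 325 / 4 * (C * ε * τ ^ 2) := by rw [hk]; ring
      _ ≤ (30 * τ) * (C * ε * τ ^ 2) :=
          mul_le_mul_of_nonneg_right (by linarith) (by positivity)
      _ = 30 * C * ε * τ ^ 3 := by ring
  have h7 : 0 ≤ (F - Y) ^ 2 / 2 := by positivity
  have h8 : 0 ≤ τ ^ 2 * D ^ 2 := by positivity
  linarith

end Riemann

/-! ### Polar functions and the Carleman multiplier -/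

namespace Riemann

variable {d : ℕ}

/-- The vector field `β = e^{2s} A ∇s`, which plays the role of the radial field `x`
if `e^s` plays the role of the distance to the origin. -/
def radialField (A : Fin d → Fin d → Euc d → ℝ) (s : Euc d → ℝ) (i : Fin d) (x : Euc d) : ℝ :=
  Real.exp (2 * s x) * flux A s i x

/-- The derivative of `s` along the radial field `e^{2s} A ∇s`; it is `1` in the flat case. -/
def radialSlope (A : Fin d → Fin d → Euc d → ℝ) (s : Euc d → ℝ) : Euc d → ℝ :=
  along (radialField A s) s

theorem flux_eq_exp_mul_radialField (A : Fin d → Fin d → Euc d → ℝ) (s : Euc d → ℝ) (i : Fin d)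
    (x : Euc d) : flux A s i x = Real.exp (-2 * s x) * radialField A s i x := by
  rw [radialField, ← mul_assoc, ← Real.exp_add]
  simp

/-- On the open set `U`, the function `s` is a logarithmic radial coordinate for the operator
`div (A ∇·)`: up to relative errors `C eˢ`, the radial field `β = e^{2s} A ∇s` has the derivatives
of the identity vector field, and `∂_β s = 1`. -/
structure IsPolar (A : Fin d → Fin d → Euc d → ℝ) (s : Euc d → ℝ) (U : Set (Euc d)) (C : ℝ) :
    Prop where
  isOpen : IsOpen U
  le_const : (d : ℝ) + 2 ≤ C
  smooth : ∀ x ∈ U, ∀ i j, ContDiffAt ℝ ∞ (A i j) x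
  symm : ∀ x ∈ U, ∀ i j, A i j x = A j i x
  smooth_log : ∀ x ∈ U, ContDiffAt ℝ ∞ s x
  energy_nonneg : ∀ x ∈ U, ∀ v, 0 ≤ energy A v x
  slope : ∀ x ∈ U, |radialSlope A s x - 1| ≤ C * Real.exp (s x)
  div : ∀ x ∈ U, |divg (radialField A s) x - d| ≤ C * Real.exp (s x)
  slope_deriv : ∀ x ∈ U, |along (radialField A s) (radialSlope A s) x| ≤ C * Real.exp (s x)
  stretch : ∀ x ∈ U, ∀ v, |stretch A (radialField A s) v x - energy A v x| ≤
    C * Real.exp (s x) * energy A v x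
  drift : ∀ x ∈ U, ∀ v, |drift A (radialField A s) v x| ≤ C * Real.exp (s x) * energy A v x

namespace IsPolar

variable {A : Fin d → Fin d → Euc d → ℝ} {s : Euc d → ℝ} {U : Set (Euc d)} {C : ℝ}
  (h : IsPolar A s U C) {x : Euc d} {u v : Euc d → ℝ}
include h

theorem contDiffAt_comp (hx : x ∈ U) {k : ℝ → ℝ} (hk : ContDiff ℝ ∞ k) :
    ContDiffAt ℝ ∞ (fun y => k (s y)) x :=
  hk.contDiffAt.comp x (h.smooth_log x hx)

theorem contDiffAt_radialField (hx : x ∈ U) (i : Fin d) :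
    ContDiffAt ℝ ∞ (radialField A s i) x :=
  (h.contDiffAt_comp hx (k := fun t => Real.exp (2 * t)) (by fun_prop)).mul
    (contDiffAt_flux (h.smooth x hx) (h.smooth_log x hx) i)

theorem contDiffAt_radialSlope (hx : x ∈ U) : ContDiffAt ℝ ∞ (radialSlope A s) x :=
  contDiffAt_along (h.contDiffAt_radialField hx) (h.smooth_log x hx)

theorem along_flux_log (hx : x ∈ U) :
    along (flux A v) s x = Real.exp (-2 * s x) * along (radialField A s) v x := by
  rw [along_flux_comm (h.symm x hx)]
  simp only [along, Finset.mul_sum]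
  exact Finset.sum_congr rfl fun i _ => by rw [flux_eq_exp_mul_radialField]; ring

theorem along_flux_comp (hx : x ∈ U) {k : ℝ → ℝ} {k' : ℝ} (hk : HasDerivAt k k' (s x)) :
    along (flux A v) (fun y => k (s y)) x =
      k' * (Real.exp (-2 * s x) * along (radialField A s) v x) := by
  rw [along_comp hk (h.smooth_log x hx).differentiableAt_infty, h.along_flux_log hx]

theorem along_radialField_comp (hx : x ∈ U) {k : ℝ → ℝ} {k' : ℝ} (hk : HasDerivAt k k' (s x)) :
    along (radialField A s) (fun y => k (s y)) x = k' * radialSlope A s x :=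
  along_comp hk (h.smooth_log x hx).differentiableAt_infty

/-- The operator on radial functions. -/
theorem ellip_comp (hx : x ∈ U) {k k₁ : ℝ → ℝ} {k₂ : ℝ} (hk : ∀ t, HasDerivAt k (k₁ t) t)
    (hk₁ : HasDerivAt k₁ k₂ (s x)) :
    ellip A (fun y => k (s y)) x = Real.exp (-2 * s x) * (k₂ * radialSlope A s x
      + k₁ (s x) * (divg (radialField A s) x - 2 * radialSlope A s x)) := by
  have hexp : HasDerivAt (fun t => Real.exp (-2 * t)) (Real.exp (-2 * s x) * (-2 * 1)) (s x) :=
    ((hasDerivAt_id (s x)).const_mul (-2)).exp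
  have h1 : ∀ i, flux A (fun y => k (s y)) i =ᶠ[nhds x]
      fun y => (k₁ (s y) * Real.exp (-2 * s y)) * radialField A s i y := fun i => by
    filter_upwards [(h.smooth_log x hx).eventually_infty] with y hy
    rw [mul_assoc, ← flux_eq_exp_mul_radialField, flux, flux, Finset.mul_sum]
    exact Finset.sum_congr rfl fun j _ => by rw [pderiv_comp (hk _) hy]; ring
  have hprod := hk₁.mul hexp
  have hd : DifferentiableAt ℝ (fun y => k₁ (s y) * Real.exp (-2 * s y)) x :=
    hprod.differentiableAt.comp x (h.smooth_log x hx).differentiableAt_infty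
  have h2 := h.along_radialField_comp hx hprod
  simp only [Pi.mul_apply] at h2
  rw [ellip, divg_congr h1, divg_mul hd
    (fun i => (h.contDiffAt_radialField hx i).differentiableAt_infty), h2]
  ring

/-- The operator on the product with a radial function. -/
theorem ellip_comp_mul (hx : x ∈ U) {k k₁ : ℝ → ℝ} {k₂ : ℝ} (hks : ContDiff ℝ ∞ k)
    (hk : ∀ t, HasDerivAt k (k₁ t) t) (hk₁ : HasDerivAt k₁ k₂ (s x)) (hv : ContDiffAt ℝ ∞ v x) :
    Real.exp (2 * s x) * ellip A (fun y => k (s y) * v y) x =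
      k (s x) * (Real.exp (2 * s x) * ellip A v x)
      + 2 * k₁ (s x) * along (radialField A s) v x
      + v x * (k₂ * radialSlope A s x
        + k₁ (s x) * (divg (radialField A s) x - 2 * radialSlope A s x)) := by
  rw [ellip_mul (h.smooth x hx) (h.symm x hx) (h.contDiffAt_comp hx hks) hv,
    h.ellip_comp hx hk hk₁, along_flux_comm (h.symm x hx) (u := fun y => k (s y)),
    h.along_flux_comp hx (hk _)]
  have : Real.exp (-2 * s x) = (Real.exp (2 * s x))⁻¹ := by rw [← Real.exp_neg]; ring_nf
  rw [this]
  field_simp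

/-- The divergence of the vector field of the multiplier method, with multiplier
`a ∂_β v + b v` for radial weights `a` and `b`. -/
theorem divg_multiplier (hx : x ∈ U) {a b : ℝ → ℝ} {a' b' : ℝ} {c : Euc d → ℝ}
    (has : ContDiff ℝ ∞ a) (hbs : ContDiff ℝ ∞ b) (ha : HasDerivAt a a' (s x))
    (hb : HasDerivAt b b' (s x)) (hc : DifferentiableAt ℝ c x) (hv : ContDiffAt ℝ ∞ v x) :
    divg (fun i y => (a (s y) * along (radialField A s) v y + b (s y) * v y) * flux A v i y
      + (c y * (v y * v y) - a (s y) * energy A v y / 2) * radialField A s i y) x =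
    (a (s x) * along (radialField A s) v x + b (s x) * v x) * ellip A v x
    + a' * Real.exp (-2 * s x) * along (radialField A s) v x ^ 2
    + a (s x) * (Riemann.stretch A (radialField A s) v x
        - Riemann.drift A (radialField A s) v x / 2)
    + b' * Real.exp (-2 * s x) * along (radialField A s) v x * v x
    + b (s x) * energy A v x
    + (c x * v x ^ 2 - a (s x) * energy A v x / 2) * divg (radialField A s) x
    + along (radialField A s) c x * v x ^ 2
    + 2 * c x * v x * along (radialField A s) v x
    - a' * radialSlope A s x * energy A v x / 2 := by
  have da := (h.contDiffAt_comp hx has).differentiableAt_infty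
  have db := (h.contDiffAt_comp hx hbs).differentiableAt_infty
  have dv := hv.differentiableAt_infty
  have dD := (contDiffAt_along (h.contDiffAt_radialField hx) hv).differentiableAt_infty
  have dE := (contDiffAt_energy (h.smooth x hx) hv).differentiableAt_infty
  have dF := fun i => (contDiffAt_flux (h.smooth x hx) hv i).differentiableAt_infty
  have dβ := fun i => (h.contDiffAt_radialField hx i).differentiableAt_infty
  have e1 := along_flux_along (h.smooth x hx) (h.symm x hx) (h.contDiffAt_radialField hx) hv
  have e2 : along (flux A v) v x = energy A v x := rfl
  have dc : DifferentiableAt ℝ (fun y => c y * (v y * v y)) x := hc.fun_mul (dv.fun_mul dv)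
  have dQ : DifferentiableAt ℝ (fun y => a (s y) * energy A v y / 2) x := by
    simpa only [div_eq_mul_inv] using (da.fun_mul dE).mul_const (2 : ℝ)⁻¹
  have e3 : along (radialField A s) (fun y => a (s y) * energy A v y / 2) x =
      (a' * radialSlope A s x * energy A v x
        + a (s x) * along (radialField A s) (energy A v) x) / 2 := by
    have : (fun y => a (s y) * energy A v y / 2) =
        fun y => (1 / 2) * (a (s y) * energy A v y) := by funext y; ring
    rw [this, along_const_mul (da.fun_mul dE), along_mul da dE, h.along_radialField_comp hx ha]
    ring
  rw [divg_add (fun i => ((da.fun_mul dD).fun_add (db.fun_mul dv)).fun_mul (dF i))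
      (fun i => (dc.fun_sub dQ).fun_mul (dβ i)),
    divg_mul ((da.fun_mul dD).fun_add (db.fun_mul dv)) dF, divg_mul (dc.fun_sub dQ) dβ,
    along_add (da.fun_mul dD) (db.fun_mul dv), along_mul da dD, along_mul db dv,
    along_sub dc dQ, e3, along_mul hc (dv.fun_mul dv), along_mul dv dv,
    h.along_flux_comp hx ha, h.along_flux_comp hx hb, e2, ellip]
  linear_combination (a (s x) / 2) * e1

end IsPolar

/-- The logarithm of the weight, `h(t) = t - K eᵗ`, in the Carleman estimate. It is
strictly concave for `K > 0`, and this makes the Carleman estimate work. -/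
def carlemanLog (K t : ℝ) : ℝ := t - K * Real.exp t

theorem hasDerivAt_carlemanLog (K t : ℝ) :
    HasDerivAt (carlemanLog K) (1 - K * Real.exp t) t :=
  (hasDerivAt_id t).sub ((Real.hasDerivAt_exp t).const_mul K)

theorem contDiff_carlemanLog (K : ℝ) : ContDiff ℝ ∞ (carlemanLog K) := by
  unfold carlemanLog; fun_prop

theorem hasDerivAt_one_sub_exp (K t : ℝ) :
    HasDerivAt (fun t => 1 - K * Real.exp t) (-(K * Real.exp t)) t :=
  ((Real.hasDerivAt_exp t).const_mul K).const_sub 1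

theorem hasDerivAt_exp_mul (κ t : ℝ) :
    HasDerivAt (fun t => Real.exp (κ * t)) (κ * Real.exp (κ * t)) t := by
  have := ((hasDerivAt_id t).const_mul κ).exp
  simpa [mul_comm] using this

namespace IsPolar

variable {A : Fin d → Fin d → Euc d → ℝ} {s : Euc d → ℝ} {U : Set (Euc d)} {C : ℝ}
  (h : IsPolar A s U C) {x : Euc d} {u v : Euc d → ℝ}
include h

/-- The multiplier method applied to `v`, with the weights of the Carleman estimate: up to a
divergence, the weighted square of the conjugated operator controls `τ³ eˢ v²`. -/
theorem divg_multiplier_le (hx : x ∈ U) (hsmall : 100 * C ^ 2 * Real.exp (s x) ≤ 1 / 8) {τ : ℝ}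
    (hτ : 1000 * C ^ 2 ≤ τ) (hv : ContDiffAt ℝ ∞ v x) :
    divg (fun i y =>
      ((2 * τ * (1 - 100 * C ^ 2 * Real.exp (s y)) * Real.exp ((2 - d) * s y)) *
          along (radialField A s) v y +
        (2 * τ * -(100 * C ^ 2 * Real.exp (s y)) * Real.exp ((2 - d) * s y)) * v y) * flux A v i y
      + ((τ ^ 3 * (1 - 100 * C ^ 2 * Real.exp (s y)) ^ 3 * Real.exp (-d * s y) * radialSlope A s y
            + τ ^ 2 * (d - 2) * (1 - 100 * C ^ 2 * Real.exp (s y)) ^ 2 * Real.exp (-d * s y))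
          * (v y * v y)
        - (2 * τ * (1 - 100 * C ^ 2 * Real.exp (s y)) * Real.exp ((2 - d) * s y))
          * energy A v y / 2) * radialField A s i y) x
      + Real.exp (-d * s x) * (10 * C ^ 2 * Real.exp (s x) * τ ^ 3 * v x ^ 2) ≤
    Real.exp (-d * s x) * ((Real.exp (2 * s x) * ellip A v x
      + 2 * τ * (1 - 100 * C ^ 2 * Real.exp (s x)) * along (radialField A s) v x
      + (τ ^ 2 * (1 - 100 * C ^ 2 * Real.exp (s x)) ^ 2 * radialSlope A s x
        + τ * (-(100 * C ^ 2 * Real.exp (s x)) * radialSlope A s x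
          + (1 - 100 * C ^ 2 * Real.exp (s x)) *
            (divg (radialField A s) x - 2 * radialSlope A s x))) * v x) ^ 2 / 2) := by
  set K := 100 * C ^ 2 with hK
  have hC : 1 ≤ C := by
    have := h.le_const
    have : (0 : ℝ) ≤ d := Nat.cast_nonneg d
    linarith
  have hd := hasDerivAt_one_sub_exp K (s x)
  have ha : HasDerivAt (fun t => 2 * τ * (1 - K * Real.exp t) * Real.exp ((2 - d) * t))
      (2 * τ * (-(K * Real.exp (s x)) - (d - 2) * (1 - K * Real.exp (s x)))
        * Real.exp ((2 - d) * s x)) (s x) := by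
    refine ((hd.const_mul (2 * τ)).mul (hasDerivAt_exp_mul (2 - d) (s x))).congr_deriv ?_
    ring
  have hb : HasDerivAt (fun t => 2 * τ * -(K * Real.exp t) * Real.exp ((2 - d) * t))
      (2 * τ * (-(K * Real.exp (s x)) - (d - 2) * -(K * Real.exp (s x)))
        * Real.exp ((2 - d) * s x)) (s x) := by
    refine ((((Real.hasDerivAt_exp (s x)).const_mul K).neg.const_mul (2 * τ)).mul
      (hasDerivAt_exp_mul (2 - d) (s x))).congr_deriv ?_
    simp only [Pi.neg_apply]
    ring
  have hc₁ : HasDerivAt (fun t => τ ^ 3 * (1 - K * Real.exp t) ^ 3 * Real.exp (-d * t))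
      (τ ^ 3 * (3 * (1 - K * Real.exp (s x)) ^ 2 * -(K * Real.exp (s x))
        - d * (1 - K * Real.exp (s x)) ^ 3) * Real.exp (-d * s x)) (s x) := by
    refine (((hd.pow 3).const_mul (τ ^ 3)).mul
      (hasDerivAt_exp_mul (-d) (s x))).congr_deriv ?_
    simp
    ring
  have hc₂ : HasDerivAt (fun t => τ ^ 2 * (d - 2) * (1 - K * Real.exp t) ^ 2 * Real.exp (-d * t))
      (τ ^ 2 * (d - 2) * (2 * (1 - K * Real.exp (s x)) * -(K * Real.exp (s x))
        - d * (1 - K * Real.exp (s x)) ^ 2) * Real.exp (-d * s x)) (s x) := by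
    refine (((hd.pow 2).const_mul (τ ^ 2 * (d - 2))).mul
      (hasDerivAt_exp_mul (-d) (s x))).congr_deriv ?_
    simp
    ring
  have dσ := (h.contDiffAt_radialSlope hx).differentiableAt_infty
  have dc₁ := (h.contDiffAt_comp hx (k := fun t =>
    τ ^ 3 * (1 - K * Real.exp t) ^ 3 * Real.exp (-d * t)) (by fun_prop)).differentiableAt_infty
  have dc₂ := (h.contDiffAt_comp hx (k := fun t =>
    τ ^ 2 * (d - 2) * (1 - K * Real.exp t) ^ 2 * Real.exp (-d * t))
    (by fun_prop)).differentiableAt_infty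
  rw [h.divg_multiplier hx (by fun_prop) (by fun_prop) ha hb ((dc₁.fun_mul dσ).fun_add dc₂) hv,
    along_add (dc₁.fun_mul dσ) dc₂, along_mul dc₁ dσ, h.along_radialField_comp hx hc₁,
    h.along_radialField_comp hx hc₂]
  have hexp2 : Real.exp (-2 * s x) * Real.exp (2 * s x) = 1 := by
    rw [← Real.exp_add]; simp
  have hexpd : Real.exp ((2 - d) * s x) = Real.exp (-d * s x) * Real.exp (2 * s x) := by
    rw [← Real.exp_add]; ring_nf
  have hE := h.energy_nonneg x hx v
  have hr := Real.exp_pos (2 * s x)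
  have hst := mul_le_mul_of_nonneg_left (h.stretch x hx v) hr.le
  have hdr := mul_le_mul_of_nonneg_left (h.drift x hx v) hr.le
  have key := carleman_pointwise (C := C) (ε := C * Real.exp (s x)) (κ := d - 2)
    (α := radialSlope A s x - 1) (γ := divg (radialField A s) x - d)
    (S := along (radialField A s) (radialSlope A s) x) (E := Real.exp (2 * s x) * energy A v x)
    (t₂ := Real.exp (2 * s x) * (Riemann.stretch A (radialField A s) v x - energy A v x))
    (t₃ := Real.exp (2 * s x) * Riemann.drift A (radialField A s) v x)
    (k := K * Real.exp (s x)) (τ := τ) (P := Real.exp (2 * s x) * ellip A v x)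
    (D := along (radialField A s) v x) (v := v x) hC
    (by have := Real.exp_pos (s x); positivity)
    (by have := h.le_const
        have : (0 : ℝ) ≤ d := Nat.cast_nonneg d
        rw [abs_le]; constructor <;> linarith)
    (by rw [hK]; ring) hsmall (h.slope x hx) (h.div x hx) (h.slope_deriv x hx) (by positivity)
    (by rw [abs_mul, abs_of_pos hr]; linarith) (by rw [abs_mul, abs_of_pos hr]; linarith) hτ
  refine le_trans (le_of_eq ?_) ((mul_le_mul_of_nonneg_left key
    (Real.exp_pos (-d * s x)).le).trans (le_of_eq ?_))
  · rw [hexpd]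
    have hm := hexp2
    generalize Real.exp (-2 * s x) = q at hm ⊢
    generalize Real.exp (2 * s x) = r at hm ⊢
    linear_combination (Real.exp (-d * s x) * (2 * τ * (-(K * Real.exp (s x)) -
      (d - 2) * (1 - K * Real.exp (s x))) * along (radialField A s) v x ^ 2
      + 2 * τ * (-(K * Real.exp (s x)) - (d - 2) * -(K * Real.exp (s x))) *
        along (radialField A s) v x * v x)) * hm
  · ring

end IsPolar

end Riemann

/-! ### The Carleman estimate -/

namespace Riemann

variable {d : ℕ}

/-- The weight `e^{-ds} e^{-2τh(s)}`, `h(t) = t - K eᵗ`, of the Carleman estimate, as a function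
of the logarithmic radius `s`. It is comparable to the power `-d-2τ` of the radius. -/
def carlemanWeight (d : ℕ) (K τ t : ℝ) : ℝ :=
  Real.exp (-d * t) * Real.exp (-τ * carlemanLog K t) ^ 2

theorem contDiff_carlemanWeight (d : ℕ) (K τ : ℝ) : ContDiff ℝ ∞ (carlemanWeight d K τ) := by
  have := contDiff_carlemanLog K
  unfold carlemanWeight
  fun_prop

theorem carlemanWeight_pos (d : ℕ) (K τ t : ℝ) : 0 < carlemanWeight d K τ t := by
  unfold carlemanWeight; positivity

namespace IsPolar

variable {A : Fin d → Fin d → Euc d → ℝ} {s : Euc d → ℝ} {U : Set (Euc d)} {C : ℝ}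
  (h : IsPolar A s U C) {x : Euc d} {u v : Euc d → ℝ}
include h

/-- Conjugation of the operator with the weight `e^{τh(s)}`: the operator applied to `u`,
expressed through `v = e^{-τh(s)} u`. -/
theorem ellip_conj (hx : x ∈ U) (K τ : ℝ) (hu : ContDiffAt ℝ ∞ u x) :
    Real.exp (2 * s x) * ellip A (fun y => Real.exp (-τ * carlemanLog K (s y)) * u y) x
      + 2 * τ * (1 - K * Real.exp (s x)) *
        along (radialField A s) (fun y => Real.exp (-τ * carlemanLog K (s y)) * u y) x
      + (τ ^ 2 * (1 - K * Real.exp (s x)) ^ 2 * radialSlope A s x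
        + τ * (-(K * Real.exp (s x)) * radialSlope A s x
          + (1 - K * Real.exp (s x)) *
            (divg (radialField A s) x - 2 * radialSlope A s x)))
        * (Real.exp (-τ * carlemanLog K (s x)) * u x) =
    Real.exp (-τ * carlemanLog K (s x)) * (Real.exp (2 * s x) * ellip A u x) := by
  have hh := contDiff_carlemanLog K
  have hv : ContDiffAt ℝ ∞ (fun y => Real.exp (-τ * carlemanLog K (s y)) * u y) x :=
    (h.contDiffAt_comp hx (k := fun t => Real.exp (-τ * carlemanLog K t)) (by fun_prop)).mul hu
  have hk : ∀ t, HasDerivAt (fun t => Real.exp (τ * carlemanLog K t))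
      (τ * (1 - K * Real.exp t) * Real.exp (τ * carlemanLog K t)) t := fun t => by
    refine ((hasDerivAt_carlemanLog K t).const_mul τ).exp.congr_deriv ?_
    ring
  have hk₁ : HasDerivAt (fun t => τ * (1 - K * Real.exp t) * Real.exp (τ * carlemanLog K t))
      ((τ * -(K * Real.exp (s x)) + τ ^ 2 * (1 - K * Real.exp (s x)) ^ 2)
        * Real.exp (τ * carlemanLog K (s x))) (s x) := by
    refine (((hasDerivAt_one_sub_exp K (s x)).const_mul τ).mul (hk (s x))).congr_deriv ?_
    ring
  have key := h.ellip_comp_mul hx (by fun_prop) hk hk₁ hv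
  have hinv : ∀ t, Real.exp (τ * carlemanLog K t) * Real.exp (-τ * carlemanLog K t) = 1 := fun t => by
    rw [← Real.exp_add]; simp
  have e : (fun y => Real.exp (τ * carlemanLog K (s y)) *
      (Real.exp (-τ * carlemanLog K (s y)) * u y)) = u := by
    funext y; rw [← mul_assoc, hinv, one_mul]
  rw [e] at key
  rw [key]
  generalize ellip A (fun y => Real.exp (-τ * carlemanLog K (s y)) * u y) x = P
  generalize along (radialField A s) (fun y => Real.exp (-τ * carlemanLog K (s y)) * u y) x = D
  have hi := hinv (s x)
  generalize Real.exp (τ * carlemanLog K (s x)) = p at hi ⊢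
  generalize Real.exp (-τ * carlemanLog K (s x)) = q at hi ⊢
  linear_combination (-(Real.exp (2 * s x) * P) - 2 * τ * (1 - K * Real.exp (s x)) * D
    - (τ ^ 2 * (1 - K * Real.exp (s x)) ^ 2 * radialSlope A s x
        + τ * (-(K * Real.exp (s x)) * radialSlope A s x
          + (1 - K * Real.exp (s x)) *
            (divg (radialField A s) x - 2 * radialSlope A s x))) * q * u x) * hi

/-- **Carleman estimate** with a singular weight, for functions supported away from the origin of
the polar coordinates. -/
theorem carleman_estimate (hsmall : ∀ x ∈ U, 100 * C ^ 2 * Real.exp (s x) ≤ 1 / 8) {τ : ℝ}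
    (hτ : 1000 * C ^ 2 ≤ τ) {K : Set (Euc d)} (hK : IsCompact K) (hKU : K ⊆ U)
    (hu : ∀ x ∈ U, ContDiffAt ℝ ∞ u x) (hu0 : ∀ x ∉ K, u x = 0) :
    Integrable (fun x => carlemanWeight d (100 * C ^ 2) τ (s x) * (Real.exp (s x) * u x ^ 2)) ∧
    Integrable (fun x => carlemanWeight d (100 * C ^ 2) τ (s x)
      * (Real.exp (2 * s x) * ellip A u x) ^ 2) ∧
    τ ^ 3 * ∫ x, carlemanWeight d (100 * C ^ 2) τ (s x) * (Real.exp (s x) * u x ^ 2) ≤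
      ∫ x, carlemanWeight d (100 * C ^ 2) τ (s x) * (Real.exp (2 * s x) * ellip A u x) ^ 2 := by
  have hC : 1 ≤ C := by
    have := h.le_const
    have : (0 : ℝ) ≤ d := Nat.cast_nonneg d
    linarith
  have hτ0 : 0 < τ := by nlinarith
  set w := carlemanWeight d (100 * C ^ 2) τ with hw
  have hws := contDiff_carlemanWeight d (100 * C ^ 2) τ
  have cw : ∀ x ∈ U, ContDiffAt ℝ ∞ (fun y => w (s y)) x := fun x hx => h.contDiffAt_comp hx hws
  have cexp : ∀ (c : ℝ), ∀ x ∈ U, ContDiffAt ℝ ∞ (fun y => Real.exp (c * s y)) x := fun c x hx =>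
    h.contDiffAt_comp hx (k := fun t => Real.exp (c * t)) (by fun_prop)
  have cexp1 : ∀ x ∈ U, ContDiffAt ℝ ∞ (fun y => Real.exp (s y)) x := fun x hx =>
    h.contDiffAt_comp hx (k := fun t => Real.exp t) (by fun_prop)
  have hev0 : ∀ x ∉ K, u =ᶠ[nhds x] fun _ => 0 := fun x hx => by
    filter_upwards [hK.isClosed.isOpen_compl.mem_nhds hx] with y hy using hu0 y hy
  have hP0 : ∀ x ∉ K, ellip A u x = 0 := fun x hx => ellip_eq_zero (hev0 x hx)
  have I1 : Integrable (fun x => w (s x) * (Real.exp (s x) * u x ^ 2)) :=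
    integrable_of_eq_zero_off hK h.isOpen hKU
      (fun x hx => ((cw x hx).mul ((cexp1 x hx).mul
        ((hu x hx).pow 2))).continuousAt.continuousWithinAt)
      (fun x hx => by simp [hu0 x hx])
  have I2 : Integrable (fun x => w (s x) * (Real.exp (2 * s x) * ellip A u x) ^ 2) :=
    integrable_of_eq_zero_off hK h.isOpen hKU
      (fun x hx => ((cw x hx).mul (((cexp 2 x hx).mul
        (contDiffAt_ellip (h.smooth x hx) (hu x hx))).pow 2)).continuousAt.continuousWithinAt)
      (fun x hx => by simp [hP0 x hx])
  refine ⟨I1, I2, ?_⟩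
  have hh := contDiff_carlemanLog (100 * C ^ 2)
  let v : Euc d → ℝ := fun y => Real.exp (-τ * carlemanLog (100 * C ^ 2) (s y)) * u y
  have cv : ∀ x ∈ U, ContDiffAt ℝ ∞ v x := fun x hx =>
    (h.contDiffAt_comp hx (k := fun t => Real.exp (-τ * carlemanLog (100 * C ^ 2) t))
      (by fun_prop)).mul (hu x hx)
  have hv0 : ∀ x ∉ K, v =ᶠ[nhds x] fun _ => 0 := fun x hx => by
    filter_upwards [hev0 x hx] with y hy
    simp [v, hy]
  have hvz : ∀ x ∉ K, v x = 0 := fun x hx => (hv0 x hx).eq_of_nhds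
  have hflux0 : ∀ x ∉ K, ∀ i, flux A v i x = 0 := fun x hx i => flux_eq_zero (hv0 x hx) i
  have hE0 : ∀ x ∉ K, energy A v x = 0 := fun x hx => by
    simp [energy, hflux0 x hx]
  -- the vector field of the multiplier method, applied to the conjugated function `v`
  let W : Fin d → Euc d → ℝ := fun i y =>
    ((2 * τ * (1 - 100 * C ^ 2 * Real.exp (s y)) * Real.exp ((2 - d) * s y)) *
          along (radialField A s) v y +
        (2 * τ * -(100 * C ^ 2 * Real.exp (s y)) * Real.exp ((2 - d) * s y)) * v y) * flux A v i y
      + ((τ ^ 3 * (1 - 100 * C ^ 2 * Real.exp (s y)) ^ 3 * Real.exp (-d * s y) * radialSlope A s y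
            + τ ^ 2 * (d - 2) * (1 - 100 * C ^ 2 * Real.exp (s y)) ^ 2 * Real.exp (-d * s y))
          * (v y * v y)
        - (2 * τ * (1 - 100 * C ^ 2 * Real.exp (s y)) * Real.exp ((2 - d) * s y))
          * energy A v y / 2) * radialField A s i y
  have cW : ∀ i, ∀ x ∈ U, ContDiffAt ℝ ∞ (W i) x := fun i x hx => by
    have c1 := cexp1 x hx
    have c2 := cexp (2 - d) x hx
    have c3 := cexp (-d) x hx
    have c4 := contDiffAt_along (h.contDiffAt_radialField hx) (cv x hx)
    have c5 := cv x hx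
    have c6 := contDiffAt_flux (h.smooth x hx) (cv x hx) i
    have c7 := h.contDiffAt_radialSlope hx
    have c8 := contDiffAt_energy (h.smooth x hx) (cv x hx)
    have c9 := h.contDiffAt_radialField hx i
    have c0 : ContDiffAt ℝ ∞ (fun y => 1 - 100 * C ^ 2 * Real.exp (s y)) x :=
      contDiffAt_const.sub (contDiffAt_const.mul c1)
    have ca : ContDiffAt ℝ ∞ (fun y => 2 * τ * (1 - 100 * C ^ 2 * Real.exp (s y)) *
        Real.exp ((2 - d) * s y)) x := (contDiffAt_const.mul c0).mul c2
    refine ContDiffAt.add (ContDiffAt.mul (ContDiffAt.add (ca.mul c4) (ContDiffAt.mul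
      ((contDiffAt_const.mul (contDiffAt_const.mul c1).neg).mul c2) c5)) c6)
      (ContDiffAt.mul (ContDiffAt.sub (ContDiffAt.mul (ContDiffAt.add
        (((contDiffAt_const.mul (c0.pow 3)).mul c3).mul c7)
        ((contDiffAt_const.mul (c0.pow 2)).mul c3)) (c5.mul c5)) ?_) c9)
    simpa only [div_eq_mul_inv] using (ca.mul c8).mul (contDiffAt_const (c := (2 : ℝ)⁻¹))
  have hW0 : ∀ i, ∀ x ∉ K, W i x = 0 := fun i x hx => by
    simp [W, hvz x hx, hflux0 x hx, hE0 x hx]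
  obtain ⟨I3, hdiv⟩ := integral_divg_eq_zero hK h.isOpen hKU cW hW0
  have hpt : ∀ x, divg W x + τ ^ 3 * (w (s x) * (Real.exp (s x) * u x ^ 2)) ≤
      w (s x) * (Real.exp (2 * s x) * ellip A u x) ^ 2 := by
    intro x
    by_cases hx : x ∈ U
    · have key := h.divg_multiplier_le hx (hsmall x hx) hτ (cv x hx)
      rw [h.ellip_conj hx (100 * C ^ 2) τ (hu x hx)] at key
      have hR : 0 ≤ w (s x) * (Real.exp (2 * s x) * ellip A u x) ^ 2 :=
        mul_nonneg (carlemanWeight_pos _ _ _ _).le (sq_nonneg _)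
      have e1 : Real.exp (-d * s x) * ((Real.exp (-τ * carlemanLog (100 * C ^ 2) (s x)) *
          (Real.exp (2 * s x) * ellip A u x)) ^ 2 / 2) =
          w (s x) * (Real.exp (2 * s x) * ellip A u x) ^ 2 / 2 := by
        simp only [hw, carlemanWeight]; ring
      have e2 : Real.exp (-d * s x) * (10 * C ^ 2 * Real.exp (s x) * τ ^ 3 * v x ^ 2) =
          10 * C ^ 2 * (τ ^ 3 * (w (s x) * (Real.exp (s x) * u x ^ 2))) := by
        simp only [hw, carlemanWeight, v]; ring
      have e3 : 0 ≤ τ ^ 3 * (w (s x) * (Real.exp (s x) * u x ^ 2)) := by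
        have := (carlemanWeight_pos d (100 * C ^ 2) τ (s x)).le
        positivity
      rw [e1, e2] at key
      have e4 : 1 * (τ ^ 3 * (w (s x) * (Real.exp (s x) * u x ^ 2))) ≤
          10 * C ^ 2 * (τ ^ 3 * (w (s x) * (Real.exp (s x) * u x ^ 2))) :=
        mul_le_mul_of_nonneg_right (by nlinarith) e3
      have key' : divg W x + 10 * C ^ 2 * (τ ^ 3 * (w (s x) * (Real.exp (s x) * u x ^ 2))) ≤
          w (s x) * (Real.exp (2 * s x) * ellip A u x) ^ 2 / 2 := key
      linarith
    · have hxK : x ∉ K := fun hk => hx (hKU hk)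
      have : divg W x = 0 := by
        have : ∀ i, W i =ᶠ[nhds x] fun _ => 0 := fun i => by
          filter_upwards [hK.isClosed.isOpen_compl.mem_nhds hxK] with y hy using hW0 i y hy
        rw [divg_congr this]
        simp [divg, pderiv_const]
      rw [this, hu0 x hxK, hP0 x hxK]
      simp
  have := integral_mono (I3.add (I1.const_mul (τ ^ 3))) I2 hpt
  have h' : ∫ x, (divg W x + τ ^ 3 * (w (s x) * (Real.exp (s x) * u x ^ 2))) ≤
      ∫ x, w (s x) * (Real.exp (2 * s x) * ellip A u x) ^ 2 := this
  rw [integral_add I3 (I1.const_mul (τ ^ 3)), hdiv, zero_add, integral_const_mul] at h'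
  exact h'

end IsPolar

end Riemann

/-! ### The logarithmic radius -/

namespace Riemann

variable {d : ℕ}

/-- A positive definite quadratic form on `ℝᵈ` is coercive. -/
theorem exists_coercive {a : Fin d → Fin d → ℝ}
    (ha : ∀ ξ : Euc d, ξ ≠ 0 → 0 < ∑ i, ∑ j, a i j * ξ i * ξ j) :
    ∃ c > 0, ∀ ξ : Euc d, c * ‖ξ‖ ^ 2 ≤ ∑ i, ∑ j, a i j * ξ i * ξ j := by
  have hcont : Continuous fun ξ : Euc d => ∑ i, ∑ j, a i j * ξ i * ξ j := by fun_prop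
  have hpos : ∃ c > 0, ∀ ξ ∈ Metric.sphere (0 : Euc d) 1, c ≤ ∑ i, ∑ j, a i j * ξ i * ξ j := by
    rcases (Metric.sphere (0 : Euc d) 1).eq_empty_or_nonempty with he | hne
    · exact ⟨1, one_pos, by simp [he]⟩
    · obtain ⟨ξ, hξ, hmin⟩ := (isCompact_sphere (0 : Euc d) 1).exists_isMinOn hne
        hcont.continuousOn
      refine ⟨_, ha ξ ?_, fun η hη => hmin hη⟩
      rintro rfl
      simp at hξ
  obtain ⟨c, hc, hmin⟩ := hpos
  refine ⟨c, hc, fun ξ => ?_⟩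
  by_cases hξ : ξ = 0
  · simp [hξ]
  · have hn : 0 < ‖ξ‖ := norm_pos_iff.2 hξ
    have h1 := hmin (‖ξ‖⁻¹ • ξ) (by simp [norm_smul, hn.ne'])
    have h2 : ∑ i, ∑ j, a i j * (‖ξ‖⁻¹ • ξ) i * (‖ξ‖⁻¹ • ξ) j =
        (∑ i, ∑ j, a i j * ξ i * ξ j) * (‖ξ‖⁻¹) ^ 2 := by
      simp only [Finset.sum_mul, PiLp.smul_apply, smul_eq_mul]
      exact Finset.sum_congr rfl fun i _ => Finset.sum_congr rfl fun j _ => by ring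
    rw [h2] at h1
    have := mul_le_mul_of_nonneg_right h1 (sq_nonneg ‖ξ‖)
    rwa [mul_assoc, ← mul_pow, inv_mul_cancel₀ hn.ne', one_pow, mul_one] at this

/-- The components of the linear map `x ↦ B (x - x₀)`. -/
def linAt (B : Fin d → Fin d → ℝ) (x₀ : Euc d) (i : Fin d) (x : Euc d) : ℝ :=
  ∑ j, B i j * (x j - x₀ j)

/-- The quadratic form `⟨B (x - x₀), x - x₀⟩`. -/
def quadAt (B : Fin d → Fin d → ℝ) (x₀ x : Euc d) : ℝ :=
  ∑ i, linAt B x₀ i x * (x i - x₀ i)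

/-- The logarithmic radius `½ log ⟨B (x - x₀), x - x₀⟩`. At `x₀` it has the junk value `0`. -/
def logRadius (B : Fin d → Fin d → ℝ) (x₀ x : Euc d) : ℝ := Real.log (quadAt B x₀ x) / 2

theorem contDiff_linAt (B : Fin d → Fin d → ℝ) (x₀ : Euc d) (i : Fin d) :
    ContDiff ℝ ∞ (linAt B x₀ i) := by
  unfold linAt; fun_prop

theorem contDiff_quadAt (B : Fin d → Fin d → ℝ) (x₀ : Euc d) :
    ContDiff ℝ ∞ (quadAt B x₀) := by
  have := contDiff_linAt B x₀
  unfold quadAt; fun_prop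

theorem pderiv_coord (x₀ x : Euc d) (i j : Fin d) :
    pderiv j (fun y : Euc d => y i - x₀ i) x = if i = j then 1 else 0 := by
  have h : HasFDerivAt (fun y : Euc d => y i - x₀ i)
      (EuclideanSpace.proj i : Euc d →L[ℝ] ℝ) x :=
    (EuclideanSpace.proj i : Euc d →L[ℝ] ℝ).hasFDerivAt.sub_const (x₀ i)
  rw [pderiv, h.fderiv]
  simp

theorem differentiableAt_coord (x₀ x : Euc d) (i : Fin d) :
    DifferentiableAt ℝ (fun y : Euc d => y i - x₀ i) x := by fun_prop

theorem pderiv_linAt (B : Fin d → Fin d → ℝ) (x₀ x : Euc d) (i j : Fin d) :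
    pderiv j (linAt B x₀ i) x = B i j := by
  unfold linAt
  rw [pderiv_sum fun k _ => (differentiableAt_coord x₀ x k).const_mul (B i k)]
  simp_rw [pderiv_const_mul (differentiableAt_coord x₀ x _), pderiv_coord]
  simp

theorem pderiv_quadAt {B : Fin d → Fin d → ℝ} (hB : ∀ i j, B i j = B j i) (x₀ x : Euc d)
    (j : Fin d) : pderiv j (quadAt B x₀) x = 2 * linAt B x₀ j x := by
  have hl := fun i => ((contDiff_linAt B x₀ i).differentiable (by simp)) x
  unfold quadAt
  rw [pderiv_sum fun k _ => (hl k).fun_mul (differentiableAt_coord x₀ x k)]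
  simp_rw [pderiv_mul (hl _) (differentiableAt_coord x₀ x _), pderiv_coord, pderiv_linAt]
  rw [Finset.sum_add_distrib, two_mul]
  congr 1
  · simp only [linAt, hB j]
  · simp

section Polar

variable {A : Fin d → Fin d → Euc d → ℝ} {B : Fin d → Fin d → ℝ} {x₀ x : Euc d}

theorem exp_logRadius (hq : 0 < quadAt B x₀ x) : Real.exp (logRadius B x₀ x) ^ 2 = quadAt B x₀ x := by
  rw [← Real.exp_nat_mul, logRadius]
  push_cast
  rw [mul_div_cancel₀ _ (two_ne_zero), Real.exp_log hq]

theorem exp_two_mul_logRadius (hq : 0 < quadAt B x₀ x) :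
    Real.exp (2 * logRadius B x₀ x) = quadAt B x₀ x := by
  rw [logRadius, mul_div_cancel₀ _ (two_ne_zero), Real.exp_log hq]

theorem contDiffAt_logRadius (hq : 0 < quadAt B x₀ x) : ContDiffAt ℝ ∞ (logRadius B x₀) x :=
  ((contDiff_quadAt B x₀).contDiffAt.log hq.ne').div_const 2

theorem pderiv_logRadius (hB : ∀ i j, B i j = B j i) (hq : 0 < quadAt B x₀ x) (j : Fin d) :
    pderiv j (logRadius B x₀) x = linAt B x₀ j x / quadAt B x₀ x := by
  have hk : HasDerivAt (fun t => Real.log t / 2) ((quadAt B x₀ x)⁻¹ / 2) (quadAt B x₀ x) :=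
    (Real.hasDerivAt_log hq.ne').div_const 2
  have := pderiv_comp hk ((contDiff_quadAt B x₀).differentiable (by simp) x) j
  rw [pderiv_quadAt hB] at this
  refine this.trans ?_
  field_simp

/-- The vector field `A B (x - x₀)`, which is the radial field of `logRadius B x₀`. -/
def linField (A : Fin d → Fin d → Euc d → ℝ) (B : Fin d → Fin d → ℝ) (x₀ : Euc d) (i : Fin d)
    (x : Euc d) : ℝ :=
  ∑ j, A i j x * linAt B x₀ j x

theorem radialField_logRadius (hB : ∀ i j, B i j = B j i) (hq : 0 < quadAt B x₀ x) (i : Fin d) :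
    radialField A (logRadius B x₀) i x = linField A B x₀ i x := by
  rw [radialField, exp_two_mul_logRadius hq, flux, linField, Finset.mul_sum]
  refine Finset.sum_congr rfl fun j _ => ?_
  rw [pderiv_logRadius hB hq]
  field_simp

/-- The error `⟨(A - A(x₀)) B (x - x₀), B (x - x₀)⟩`, which vanishes to third order at `x₀`. -/
def cubicError (A : Fin d → Fin d → Euc d → ℝ) (B : Fin d → Fin d → ℝ) (x₀ x : Euc d) : ℝ :=
  ∑ i, ∑ j, (A i j x - A i j x₀) * (linAt B x₀ i x * linAt B x₀ j x)

theorem sum_mul_linAt (hAB : ∀ i k, ∑ j, A i j x₀ * B j k = if i = k then 1 else 0) (i : Fin d) :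
    ∑ j, A i j x₀ * linAt B x₀ j x = x i - x₀ i := by
  simp only [linAt, Finset.mul_sum]
  rw [Finset.sum_comm]
  have : ∀ k, ∑ j, A i j x₀ * (B j k * (x k - x₀ k)) =
      (if i = k then 1 else 0) * (x k - x₀ k) := fun k => by
    rw [← hAB i k, Finset.sum_mul]
    exact Finset.sum_congr rfl fun j _ => by ring
  simp [this]

theorem sum_linField_mul_linAt (hAB : ∀ i k, ∑ j, A i j x₀ * B j k = if i = k then 1 else 0) :
    ∑ i, linField A B x₀ i x * linAt B x₀ i x = quadAt B x₀ x + cubicError A B x₀ x := by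
  have : quadAt B x₀ x = ∑ i, (∑ j, A i j x₀ * linAt B x₀ j x) * linAt B x₀ i x := by
    simp only [sum_mul_linAt hAB, quadAt]
    exact Finset.sum_congr rfl fun i _ => mul_comm _ _
  rw [this, cubicError, ← Finset.sum_add_distrib]
  refine Finset.sum_congr rfl fun i _ => ?_
  rw [linField, Finset.sum_mul, Finset.sum_mul, ← Finset.sum_add_distrib]
  exact Finset.sum_congr rfl fun j _ => by ring

theorem radialSlope_logRadius (hB : ∀ i j, B i j = B j i)
    (hAB : ∀ i k, ∑ j, A i j x₀ * B j k = if i = k then 1 else 0) (hq : 0 < quadAt B x₀ x) :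
    radialSlope A (logRadius B x₀) x = 1 + cubicError A B x₀ x / quadAt B x₀ x := by
  have h1 : radialSlope A (logRadius B x₀) x =
      (∑ i, linField A B x₀ i x * linAt B x₀ i x) / quadAt B x₀ x := by
    rw [radialSlope, along, Finset.sum_div]
    refine Finset.sum_congr rfl fun i _ => ?_
    rw [radialField_logRadius hB hq, pderiv_logRadius hB hq, mul_div_assoc]
  rw [h1, sum_linField_mul_linAt hAB, add_div, div_self hq.ne']

/-- The deviation of the derivative of `linField` from the identity. -/
def jacobianError (A : Fin d → Fin d → Euc d → ℝ) (B : Fin d → Fin d → ℝ) (x₀ : Euc d)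
    (i j : Fin d) (x : Euc d) : ℝ :=
  ∑ k, (pderiv j (A i k) x * linAt B x₀ k x + (A i k x - A i k x₀) * B k j)

theorem pderiv_linField (hAB : ∀ i k, ∑ j, A i j x₀ * B j k = if i = k then 1 else 0)
    (hA : ∀ i j, DifferentiableAt ℝ (A i j) x) (i j : Fin d) :
    pderiv j (linField A B x₀ i) x = (if i = j then 1 else 0) + jacobianError A B x₀ i j x := by
  have hl := fun i => ((contDiff_linAt B x₀ i).differentiable (by simp)) x
  unfold linField
  rw [pderiv_sum fun k _ => (hA i k).fun_mul (hl k), ← hAB i j, jacobianError,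
    ← Finset.sum_add_distrib]
  refine Finset.sum_congr rfl fun k _ => ?_
  rw [pderiv_mul (hA i k) (hl k), pderiv_linAt]
  ring

theorem pderiv_cubicError (hA : ∀ i j, DifferentiableAt ℝ (A i j) x) (k : Fin d) :
    pderiv k (cubicError A B x₀) x = ∑ i, ∑ j, (pderiv k (A i j) x *
      (linAt B x₀ i x * linAt B x₀ j x) + (A i j x - A i j x₀) *
        (B i k * linAt B x₀ j x + linAt B x₀ i x * B j k)) := by
  have hl := fun i => ((contDiff_linAt B x₀ i).differentiable (by simp)) x
  have hm := fun i j => ((hA i j).sub_const (A i j x₀)).fun_mul ((hl i).fun_mul (hl j))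
  unfold cubicError
  rw [pderiv_sum fun i _ => DifferentiableAt.fun_sum fun j _ => hm i j]
  refine Finset.sum_congr rfl fun i _ => ?_
  rw [pderiv_sum fun j _ => hm i j]
  refine Finset.sum_congr rfl fun j _ => ?_
  rw [pderiv_mul ((hA i j).sub_const (A i j x₀)) ((hl i).fun_mul (hl j)), pderiv_mul (hl i) (hl j),
    pderiv_sub (hA i j) (differentiableAt_const _), pderiv_const, pderiv_linAt, pderiv_linAt]
  ring

theorem differentiableAt_cubicError (hA : ∀ i j, DifferentiableAt ℝ (A i j) x) :
    DifferentiableAt ℝ (cubicError A B x₀) x := by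
  have hl := fun i => ((contDiff_linAt B x₀ i).differentiable (by simp)) x
  exact DifferentiableAt.fun_sum fun i _ => DifferentiableAt.fun_sum fun j _ =>
    ((hA i j).sub_const (A i j x₀)).fun_mul ((hl i).fun_mul (hl j))

/-- The derivative of the radial slope along the radial field, in terms of the cubic error. -/
theorem along_linField_slope (hB : ∀ i j, B i j = B j i)
    (hAB : ∀ i k, ∑ j, A i j x₀ * B j k = if i = k then 1 else 0) (hq : 0 < quadAt B x₀ x)
    (hA : ∀ i j, DifferentiableAt ℝ (A i j) x) :
    along (linField A B x₀) (fun y => 1 + cubicError A B x₀ y * (quadAt B x₀ y)⁻¹) x =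
      along (linField A B x₀) (cubicError A B x₀) x / quadAt B x₀ x
      - 2 * cubicError A B x₀ x / quadAt B x₀ x * (1 + cubicError A B x₀ x / quadAt B x₀ x) := by
  have hd := differentiableAt_cubicError (B := B) (x₀ := x₀) hA
  have hqd : DifferentiableAt ℝ (quadAt B x₀) x :=
    (contDiff_quadAt B x₀).differentiable (by simp) x
  have hinv := hasDerivAt_inv hq.ne'
  have hqi : DifferentiableAt ℝ (fun y => (quadAt B x₀ y)⁻¹) x := hqd.fun_inv hq.ne'
  have e1 : along (linField A B x₀) (quadAt B x₀) x =
      2 * (quadAt B x₀ x + cubicError A B x₀ x) := by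
    rw [← sum_linField_mul_linAt hAB, along, Finset.mul_sum]
    refine Finset.sum_congr rfl fun i _ => ?_
    rw [pderiv_quadAt hB]; ring
  have e2 : along (linField A B x₀) (fun _ => (1 : ℝ)) x = 0 := by simp [along, pderiv_const]
  rw [along_add (differentiableAt_const _) (hd.fun_mul hqi), e2, along_mul hd hqi,
    along_comp (k := fun t => t⁻¹) hinv hqd, e1]
  field_simp
  ring

end Polar

end Riemann

/-! ### The logarithmic radius is polar -/

namespace Riemann

variable {d : ℕ}

/-- `f = O(‖x - x₀‖ⁿ)` as `x → x₀`. -/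
def VanishesToOrder (x₀ : Euc d) (n : ℕ) (f : Euc d → ℝ) : Prop :=
  f =O[nhds x₀] fun x => ‖x - x₀‖ ^ n

namespace VanishesToOrder

variable {x₀ : Euc d} {n m : ℕ} {f g : Euc d → ℝ}

theorem mul (hf : VanishesToOrder x₀ n f) (hg : VanishesToOrder x₀ m g) :
    VanishesToOrder x₀ (n + m) (fun x => f x * g x) := by
  have := Asymptotics.IsBigO.mul hf hg
  simpa only [VanishesToOrder, pow_add] using this

theorem add (hf : VanishesToOrder x₀ n f) (hg : VanishesToOrder x₀ n g) :
    VanishesToOrder x₀ n (fun x => f x + g x) :=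
  Asymptotics.IsBigO.add hf hg

theorem sum {ι : Type*} {t : Finset ι} {F : ι → Euc d → ℝ}
    (hF : ∀ i, VanishesToOrder x₀ n (F i)) : VanishesToOrder x₀ n (fun x => ∑ i ∈ t, F i x) := by
  have := Asymptotics.IsBigO.sum (s := t) (fun i _ => hF i)
  simpa only [VanishesToOrder, ← Finset.sum_fn] using this

theorem abs (hf : VanishesToOrder x₀ n f) : VanishesToOrder x₀ n (fun x => |f x|) :=
  Asymptotics.IsBigO.norm_left hf

theorem of_continuousAt (hf : ContinuousAt f x₀) : VanishesToOrder x₀ 0 f := by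
  simpa [VanishesToOrder] using hf.isBigO_one ℝ

theorem const (c : ℝ) : VanishesToOrder x₀ 0 (fun _ : Euc d => c) :=
  of_continuousAt continuousAt_const

theorem sub_of_differentiableAt (hf : DifferentiableAt ℝ f x₀) :
    VanishesToOrder x₀ 1 (fun x => f x - f x₀) := by
  simpa [VanishesToOrder] using hf.isBigO_sub.norm_right

theorem exists_bound (hf : VanishesToOrder x₀ n f) :
    ∃ c > 0, ∀ᶠ x in nhds x₀, |f x| ≤ c * ‖x - x₀‖ ^ n := by
  obtain ⟨c, hc, h⟩ := Asymptotics.IsBigO.exists_pos hf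
  refine ⟨c, hc, ?_⟩
  filter_upwards [h.bound] with x hx
  simpa using hx

end VanishesToOrder

theorem vanishesToOrder_linAt (B : Fin d → Fin d → ℝ) (x₀ : Euc d) (i : Fin d) :
    VanishesToOrder x₀ 1 (linAt B x₀ i) := by
  have := VanishesToOrder.sub_of_differentiableAt
    ((contDiff_linAt B x₀ i).differentiable (by simp) x₀)
  simpa [show linAt B x₀ i x₀ = 0 by simp [linAt]] using this

section Errors

variable {A : Fin d → Fin d → Euc d → ℝ} {x₀ : Euc d}

theorem vanishesToOrder_linField (B : Fin d → Fin d → ℝ)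
    (hA : ∀ i j, ContDiffAt ℝ ∞ (A i j) x₀) (i : Fin d) :
    VanishesToOrder x₀ 1 (linField A B x₀ i) :=
  .sum fun j => (VanishesToOrder.of_continuousAt (hA i j).continuousAt).mul
    (vanishesToOrder_linAt B x₀ j)

theorem vanishesToOrder_cubicError (B : Fin d → Fin d → ℝ)
    (hA : ∀ i j, ContDiffAt ℝ ∞ (A i j) x₀) :
    VanishesToOrder x₀ 3 (cubicError A B x₀) :=
  .sum fun i => .sum fun j =>
    (VanishesToOrder.sub_of_differentiableAt (hA i j).differentiableAt_infty).mul
      ((vanishesToOrder_linAt B x₀ i).mul (vanishesToOrder_linAt B x₀ j))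

theorem vanishesToOrder_along_cubicError (B : Fin d → Fin d → ℝ)
    (hA : ∀ᶠ x in nhds x₀, ∀ i j, ContDiffAt ℝ ∞ (A i j) x) :
    VanishesToOrder x₀ 3 (along (linField A B x₀) (cubicError A B x₀)) := by
  have hA₀ := hA.self_of_nhds
  refine .sum fun k => (vanishesToOrder_linField B hA₀ k).mul (m := 2) ?_
  have h : VanishesToOrder x₀ 2 (fun x => ∑ i, ∑ j, (pderiv k (A i j) x *
      (linAt B x₀ i x * linAt B x₀ j x) + (A i j x - A i j x₀) *
        (B i k * linAt B x₀ j x + linAt B x₀ i x * B j k))) := by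
    refine .sum fun i => .sum fun j => .add (n := 2) ?_ ?_
    · exact (VanishesToOrder.of_continuousAt (contDiffAt_pderiv (hA₀ i j) k).continuousAt).mul
        ((vanishesToOrder_linAt B x₀ i).mul (vanishesToOrder_linAt B x₀ j))
    · exact (VanishesToOrder.sub_of_differentiableAt (hA₀ i j).differentiableAt_infty).mul
        (.add (n := 1) ((VanishesToOrder.const _).mul (vanishesToOrder_linAt B x₀ j))
          ((vanishesToOrder_linAt B x₀ i).mul (VanishesToOrder.const _)))
  refine Asymptotics.IsBigO.congr' h ?_ .rfl
  filter_upwards [hA] with x hx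
  exact (pderiv_cubicError (fun i j => (hx i j).differentiableAt_infty) k).symm

theorem vanishesToOrder_jacobianError (B : Fin d → Fin d → ℝ)
    (hA : ∀ i j, ContDiffAt ℝ ∞ (A i j) x₀) (i j : Fin d) :
    VanishesToOrder x₀ 1 (jacobianError A B x₀ i j) :=
  .sum fun k => .add (n := 1)
    ((VanishesToOrder.of_continuousAt (contDiffAt_pderiv (hA i k) j).continuousAt).mul
      (vanishesToOrder_linAt B x₀ k))
    ((VanishesToOrder.sub_of_differentiableAt (hA i k).differentiableAt_infty).mul
      (VanishesToOrder.const _))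

theorem vanishesToOrder_along_coeff (B : Fin d → Fin d → ℝ)
    (hA : ∀ i j, ContDiffAt ℝ ∞ (A i j) x₀) (i j : Fin d) :
    VanishesToOrder x₀ 1 (along (linField A B x₀) (A i j)) :=
  .sum fun k => (vanishesToOrder_linField B hA k).mul
    (.of_continuousAt (contDiffAt_pderiv (hA i j) k).continuousAt)

end Errors

theorem abs_mul_le_sum_sq (ξ : Fin d → ℝ) (i j : Fin d) : |ξ i * ξ j| ≤ ∑ k, ξ k ^ 2 := by
  have h : ∀ i, ξ i ^ 2 ≤ ∑ k, ξ k ^ 2 := fun i =>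
    Finset.single_le_sum (f := fun k => ξ k ^ 2) (fun k _ => sq_nonneg _) (Finset.mem_univ i)
  rw [abs_le]
  constructor <;> nlinarith [h i, h j, sq_nonneg (ξ i + ξ j), sq_nonneg (ξ i - ξ j)]

theorem abs_sum_mul_mul_le (a : Fin d → Fin d → ℝ) (ξ : Fin d → ℝ) :
    |∑ i, ∑ j, a i j * ξ i * ξ j| ≤ (∑ i, ∑ j, |a i j|) * ∑ k, ξ k ^ 2 := by
  refine (Finset.abs_sum_le_sum_abs _ _).trans ?_
  rw [Finset.sum_mul]
  refine Finset.sum_le_sum fun i _ => (Finset.abs_sum_le_sum_abs _ _).trans ?_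
  rw [Finset.sum_mul]
  refine Finset.sum_le_sum fun j _ => ?_
  rw [mul_assoc, abs_mul]
  exact mul_le_mul_of_nonneg_left (abs_mul_le_sum_sq ξ i j) (abs_nonneg _)

/-- Near a point where it is smooth, symmetric and positive definite, the matrix `A` admits a
logarithmic radial coordinate, comparable to the logarithm of the distance to the point. -/
theorem exists_isPolar {A : Fin d → Fin d → Euc d → ℝ} {x₀ : Euc d}
    (hA : ∀ᶠ x in nhds x₀, ∀ i j, ContDiffAt ℝ ∞ (A i j) x)
    (hsymm : ∀ᶠ x in nhds x₀, ∀ i j, A i j x = A j i x)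
    (hpos : (Matrix.of fun i j => A i j x₀).PosDef) :
    ∃ (s : Euc d → ℝ) (C r c₁ c₂ c₃ : ℝ), 0 < r ∧ 0 < c₁ ∧ 0 < c₂ ∧
      IsPolar A s (Metric.ball x₀ r \ {x₀}) C ∧
      (∀ x ∈ Metric.ball x₀ r \ {x₀}, ∀ i, |radialField A s i x| ≤ c₃) ∧
      (∀ x ≠ x₀, ContDiffAt ℝ ∞ s x) ∧
      ∀ x ≠ x₀, c₁ * ‖x - x₀‖ ≤ Real.exp (s x) ∧ Real.exp (s x) ≤ c₂ * ‖x - x₀‖ := by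
  -- With `B = A(x₀)⁻¹`, the field `A B (x - x₀)` agrees with `x - x₀` to first order.
  set A₀ : Matrix (Fin d) (Fin d) ℝ := Matrix.of fun i j => A i j x₀ with hA₀def
  set B : Fin d → Fin d → ℝ := fun i j => A₀⁻¹ i j with hBdef
  have hA₀ := hA.self_of_nhds
  have hB : ∀ i j, B i j = B j i := fun i j => by
    have := hpos.inv.isHermitian.apply i j
    simpa [hBdef] using this.symm
  have hAB : ∀ i k, ∑ j, A i j x₀ * B j k = if i = k then 1 else 0 := fun i k => by
    have h := Matrix.mul_nonsing_inv A₀ (hpos.det_pos.ne'.isUnit)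
    have := congrFun (congrFun h i) k
    rw [Matrix.mul_apply, Matrix.one_apply] at this
    exact this
  have hform : ∀ (N : Matrix (Fin d) (Fin d) ℝ), N.PosDef → ∀ ξ : Euc d, ξ ≠ 0 →
      0 < ∑ i, ∑ j, N i j * ξ i * ξ j := fun N hN ξ hξ => by
    have := hN.dotProduct_mulVec_pos (x := ξ.ofLp) (fun h0 => hξ (by ext i; simp [h0]))
    refine this.trans_eq ?_
    simp only [dotProduct, Matrix.mulVec, Finset.mul_sum, Pi.star_apply, star_trivial]
    exact Finset.sum_congr rfl fun i _ => Finset.sum_congr rfl fun j _ => by ring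
  obtain ⟨cA, hcA, hcoA⟩ := exists_coercive (hform A₀ hpos)
  obtain ⟨cB, hcB, hcoB⟩ := exists_coercive (hform A₀⁻¹ hpos.inv)
  have hquad : ∀ x, quadAt B x₀ x =
      ∑ i, ∑ j, A₀⁻¹ i j * (x - x₀ : Euc d) i * (x - x₀ : Euc d) j := fun x => by
    simp only [quadAt, linAt, Finset.sum_mul]
    exact Finset.sum_congr rfl fun i _ => Finset.sum_congr rfl fun j _ => by
      simp [hBdef]; ring
  have hqlow : ∀ x, cB * ‖x - x₀‖ ^ 2 ≤ quadAt B x₀ x := fun x => by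
    rw [hquad]; exact hcoB _
  have hqup : ∀ x, quadAt B x₀ x ≤ (∑ i, ∑ j, |A₀⁻¹ i j|) * ‖x - x₀‖ ^ 2 := fun x => by
    rw [hquad, EuclideanSpace.real_norm_sq_eq]
    exact (le_abs_self _).trans (abs_sum_mul_mul_le _ _)
  have hqpos : ∀ x ≠ x₀, 0 < quadAt B x₀ x := fun x hx => by
    have : 0 < ‖x - x₀‖ := norm_pos_iff.2 (sub_ne_zero.2 hx)
    exact lt_of_lt_of_le (by positivity) (hqlow x)
  -- bounds for the error terms, by powers of the distance to `x₀`
  obtain ⟨C₁, hC₁, e₁⟩ := (vanishesToOrder_cubicError B hA₀).exists_bound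
  obtain ⟨C₂, hC₂, e₂⟩ := (vanishesToOrder_along_cubicError B hA).exists_bound
  obtain ⟨C₃, hC₃, e₃⟩ := (VanishesToOrder.sum (t := Finset.univ)
    (fun i => vanishesToOrder_jacobianError B hA₀ i i)).exists_bound
  obtain ⟨C₄, hC₄, e₄⟩ := (VanishesToOrder.sum (t := Finset.univ) (fun k =>
    VanishesToOrder.sum (t := Finset.univ) fun j => (VanishesToOrder.sum (t := Finset.univ)
      fun i => (vanishesToOrder_jacobianError B hA₀ k i).mul (VanishesToOrder.of_continuousAt
        (hA₀ i j).continuousAt)).abs)).exists_bound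
  obtain ⟨C₅, hC₅, e₅⟩ := (VanishesToOrder.sum (t := Finset.univ) (fun i =>
    VanishesToOrder.sum (t := Finset.univ) fun j =>
      (vanishesToOrder_along_coeff B hA₀ i j).abs)).exists_bound
  obtain ⟨C₆, hC₆, e₆⟩ := (VanishesToOrder.sum (t := Finset.univ) (fun i =>
    VanishesToOrder.sum (t := Finset.univ) fun j =>
      (VanishesToOrder.sub_of_differentiableAt
        (hA₀ i j).differentiableAt_infty).abs)).exists_bound
  obtain ⟨C₇, hC₇, e₇⟩ := (VanishesToOrder.sum (t := Finset.univ) fun i =>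
    (vanishesToOrder_linField B hA₀ i).abs).exists_bound
  have htend : ∀ c > 0, ∀ᶠ x in nhds x₀, ‖x - x₀‖ < c := fun c hc => by
    filter_upwards [Metric.ball_mem_nhds x₀ hc] with x hx
    simpa [dist_eq_norm] using hx
  obtain ⟨r, hr, hball⟩ := Metric.eventually_nhds_iff_ball.1
    (hA.and (e₇.and (hsymm.and (e₁.and (e₂.and (e₃.and (e₄.and (e₅.and (e₆.and
      ((htend (cA / 2 / C₆) (by positivity)).and (htend (cB / C₁) (by positivity))))))))))))
  set μ := Real.sqrt cB with hμ
  have hμ0 : 0 < μ := Real.sqrt_pos.2 hcB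
  have hμ2 : μ ^ 2 = cB := Real.sq_sqrt hcB.le
  set M := ∑ i, ∑ j, |A₀⁻¹ i j| with hM
  have hM0 : 0 ≤ M := Finset.sum_nonneg fun i _ => Finset.sum_nonneg fun j _ => abs_nonneg _
  have hexp : ∀ x ≠ x₀, μ * ‖x - x₀‖ ≤ Real.exp (logRadius B x₀ x) := fun x hx => by
    refine le_of_sq_le_sq ?_ (Real.exp_pos _).le
    rw [exp_logRadius (hqpos x hx), mul_pow, hμ2]
    exact hqlow x
  have hrad : ∀ x ≠ x₀, ∀ i, radialField A (logRadius B x₀) i =ᶠ[nhds x] linField A B x₀ i :=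
    fun x hx i => by
      filter_upwards [isOpen_compl_singleton.mem_nhds hx] with y hy
      exact radialField_logRadius hB (hqpos y hy) i
  set Λ := C₁ / cB + C₂ / cB + 4 * C₁ / cB + C₃ + C₄ * (2 / cA) + C₅ * (2 / cA) with hΛ
  have hΛ0 : 0 ≤ Λ := by positivity
  refine ⟨logRadius B x₀, Λ / μ + d + 2, r, μ, Real.sqrt M + 1, C₇ * r, hr, hμ0, by positivity, ?_,
    fun x hx i => ?_, fun x hx => contDiffAt_logRadius (hqpos x hx), fun x hx => ⟨hexp x hx, ?_⟩⟩
  rotate_left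
  · rw [(hrad x hx.2 i).eq_of_nhds]
    have h1 := (hball x hx.1).2.1
    have h2 : ‖x - x₀‖ ≤ r := by
      have := hx.1
      rw [Metric.mem_ball, dist_eq_norm] at this
      exact this.le
    have h3 : |linField A B x₀ i x| ≤ ∑ i, |linField A B x₀ i x| :=
      Finset.single_le_sum (f := fun i => |linField A B x₀ i x|) (fun i _ => abs_nonneg _)
        (Finset.mem_univ i)
    rw [pow_one] at h1
    exact h3.trans ((le_abs_self _).trans (h1.trans (mul_le_mul_of_nonneg_left h2 hC₇.le)))
  · refine le_of_sq_le_sq ?_ (by positivity)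
    rw [exp_logRadius (hqpos x hx), mul_pow]
    refine (hqup x).trans (mul_le_mul_of_nonneg_right ?_ (sq_nonneg _))
    nlinarith [Real.sq_sqrt hM0, Real.sqrt_nonneg M]
  have hd0 : (0 : ℝ) ≤ d := Nat.cast_nonneg d
  have hconv : ∀ x ≠ x₀, ∀ c, 0 ≤ c → c ≤ Λ →
      c * ‖x - x₀‖ ≤ (Λ / μ + d + 2) * Real.exp (logRadius B x₀ x) := fun x hx c hc hcΛ => by
    have h1 := hexp x hx
    have h2 : ‖x - x₀‖ ≤ Real.exp (logRadius B x₀ x) / μ := by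
      rw [le_div_iff₀ hμ0]; linarith
    calc c * ‖x - x₀‖ ≤ Λ * (Real.exp (logRadius B x₀ x) / μ) :=
          mul_le_mul hcΛ h2 (norm_nonneg _) hΛ0
      _ = Λ / μ * Real.exp (logRadius B x₀ x) := by ring
      _ ≤ _ := mul_le_mul_of_nonneg_right (by linarith) (Real.exp_pos _).le
  have halong : ∀ x ≠ x₀, ∀ f, along (radialField A (logRadius B x₀)) f x =
      along (linField A B x₀) f x := fun x hx f => by
    simp only [along, (hrad x hx _).eq_of_nhds]
  have hcub : ∀ x ∈ Metric.ball x₀ r, x ≠ x₀ →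
      |cubicError A B x₀ x / quadAt B x₀ x| ≤ C₁ / cB * ‖x - x₀‖ := fun x hx hne => by
    have h1 := (hball x hx).2.2.2.1
    have hn : 0 < ‖x - x₀‖ := norm_pos_iff.2 (sub_ne_zero.2 hne)
    rw [abs_div, abs_of_pos (hqpos x hne), div_le_iff₀ (hqpos x hne)]
    calc |cubicError A B x₀ x| ≤ C₁ * ‖x - x₀‖ ^ 3 := h1
      _ = C₁ / cB * ‖x - x₀‖ * (cB * ‖x - x₀‖ ^ 2) := by field_simp
      _ ≤ _ := mul_le_mul_of_nonneg_left (hqlow x) (by positivity)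
  have hcoer : ∀ x ∈ Metric.ball x₀ r, ∀ v,
      cA / 2 * ∑ k, pderiv k v x ^ 2 ≤ energy A v x := fun x hx v => by
    obtain ⟨-, -, -, -, -, -, -, -, h6, h7, -⟩ := hball x hx
    have h1 := hcoA (WithLp.toLp 2 fun i => pderiv i v x)
    rw [EuclideanSpace.real_norm_sq_eq] at h1
    have h2 := abs_sum_mul_mul_le (fun i j => A i j x - A i j x₀) (fun i => pderiv i v x)
    have h3 : energy A v x = ∑ i, ∑ j, A₀ i j * pderiv i v x * pderiv j v x +
        ∑ i, ∑ j, (A i j x - A i j x₀) * pderiv i v x * pderiv j v x := by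
      simp only [energy, flux, Finset.sum_mul, ← Finset.sum_add_distrib]
      exact Finset.sum_congr rfl fun i _ => Finset.sum_congr rfl fun j _ => by
        simp [hA₀def]; ring
    have h4 : ∑ i, ∑ j, |A i j x - A i j x₀| ≤ cA / 2 := by
      have := (le_abs_self _).trans h6
      rw [pow_one] at this
      have h8 : C₆ * ‖x - x₀‖ ≤ C₆ * (cA / 2 / C₆) := mul_le_mul_of_nonneg_left h7.le hC₆.le
      rw [mul_div_cancel₀ _ hC₆.ne'] at h8
      exact this.trans h8
    have h5 : 0 ≤ ∑ k, pderiv k v x ^ 2 := Finset.sum_nonneg fun k _ => sq_nonneg _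
    have h9 := mul_le_mul_of_nonneg_right h4 h5
    have h10 := (abs_le.1 h2).1
    have h11 : cA * ∑ k, pderiv k v x ^ 2 ≤ ∑ i, ∑ j, A₀ i j * pderiv i v x * pderiv j v x := h1
    rw [h3]
    linarith
  have hgrad : ∀ x ∈ Metric.ball x₀ r, ∀ v,
      ∑ k, pderiv k v x ^ 2 ≤ 2 / cA * energy A v x := fun x hx v => by
    have := hcoer x hx v
    rw [div_mul_eq_mul_div, le_div_iff₀ hcA]
    linarith
  have hEn : ∀ x ∈ Metric.ball x₀ r, ∀ v, 0 ≤ energy A v x := fun x hx v =>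
    le_trans (mul_nonneg (by positivity) (Finset.sum_nonneg fun k _ => sq_nonneg _)) (hcoer x hx v)
  have hquadbound : ∀ x ∈ Metric.ball x₀ r, x ≠ x₀ → ∀ v (a : Fin d → Fin d → ℝ) (c : ℝ),
      0 ≤ c → c * (2 / cA) ≤ Λ → ∑ i, ∑ j, |a i j| ≤ c * ‖x - x₀‖ →
      |∑ i, ∑ j, a i j * pderiv i v x * pderiv j v x| ≤
        (Λ / μ + d + 2) * Real.exp (logRadius B x₀ x) * energy A v x :=
    fun x hx hne v a c hc hcΛ ha => by
      have h1 := abs_sum_mul_mul_le a (fun i => pderiv i v x)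
      have h5 : 0 ≤ ∑ k, pderiv k v x ^ 2 := Finset.sum_nonneg fun k _ => sq_nonneg _
      calc _ ≤ _ := h1
        _ ≤ c * ‖x - x₀‖ * (2 / cA * energy A v x) :=
            mul_le_mul ha (hgrad x hx v) h5 (by positivity)
        _ = c * (2 / cA) * ‖x - x₀‖ * energy A v x := by ring
        _ ≤ _ := mul_le_mul_of_nonneg_right (hconv x hne _ (by positivity) hcΛ) (hEn x hx v)
  refine ⟨Metric.isOpen_ball.sdiff isClosed_singleton, ?_, fun x hx => (hball x hx.1).1,
    fun x hx => (hball x hx.1).2.2.1, fun x hx => contDiffAt_logRadius (hqpos x hx.2),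
    fun x hx v => hEn x hx.1 v, fun x hx => ?_, fun x hx => ?_, fun x hx => ?_,
    fun x hx v => ?_, fun x hx v => ?_⟩
  · have : 0 ≤ Λ / μ := by positivity
    linarith
  · rw [radialSlope_logRadius hB hAB (hqpos x hx.2), add_sub_cancel_left]
    exact (hcub x hx.1 hx.2).trans (hconv x hx.2 _ (by positivity) (by
      rw [hΛ]; have : 0 ≤ C₂ / cB + 4 * C₁ / cB + C₃ + C₄ * (2 / cA) + C₅ * (2 / cA) := by positivity
      linarith))
  · obtain ⟨h1, -, -, -, -, h3, -⟩ := hball x hx.1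
    have e : divg (radialField A (logRadius B x₀)) x - d = ∑ i, jacobianError A B x₀ i i x := by
      rw [divg_congr (hrad x hx.2), divg]
      simp_rw [pderiv_linField hAB fun i j => (h1 i j).differentiableAt_infty]
      simp [Finset.sum_add_distrib]
    rw [e]
    rw [pow_one] at h3
    exact h3.trans (hconv x hx.2 _ hC₃.le (by
      rw [hΛ]
      have : 0 ≤ C₁ / cB + C₂ / cB + 4 * C₁ / cB + C₄ * (2 / cA) + C₅ * (2 / cA) := by positivity
      linarith))
  · obtain ⟨h1, -, -, -, h2, -, -, -, -, -, h7⟩ := hball x hx.1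
    have hne : x ≠ x₀ := hx.2
    have hσ : radialSlope A (logRadius B x₀) =ᶠ[nhds x]
        fun y => 1 + cubicError A B x₀ y * (quadAt B x₀ y)⁻¹ := by
      filter_upwards [isOpen_compl_singleton.mem_nhds hne] with y hy
      rw [radialSlope_logRadius hB hAB (hqpos y hy), div_eq_mul_inv]
    rw [halong x hne, along_congr hσ,
      along_linField_slope hB hAB (hqpos x hne) fun i j => (h1 i j).differentiableAt_infty]
    have hc := hcub x hx.1 hne
    have hn : 0 < ‖x - x₀‖ := norm_pos_iff.2 (sub_ne_zero.2 hne)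
    have hc1 : C₁ / cB * ‖x - x₀‖ ≤ 1 := by
      rw [lt_div_iff₀ hC₁] at h7
      rw [div_mul_eq_mul_div, div_le_one hcB]
      linarith
    have hc2 : |along (linField A B x₀) (cubicError A B x₀) x / quadAt B x₀ x| ≤
        C₂ / cB * ‖x - x₀‖ := by
      rw [abs_div, abs_of_pos (hqpos x hne), div_le_iff₀ (hqpos x hne)]
      calc _ ≤ C₂ * ‖x - x₀‖ ^ 3 := h2
        _ = C₂ / cB * ‖x - x₀‖ * (cB * ‖x - x₀‖ ^ 2) := by field_simp
        _ ≤ _ := mul_le_mul_of_nonneg_left (hqlow x) (by positivity)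
    have hc3 : |2 * cubicError A B x₀ x / quadAt B x₀ x *
        (1 + cubicError A B x₀ x / quadAt B x₀ x)| ≤ 2 * (C₁ / cB * ‖x - x₀‖) * 2 := by
      refine abs_mul_le_of_abs_le ?_ ?_
      · rw [mul_div_assoc, abs_mul, abs_two]; linarith
      · rw [abs_le] at hc ⊢; constructor <;> linarith
    refine (abs_sub _ _).trans ((add_le_add hc2 hc3).trans ?_)
    refine le_trans (le_of_eq ?_) (hconv x hne (C₂ / cB + 4 * C₁ / cB) (by positivity) ?_)
    · ring
    · rw [hΛ]
      have : 0 ≤ C₁ / cB + C₃ + C₄ * (2 / cA) + C₅ * (2 / cA) := by positivity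
      linarith
  · obtain ⟨h1, -, -, -, -, -, h4, -⟩ := hball x hx.1
    have hne : x ≠ x₀ := hx.2
    have e : stretch A (radialField A (logRadius B x₀)) v x - energy A v x =
        ∑ k, ∑ j, (∑ i, jacobianError A B x₀ k i x * A i j x) * pderiv k v x * pderiv j v x := by
      have e1 : ∀ i k, pderiv i (radialField A (logRadius B x₀) k) x =
          (if k = i then 1 else 0) + jacobianError A B x₀ k i x := fun i k => by
        rw [pderiv_congr (hrad x hne k),
          pderiv_linField hAB fun i j => (h1 i j).differentiableAt_infty]
      have e2 : stretch A (radialField A (logRadius B x₀)) v x = energy A v x +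
          ∑ i, ∑ k, jacobianError A B x₀ k i x * pderiv k v x * flux A v i x := by
        rw [stretch, energy, ← Finset.sum_add_distrib]
        refine Finset.sum_congr rfl fun i _ => ?_
        simp only [e1, add_mul, Finset.sum_add_distrib]
        simp [mul_comm]
      rw [e2, add_sub_cancel_left]
      simp only [flux, Finset.mul_sum, Finset.sum_mul]
      rw [Finset.sum_comm]
      refine Finset.sum_congr rfl fun k _ => ?_
      rw [Finset.sum_comm]
      exact Finset.sum_congr rfl fun j _ => Finset.sum_congr rfl fun i _ => by ring
    rw [e]
    refine hquadbound x hx.1 hne v _ C₄ hC₄.le ?_ ?_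
    · rw [hΛ]
      have : 0 ≤ C₁ / cB + C₂ / cB + 4 * C₁ / cB + C₃ + C₅ * (2 / cA) := by positivity
      linarith
    · have := (le_abs_self _).trans h4
      simpa using this
  · obtain ⟨-, -, -, -, -, -, -, h5, -⟩ := hball x hx.1
    have hne : x ≠ x₀ := hx.2
    have e : drift A (radialField A (logRadius B x₀)) v x =
        ∑ i, ∑ j, along (linField A B x₀) (A i j) x * pderiv i v x * pderiv j v x := by
      simp only [drift, halong x hne]
    rw [e]
    refine hquadbound x hx.1 hne v _ C₅ hC₅.le ?_ ?_
    · rw [hΛ]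
      have : 0 ≤ C₁ / cB + C₂ / cB + 4 * C₁ / cB + C₃ + C₄ * (2 / cA) := by positivity
      linarith
    · have := (le_abs_self _).trans h5
      simpa using this

end Riemann

/-! ### Cutoffs and bounds on the weight -/

namespace Riemann

variable {d : ℕ}

theorem IsPolar.mono {A : Fin d → Fin d → Euc d → ℝ} {s : Euc d → ℝ} {U V : Set (Euc d)} {C : ℝ}
    (h : IsPolar A s U C) (hV : IsOpen V) (hVU : V ⊆ U) : IsPolar A s V C :=
  ⟨hV, h.le_const, fun x hx => h.smooth x (hVU hx), fun x hx => h.symm x (hVU hx),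
    fun x hx => h.smooth_log x (hVU hx), fun x hx => h.energy_nonneg x (hVU hx),
    fun x hx => h.slope x (hVU hx), fun x hx => h.div x (hVU hx),
    fun x hx => h.slope_deriv x (hVU hx), fun x hx => h.stretch x (hVU hx),
    fun x hx => h.drift x (hVU hx)⟩

/-- Cutoff functions with transition regions of unit length have uniformly bounded derivatives. -/
theorem exists_cutoff : ∃ c : ℝ, 0 ≤ c ∧ ∀ a b : ℝ, ∃ ζ ζ₁ ζ₂ : ℝ → ℝ,
    ContDiff ℝ ∞ ζ ∧ (∀ t, HasDerivAt ζ (ζ₁ t) t) ∧ (∀ t, HasDerivAt ζ₁ (ζ₂ t) t) ∧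
    (∀ t, |ζ₁ t| ≤ c) ∧ (∀ t, |ζ₂ t| ≤ c) ∧ (∀ t ≤ a, ζ t = 0) ∧ (∀ t, b + 1 ≤ t → ζ t = 0) ∧
    (∀ t, a + 1 ≤ t → t ≤ b → ζ t = 1) ∧ (∀ t, a + 1 < t → t < b → ζ₁ t = 0 ∧ ζ₂ t = 0) := by
  set θ := Real.smoothTransition with hθ
  have h0 : ContDiff ℝ ∞ θ := Real.smoothTransition.contDiff
  have h1 : ContDiff ℝ ∞ (deriv θ) := (contDiff_infty_iff_deriv.1 h0).2
  have h2 : ContDiff ℝ ∞ (deriv (deriv θ)) := (contDiff_infty_iff_deriv.1 h1).2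
  have d0 : ∀ t, HasDerivAt θ (deriv θ t) t := fun t => (h0.differentiable (by simp) t).hasDerivAt
  have d1 : ∀ t, HasDerivAt (deriv θ) (deriv (deriv θ) t) t := fun t =>
    (h1.differentiable (by simp) t).hasDerivAt
  have z1 : ∀ t ∉ Set.Icc (0 : ℝ) 1, deriv θ =ᶠ[nhds t] fun _ => 0 := by
    intro t ht
    have : t < 0 ∨ 1 < t := by
      by_contra hcon
      push Not at hcon
      exact ht hcon
    rcases this with h | h
    · filter_upwards [Iio_mem_nhds h] with y hy
      have : θ =ᶠ[nhds y] fun _ => 0 := by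
        filter_upwards [Iio_mem_nhds hy] with z hz
        exact Real.smoothTransition.zero_of_nonpos (le_of_lt hz)
      rw [this.deriv_eq]; simp
    · filter_upwards [Ioi_mem_nhds h] with y hy
      have : θ =ᶠ[nhds y] fun _ => 1 := by
        filter_upwards [Ioi_mem_nhds hy] with z hz
        exact Real.smoothTransition.one_of_one_le (le_of_lt hz)
      rw [this.deriv_eq]; simp
  have z2 : ∀ t ∉ Set.Icc (0 : ℝ) 1, deriv (deriv θ) t = 0 := fun t ht => by
    rw [(z1 t ht).deriv_eq]; simp
  obtain ⟨c₁, hc₁⟩ := h1.continuous.bounded_above_of_compact_support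
    (HasCompactSupport.intro isCompact_Icc fun t ht => (z1 t ht).eq_of_nhds)
  obtain ⟨c₂, hc₂⟩ := h2.continuous.bounded_above_of_compact_support
    (HasCompactSupport.intro isCompact_Icc z2)
  set m := max 1 (max c₁ c₂) with hm
  have m1 : 1 ≤ m := le_max_left _ _
  have b0 : ∀ t, |θ t| ≤ m := fun t => by
    rw [abs_of_nonneg (Real.smoothTransition.nonneg t)]
    exact (Real.smoothTransition.le_one t).trans m1
  have b1 : ∀ t, |deriv θ t| ≤ m := fun t =>
    (hc₁ t).trans ((le_max_left _ _).trans (le_max_right _ _))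
  have b2 : ∀ t, |deriv (deriv θ) t| ≤ m := fun t =>
    (hc₂ t).trans ((le_max_right _ _).trans (le_max_right _ _))
  refine ⟨4 * (m * m), by positivity, fun a b => ?_⟩
  have eL : ∀ {k : ℝ → ℝ} {k' : ℝ} {t : ℝ}, HasDerivAt k k' (t - a) →
      HasDerivAt (fun t => k (t - a)) k' t := fun {k k' t} hk =>
    (hk.comp t ((hasDerivAt_id t).sub_const a)).congr_deriv (by ring)
  have eR : ∀ {k : ℝ → ℝ} {k' : ℝ} {t : ℝ}, HasDerivAt k k' (b + 1 - t) →
      HasDerivAt (fun t => k (b + 1 - t)) (-k') t := fun {k k' t} hk =>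
    (hk.comp t ((hasDerivAt_id t).const_sub (b + 1))).congr_deriv (by ring)
  refine ⟨fun t => θ (t - a) * θ (b + 1 - t),
    fun t => deriv θ (t - a) * θ (b + 1 - t) + θ (t - a) * -deriv θ (b + 1 - t),
    fun t => (deriv (deriv θ) (t - a) * θ (b + 1 - t) + deriv θ (t - a) * -deriv θ (b + 1 - t)) +
      (deriv θ (t - a) * -deriv θ (b + 1 - t) + θ (t - a) * -(-deriv (deriv θ) (b + 1 - t))),
    by fun_prop, fun t => (eL (d0 _)).mul (eR (d0 _)), fun t => ?_, fun t => ?_, fun t => ?_,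
    fun t ht => ?_, fun t ht => ?_, fun t ht ht' => ?_, fun t ht ht' => ?_⟩
  · exact ((eL (d1 _)).mul (eR (d0 _))).add ((eL (d0 _)).mul (eR (d1 _)).neg)
  · have i1 := abs_mul_le_of_abs_le (b1 (t - a)) (b0 (b + 1 - t))
    have i2 := abs_mul_le_of_abs_le (b0 (t - a)) ((abs_neg _).trans_le (b1 (b + 1 - t)))
    refine (abs_add_le _ _).trans ?_
    nlinarith
  · have i1 := abs_mul_le_of_abs_le (b2 (t - a)) (b0 (b + 1 - t))
    have i2 := abs_mul_le_of_abs_le (b1 (t - a)) ((abs_neg _).trans_le (b1 (b + 1 - t)))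
    have i3 := abs_mul_le_of_abs_le (b0 (t - a))
      ((abs_neg _).trans_le ((abs_neg _).trans_le (b2 (b + 1 - t))))
    refine (abs_add_le _ _).trans ?_
    linarith [abs_add_le (deriv (deriv θ) (t - a) * θ (b + 1 - t))
        (deriv θ (t - a) * -deriv θ (b + 1 - t)),
      abs_add_le (deriv θ (t - a) * -deriv θ (b + 1 - t))
        (θ (t - a) * -(-deriv (deriv θ) (b + 1 - t)))]
  · simp only [hθ, Real.smoothTransition.zero_of_nonpos (sub_nonpos.2 ht), zero_mul]
  · simp only [hθ, Real.smoothTransition.zero_of_nonpos (sub_nonpos.2 ht), mul_zero]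
  · simp only [hθ, Real.smoothTransition.one_of_one_le (show 1 ≤ t - a by linarith),
      Real.smoothTransition.one_of_one_le (show 1 ≤ b + 1 - t by linarith), one_mul]
  · have n1 : t - a ∉ Set.Icc (0 : ℝ) 1 := fun h => by linarith [h.2]
    have n2 : b + 1 - t ∉ Set.Icc (0 : ℝ) 1 := fun h => by linarith [h.2]
    simp [(z1 _ n1).eq_of_nhds, (z1 _ n2).eq_of_nhds, z2 _ n1, z2 _ n2]

/-- The function `h(t) = t - K eᵗ` increases as long as `K eᵗ ≤ 1 / 8`. -/
theorem carlemanLog_le {K a b : ℝ} (hK : 0 ≤ K) (hab : a ≤ b) (hb : K * Real.exp b ≤ 1 / 8) :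
    carlemanLog K a ≤ carlemanLog K b := by
  have h1 : Real.exp b * (1 + (a - b)) ≤ Real.exp a := by
    have := Real.add_one_le_exp (a - b)
    calc Real.exp b * (1 + (a - b)) ≤ Real.exp b * Real.exp (a - b) :=
          mul_le_mul_of_nonneg_left (by linarith) (Real.exp_pos b).le
      _ = Real.exp a := by rw [← Real.exp_add]; ring_nf
  unfold carlemanLog
  have h2 := mul_le_mul_of_nonneg_left h1 hK
  have h3 : K * Real.exp b * (b - a) ≤ 1 / 8 * (b - a) :=
    mul_le_mul_of_nonneg_right hb (by linarith)
  nlinarith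

theorem carlemanWeight_antitone {K τ a b : ℝ} (hK : 0 ≤ K) (hτ : 0 ≤ τ) (hab : a ≤ b)
    (hb : K * Real.exp b ≤ 1 / 8) : carlemanWeight d K τ b ≤ carlemanWeight d K τ a := by
  have hd : (0 : ℝ) ≤ d := Nat.cast_nonneg d
  unfold carlemanWeight
  have h1 : Real.exp (-d * b) ≤ Real.exp (-d * a) := Real.exp_le_exp.2 (by nlinarith)
  have h2 : Real.exp (-τ * carlemanLog K b) ≤ Real.exp (-τ * carlemanLog K a) :=
    Real.exp_le_exp.2 (by nlinarith [carlemanLog_le hK hab hb])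
  exact mul_le_mul h1 (pow_le_pow_left₀ (Real.exp_pos _).le h2 2) (by positivity) (by positivity)

/-- The weight grows at most polynomially in the inverse `e⁻ᵗ` of the radius. -/
theorem carlemanWeight_le {K τ : ℝ} (hτ : 0 ≤ τ) {N : ℕ} (hN : d + 2 * τ ≤ N) {t : ℝ}
    (ht : t ≤ 0) (hK : K * Real.exp t ≤ 1 / 8) :
    carlemanWeight d K τ t * Real.exp t ^ N ≤ Real.exp τ := by
  unfold carlemanWeight carlemanLog
  rw [← Real.exp_nat_mul, ← Real.exp_nat_mul, ← Real.exp_add, ← Real.exp_add]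
  refine Real.exp_le_exp.2 ?_
  push_cast
  have h1 : ((N : ℝ) - d - 2 * τ) * t ≤ 0 := mul_nonpos_of_nonneg_of_nonpos (by linarith) ht
  nlinarith [mul_le_mul_of_nonneg_left hK hτ]

end Riemann

/-! ### Strong unique continuation -/

namespace Riemann

variable {d : ℕ}

namespace IsPolar

variable {A : Fin d → Fin d → Euc d → ℝ} {s : Euc d → ℝ} {U : Set (Euc d)} {C : ℝ}
  (h : IsPolar A s U C) {x : Euc d} {f : Euc d → ℝ}
include h

/-- Cutting off a solution of `|Pf| ≤ Λ |f|` produces an error only where the cutoff is not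
constant, and the error is controlled by `f` and its gradient. -/
theorem sq_ellip_cutoff_le (hx : x ∈ U) (hf : ContDiffAt ℝ ∞ f x) {Λ c c₃ : ℝ}
    (hP : |ellip A f x| ≤ Λ * |f x|) (hc : 0 ≤ c) (hc₃ : 0 ≤ c₃)
    (hβ : ∀ i, |radialField A s i x| ≤ c₃)
    (hs0 : s x ≤ 0) (hsmall : C * Real.exp (s x) ≤ 1)
    {ζ ζ₁ ζ₂ : ℝ → ℝ} (hζ : ContDiff ℝ ∞ ζ) (h1 : ∀ t, HasDerivAt ζ (ζ₁ t) t)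
    (h2 : ∀ t, HasDerivAt ζ₁ (ζ₂ t) t) (hc1 : |ζ₁ (s x)| ≤ c) (hc2 : |ζ₂ (s x)| ≤ c) :
    (Real.exp (2 * s x) * ellip A (fun y => ζ (s y) * f y) x) ^ 2 ≤
      2 * Λ ^ 2 * (Real.exp (s x) * (ζ (s x) * f x) ^ 2) +
      if ζ₁ (s x) = 0 ∧ ζ₂ (s x) = 0 then 0 else
        2 * (c * (2 * c₃ + d + 7) * (∑ i, |pderiv i f x| + |f x|)) ^ 2 := by
  rw [h.ellip_comp_mul hx hζ h1 (h2 _) hf]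
  have hd0 : (0 : ℝ) ≤ d := Nat.cast_nonneg d
  have hC : 2 ≤ C := by linarith [h.le_const]
  set g := ∑ i, |pderiv i f x| + |f x| with hg
  have hp0 : 0 ≤ ∑ i, |pderiv i f x| := Finset.sum_nonneg fun i _ => abs_nonneg _
  set err := 2 * ζ₁ (s x) * along (radialField A s) f x
      + f x * (ζ₂ (s x) * radialSlope A s x
        + ζ₁ (s x) * (divg (radialField A s) x - 2 * radialSlope A s x)) with herr
  have hσ : |radialSlope A s x| ≤ 2 := by
    have := (h.slope x hx).trans hsmall
    rw [abs_le] at this ⊢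
    constructor <;> linarith
  have hδ : |divg (radialField A s) x| ≤ d + 1 := by
    have := (h.div x hx).trans hsmall
    rw [abs_le] at this ⊢
    constructor <;> linarith
  have hD : |along (radialField A s) f x| ≤ c₃ * ∑ i, |pderiv i f x| := by
    rw [along, Finset.mul_sum]
    refine (Finset.abs_sum_le_sum_abs _ _).trans (Finset.sum_le_sum fun i _ => ?_)
    rw [abs_mul]
    exact mul_le_mul_of_nonneg_right (hβ i) (abs_nonneg _)
  have herr_le : |err| ≤ c * (2 * (c₃ * ∑ i, |pderiv i f x|) + (d + 7) * |f x|) := by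
    have i1 : |2 * ζ₁ (s x) * along (radialField A s) f x| ≤
        2 * c * (c₃ * ∑ i, |pderiv i f x|) :=
      abs_mul_le_of_abs_le (by rw [abs_mul, abs_two]; linarith) hD
    have i2 : |ζ₂ (s x) * radialSlope A s x| ≤ c * 2 := abs_mul_le_of_abs_le hc2 hσ
    have i3 : |ζ₁ (s x) * (divg (radialField A s) x - 2 * radialSlope A s x)| ≤ c * (d + 5) :=
      abs_mul_le_of_abs_le hc1 (by
        rw [abs_le] at hσ hδ ⊢
        constructor <;> linarith)
    have i4 := abs_mul_le_of_abs_le (le_refl |f x|)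
      ((abs_add_le _ _).trans (add_le_add i2 i3))
    refine (abs_add_le _ _).trans ((add_le_add i1 i4).trans (le_of_eq ?_))
    ring
  have herr_le' : |err| ≤ c * (2 * c₃ + d + 7) * g := by
    refine herr_le.trans ?_
    rw [mul_assoc]
    refine mul_le_mul_of_nonneg_left ?_ hc
    nlinarith [mul_nonneg hc₃ (abs_nonneg (f x)), mul_nonneg hd0 hp0]
  have e1 : (Real.exp (2 * s x) * ellip A f x) ^ 2 ≤ Λ ^ 2 * (Real.exp (s x) * f x ^ 2) := by
    have i1 : ellip A f x ^ 2 ≤ Λ ^ 2 * f x ^ 2 := by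
      rw [← sq_abs (ellip A f x), ← sq_abs (f x), ← mul_pow]
      exact pow_le_pow_left₀ (abs_nonneg _) hP 2
    have i2 : Real.exp (2 * s x) ^ 2 ≤ Real.exp (s x) := by
      rw [← Real.exp_nat_mul]
      refine Real.exp_le_exp.2 ?_
      push_cast
      linarith
    rw [mul_pow]
    calc _ ≤ Real.exp (s x) * (Λ ^ 2 * f x ^ 2) := mul_le_mul i2 i1 (sq_nonneg _) (Real.exp_pos _).le
      _ = _ := by ring
  have e2 := mul_le_mul_of_nonneg_left e1 (sq_nonneg (ζ (s x)))
  have e3 : (ζ (s x) * (Real.exp (2 * s x) * ellip A f x) + err) ^ 2 ≤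
      2 * (ζ (s x) ^ 2 * (Real.exp (2 * s x) * ellip A f x) ^ 2) + 2 * err ^ 2 := by
    nlinarith [sq_nonneg (ζ (s x) * (Real.exp (2 * s x) * ellip A f x) - err)]
  have e4 : 2 * err ^ 2 ≤ if ζ₁ (s x) = 0 ∧ ζ₂ (s x) = 0 then 0 else
        2 * (c * (2 * c₃ + d + 7) * g) ^ 2 := by
    split_ifs with hz
    · simp [herr, hz.1, hz.2]
    · rw [← sq_abs err]
      have := pow_le_pow_left₀ (abs_nonneg _) herr_le' 2
      linarith
  rw [add_assoc, ← herr]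
  linarith

end IsPolar

set_option maxHeartbeats 1000000 in
/-- **Strong unique continuation**: if `f` satisfies `|div (A ∇f)| ≤ Λ |f|` and vanishes to infinite
order at `x₀` together with its gradient, then `f` vanishes near `x₀`. -/
theorem eventually_eq_zero_of_vanishesToOrder {A : Fin d → Fin d → Euc d → ℝ} {x₀ : Euc d}
    {f : Euc d → ℝ} {Λ : ℝ}
    (hA : ∀ᶠ x in nhds x₀, ∀ i j, ContDiffAt ℝ ∞ (A i j) x)
    (hsymm : ∀ᶠ x in nhds x₀, ∀ i j, A i j x = A j i x)
    (hpos : (Matrix.of fun i j => A i j x₀).PosDef)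
    (hf : ∀ᶠ x in nhds x₀, ContDiffAt ℝ ∞ f x)
    (hP : ∀ᶠ x in nhds x₀, |ellip A f x| ≤ Λ * |f x|)
    (hord : ∀ n, VanishesToOrder x₀ n f)
    (hord' : ∀ n i, VanishesToOrder x₀ n (pderiv i f)) :
    ∀ᶠ x in nhds x₀, f x = 0 := by
  obtain ⟨s, C, r₀, c₁, c₂, c₃', hr₀, hc₁, hc₂, hpolar, hβ, hcont, hexp⟩ :=
    exists_isPolar hA hsymm hpos
  obtain ⟨c, hc, hcut⟩ := exists_cutoff
  have hd0 : (0 : ℝ) ≤ d := Nat.cast_nonneg d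
  have hC : 2 ≤ C := by linarith [hpolar.le_const]
  set c₃ := max c₃' 0 with hc₃def
  have hc₃ : 0 ≤ c₃ := le_max_right _ _
  set g : Euc d → ℝ := fun x => ∑ i, |pderiv i f x| + |f x| with hgdef
  have hg : ∀ n, VanishesToOrder x₀ n g := fun n => (VanishesToOrder.sum fun i => (hord' n i).abs).add
    (hord n).abs
  have hg0 : ∀ x, 0 ≤ g x := fun x =>
    add_nonneg (Finset.sum_nonneg fun i _ => abs_nonneg _) (abs_nonneg _)
  have hfx₀ : f x₀ = 0 := by
    obtain ⟨c, -, hc⟩ := (hord 1).exists_bound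
    simpa using hc.self_of_nhds
  obtain ⟨G, hG, hgG⟩ := (hg 0).exists_bound
  have hρ : ∀ ε > 0, ∀ᶠ x in nhds x₀, ‖x - x₀‖ < ε := fun ε hε => by
    filter_upwards [Metric.ball_mem_nhds x₀ hε] with x hx
    simpa [dist_eq_norm] using hx
  obtain ⟨r₁, hr₁, hball⟩ := Metric.eventually_nhds_iff_ball.1
    (hf.and (hP.and (hgG.and (hρ (1 / (800 * C ^ 2 * c₂)) (by positivity)))))
  set r := min r₀ (min r₁ (1 / (800 * C ^ 2 * c₁))) with hr
  have hr0 : 0 < r := lt_min hr₀ (lt_min hr₁ (by positivity))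
  set U : Set (Euc d) := Metric.ball x₀ r \ {x₀} with hUdef
  have hUsub : U ⊆ Metric.ball x₀ r₀ \ {x₀} :=
    Set.sdiff_subset_sdiff_left (Metric.ball_subset_ball (min_le_left _ _))
  have hUpolar : IsPolar A s U C :=
    hpolar.mono (Metric.isOpen_ball.sdiff isClosed_singleton) hUsub
  have hUball : ∀ x ∈ U, x ∈ Metric.ball x₀ r₁ := fun x hx =>
    Metric.ball_subset_ball ((min_le_right _ _).trans (min_le_left _ _)) hx.1
  have hsmall : ∀ x ∈ U, 100 * C ^ 2 * Real.exp (s x) ≤ 1 / 8 := fun x hx => by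
    have h1 := (hball x (hUball x hx)).2.2.2
    rw [lt_div_iff₀ (by positivity)] at h1
    have h2 := mul_le_mul_of_nonneg_left (hexp x hx.2).2 (show 0 ≤ 100 * C ^ 2 by positivity)
    nlinarith
  have hCs : ∀ x ∈ U, C * Real.exp (s x) ≤ 1 := fun x hx => by
    have h1 := hsmall x hx
    have h2 : C ≤ 100 * C ^ 2 := by nlinarith
    have := mul_le_mul_of_nonneg_right h2 (Real.exp_pos (s x)).le
    linarith
  have hs0 : ∀ x ∈ U, s x ≤ 0 := fun x hx => by
    rw [← Real.exp_le_one_iff]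
    nlinarith [hCs x hx, Real.exp_pos (s x)]
  -- Below `T + 1` the logarithmic radius forces the distance to `x₀` to be less than `r / 2`.
  set T := Real.log (c₁ * r / 2) - 1 with hT
  have hexpT : Real.exp (T + 1) = c₁ * r / 2 := by
    rw [hT, sub_add_cancel, Real.exp_log (by positivity)]
  have hTU : ∀ x ≠ x₀, s x < T + 1 → ‖x - x₀‖ < r / 2 := fun x hx hsx => by
    have h1 := (hexp x hx).1.trans_lt (Real.exp_lt_exp.2 hsx)
    rw [hexpT] at h1
    nlinarith
  have memU : ∀ x ≠ x₀, ‖x - x₀‖ ≤ r / 2 → x ∈ U := fun x hx h =>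
    ⟨by rw [Metric.mem_ball, dist_eq_norm]; linarith, hx⟩
  -- the function vanishes where the logarithmic radius is less than `T`
  have key : ∀ x₁ ≠ x₀, s x₁ < T → f x₁ = 0 := by
    intro x₁ hx₁ hsx₁
    by_contra hfx₁
    have hx₁U : x₁ ∈ U := memU x₁ hx₁ (hTU x₁ hx₁ (by linarith)).le
    have hTsmall : 100 * C ^ 2 * Real.exp T ≤ 1 / 8 := by
      have h1 : r ≤ 1 / (800 * C ^ 2 * c₁) := (min_le_right _ _).trans (min_le_right _ _)
      rw [le_div_iff₀ (by positivity)] at h1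
      have h2 : Real.exp T ≤ c₁ * r / 2 := hexpT ▸ Real.exp_le_exp.2 (by linarith)
      have h3 := mul_le_mul_of_nonneg_left h2 (show 0 ≤ 100 * C ^ 2 by positivity)
      linarith
    set κ := Real.exp (s x₁) * f x₁ ^ 2 / 2 with hκ
    have hκ0 : 0 < κ := by positivity
    have cs := (hcont x₁ hx₁).continuousAt
    have cf := ((hball x₁ (hUball x₁ hx₁U)).1).continuousAt
    have cef : ContinuousAt (fun x => Real.exp (s x) * f x ^ 2) x₁ :=
      (Real.continuous_exp.continuousAt.comp cs).mul (cf.pow 2)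
    obtain ⟨r₂, hr₂, hball₂⟩ := Metric.eventually_nhds_iff_ball.1
      ((eventually_ne_nhds hx₁).and
        ((cs.eventually_lt_const hsx₁).and ((cs.eventually_const_lt (sub_one_lt (s x₁))).and
          (cef.eventually_const_lt (show κ < _ by rw [hκ]; exact half_lt_self (by positivity))))))
    set V := volume.real (Metric.closedBall x₀ r) with hV
    set V₁ := volume.real (Metric.ball x₁ r₂) with hV₁
    have hV₁0 : 0 < V₁ := ENNReal.toReal_pos (Metric.measure_ball_pos volume x₁ hr₂).ne'
      measure_ball_lt_top.ne
    set m := 2 * (c * (2 * c₃ + d + 7)) ^ 2 with hm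
    have hm0 : 0 ≤ m := by positivity
    -- The Carleman estimate for `f`, cut off to `a ≤ s ≤ T + 1`: the weight is at least `w T` near
    -- `x₁`, and at most `w T` where the outer cutoff is not constant, so `w T` cancels; the inner
    -- cutoff contributes at most as much. The factor `τ` remains on the left.
    have main : ∀ τ : ℝ, 1000 * C ^ 2 ≤ τ → 4 * Λ ^ 2 ≤ τ →
        τ / 2 * (κ * V₁) ≤ m * (G ^ 2 + 1) * V := by
      intro τ hτ hτΛ
      have hτ1 : 1 ≤ τ := by nlinarith
      set w := carlemanWeight d (100 * C ^ 2) τ with hw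
      have hwpos : ∀ t, 0 < w t := carlemanWeight_pos d _ τ
      obtain ⟨N, hN⟩ := exists_nat_ge (d + 2 * τ)
      -- the weighted error is small near `x₀`
      obtain ⟨cN, hcN, hgN⟩ := ((hg (N + 1)).mul (hg 0)).exists_bound
      obtain ⟨δ, hδ, hballδ⟩ := Metric.eventually_nhds_iff_ball.1
        (hgN.and (hρ (w T * c₁ ^ N / (cN * Real.exp τ))
          (div_pos (mul_pos (hwpos T) (by positivity)) (by positivity))))
      have hinner : ∀ x ∈ U, ‖x - x₀‖ < δ → w (s x) * g x ^ 2 ≤ w T := fun x hx hxδ => by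
        obtain ⟨h1, h2⟩ := hballδ x (by rwa [Metric.mem_ball, dist_eq_norm])
        rw [lt_div_iff₀ (by positivity)] at h2
        have h3 := carlemanWeight_le (d := d) (show 0 ≤ τ by linarith) hN (hs0 x hx) (hsmall x hx)
        have h4 : (c₁ * ‖x - x₀‖) ^ N ≤ Real.exp (s x) ^ N :=
          pow_le_pow_left₀ (by positivity) (hexp x hx.2).1 N
        have h5 : w (s x) * (c₁ * ‖x - x₀‖) ^ N ≤ Real.exp τ :=
          (mul_le_mul_of_nonneg_left h4 (hwpos _).le).trans h3
        have h6 : g x ^ 2 ≤ cN * ‖x - x₀‖ ^ (N + 1) := by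
          have := (le_abs_self _).trans h1
          rw [add_zero] at this
          rwa [sq]
        have h7 : 0 < c₁ ^ N := by positivity
        refine le_of_mul_le_mul_right ?_ h7
        calc w (s x) * g x ^ 2 * c₁ ^ N
            ≤ w (s x) * (cN * ‖x - x₀‖ ^ (N + 1)) * c₁ ^ N := by
              have := (hwpos (s x)).le
              gcongr
          _ = cN * ‖x - x₀‖ * (w (s x) * (c₁ * ‖x - x₀‖) ^ N) := by rw [mul_pow]; ring
          _ ≤ cN * ‖x - x₀‖ * Real.exp τ := mul_le_mul_of_nonneg_left h5 (by positivity)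
          _ ≤ w T * c₁ ^ N := by linarith
      -- where `s ≤ a + 1`, the distance to `x₀` is less than `δ`, and `x₁` is avoided
      set a := min (Real.log (c₁ * δ / 2)) (s x₁ - 1) - 1 with ha
      have ha1 : a + 1 ≤ s x₁ - 1 := by rw [ha, sub_add_cancel]; exact min_le_right _ _
      have haδ : ∀ x ≠ x₀, s x ≤ a + 1 → ‖x - x₀‖ < δ := fun x hx hsx => by
        have h1 : s x ≤ Real.log (c₁ * δ / 2) := by
          rw [ha, sub_add_cancel] at hsx; exact hsx.trans (min_le_left _ _)
        have h2 := (hexp x hx).1.trans (Real.exp_le_exp.2 h1)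
        rw [Real.exp_log (by positivity)] at h2
        nlinarith
      obtain ⟨ζ, ζ₁, ζ₂, hζ, hζ1, hζ2, b1, b2, z1, z2, o1, o2⟩ := hcut a T
      set u : Euc d → ℝ := fun y => ζ (s y) * f y with hu
      set K : Set (Euc d) := Metric.closedBall x₀ (r / 2) \ Metric.ball x₀ (Real.exp a / c₂) with hK
      have hKc : IsCompact K := (isCompact_closedBall _ _).diff Metric.isOpen_ball
      have hKU : K ⊆ U := fun x hx => by
        refine memU x ?_ ?_
        · rintro rfl
          exact hx.2 (Metric.mem_ball_self (by positivity))
        · have := hx.1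
          rwa [Metric.mem_closedBall, dist_eq_norm] at this
      have hu0 : ∀ x ∉ K, u x = 0 := fun x hx => by
        by_cases hxx : x = x₀
        · simp [hu, hxx, hfx₀]
        · by_cases h1 : ‖x - x₀‖ ≤ r / 2
          · have h2 : ‖x - x₀‖ < Real.exp a / c₂ := by
              by_contra hcon
              refine hx ⟨by rwa [Metric.mem_closedBall, dist_eq_norm], ?_⟩
              rwa [Metric.mem_ball, dist_eq_norm]
            rw [lt_div_iff₀ hc₂] at h2
            have h3 := (hexp x hxx).2
            have : s x ≤ a := Real.exp_le_exp.1 (by linarith)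
            simp [hu, z1 _ this]
          · have : T + 1 ≤ s x := by
              by_contra hcon
              exact h1 (hTU x hxx (not_le.1 hcon)).le
            simp [hu, z2 _ this]
      have hus : ∀ x ∈ U, ContDiffAt ℝ ∞ u x := fun x hx =>
        (hUpolar.contDiffAt_comp hx hζ).mul (hball x (hUball x hx)).1
      obtain ⟨I1, I2, hcarl⟩ := hUpolar.carleman_estimate hsmall hτ hKc hKU hus hu0
      have hKant : ∀ t₁ t₂, t₁ ≤ t₂ → 100 * C ^ 2 * Real.exp t₂ ≤ 1 / 8 → w t₂ ≤ w t₁ :=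
        fun t₁ t₂ h12 h2 => carlemanWeight_antitone (by positivity) (by linarith) h12 h2
      have hup : ∀ x, w (s x) * (Real.exp (2 * s x) * ellip A u x) ^ 2 ≤
          2 * Λ ^ 2 * (w (s x) * (Real.exp (s x) * u x ^ 2)) +
            (Metric.closedBall x₀ r).indicator (fun _ => m * (G ^ 2 + 1) * w T) x := by
        intro x
        by_cases hx : x ∈ K
        · have hxU := hKU hx
          obtain ⟨hx1, hx2, hx3, -⟩ := hball x (hUball x hxU)
          have h1 := hUpolar.sq_ellip_cutoff_le hxU hx1 hx2 hc hc₃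
            (fun i => (hβ x (hUsub hxU) i).trans (le_max_left _ _)) (hs0 x hxU) (hCs x hxU)
            hζ hζ1 hζ2 (b1 _) (b2 _)
          have h2 := mul_le_mul_of_nonneg_left h1 (hwpos (s x)).le
          refine h2.trans ?_
          rw [Set.indicator_of_mem (Metric.ball_subset_closedBall hxU.1), mul_add]
          refine add_le_add (le_of_eq (by simp only [hu]; ring)) ?_
          have hwT := hwpos T
          split_ifs with hz
          · rw [mul_zero]; positivity
          · have hgx : g x ^ 2 ≤ G ^ 2 := by
              have := (le_abs_self _).trans hx3
              rw [pow_zero, mul_one] at this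
              exact pow_le_pow_left₀ (hg0 x) this 2
            have h3 : w (s x) * g x ^ 2 ≤ (G ^ 2 + 1) * w T := by
              by_cases hsa : s x ≤ a + 1
              · have := hinner x hxU (haδ x hxU.2 hsa)
                have : 0 ≤ G ^ 2 * w T := by positivity
                linarith
              · have hsT : T ≤ s x := by
                  by_contra hcon
                  exact hz (o2 _ (not_le.1 hsa) (not_le.1 hcon))
                have := hKant _ _ hsT (hsmall x hxU)
                calc w (s x) * g x ^ 2 ≤ w T * G ^ 2 :=
                      mul_le_mul this hgx (sq_nonneg _) (hwpos T).le
                  _ ≤ _ := by linarith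
            calc w (s x) * (2 * (c * (2 * c₃ + d + 7) * g x) ^ 2) = m * (w (s x) * g x ^ 2) := by
                  rw [hm]; ring
              _ ≤ m * ((G ^ 2 + 1) * w T) := mul_le_mul_of_nonneg_left h3 hm0
              _ = _ := by ring
        · have : u =ᶠ[nhds x] fun _ => 0 := by
            filter_upwards [hKc.isClosed.isOpen_compl.mem_nhds hx] with y hy using hu0 y hy
          rw [ellip_eq_zero this, hu0 x hx]
          have hi : 0 ≤ (Metric.closedBall x₀ r).indicator (fun _ => m * (G ^ 2 + 1) * w T) x :=
            Set.indicator_nonneg (fun _ _ => by have := hwpos T; positivity) x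
          simpa using hi
      have hlow : ∀ x, (Metric.ball x₁ r₂).indicator (fun _ => w T * κ) x ≤
          w (s x) * (Real.exp (s x) * u x ^ 2) := by
        intro x
        by_cases hx : x ∈ Metric.ball x₁ r₂
        · obtain ⟨hx0, hxT, hxs, hxκ⟩ := hball₂ x hx
          rw [Set.indicator_of_mem hx]
          have : u x = f x := by
            simp only [hu]
            rw [o1 (s x) (by linarith) hxT.le, one_mul]
          rw [this]
          exact mul_le_mul (hKant _ _ hxT.le hTsmall) hxκ.le hκ0.le (hwpos _).le
        · rw [Set.indicator_of_notMem hx]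
          have := hwpos (s x)
          positivity
      have hind : ∀ (S : Set (Euc d)) (k : ℝ), MeasurableSet S → volume S ≠ ⊤ →
          Integrable (S.indicator fun _ => k) := fun S k hS hfin =>
        (integrable_indicator_iff hS).2 (integrableOn_const hfin)
      have i1 := hind (Metric.closedBall x₀ r) (m * (G ^ 2 + 1) * w T)
        Metric.isClosed_closedBall.measurableSet measure_closedBall_lt_top.ne
      have i2 := hind (Metric.ball x₁ r₂) (w T * κ) Metric.isOpen_ball.measurableSet
        measure_ball_lt_top.ne
      have j1 := integral_mono I2 ((I1.const_mul (2 * Λ ^ 2)).add i1) hup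
      have j1' : ∫ x, w (s x) * (Real.exp (2 * s x) * ellip A u x) ^ 2 ≤
          2 * Λ ^ 2 * (∫ x, w (s x) * (Real.exp (s x) * u x ^ 2)) + V * (m * (G ^ 2 + 1) * w T) := by
        refine j1.trans (le_of_eq ?_)
        simp only [Pi.add_apply]
        rw [integral_add (I1.const_mul (2 * Λ ^ 2)) i1, integral_const_mul,
          integral_indicator_const _ Metric.isClosed_closedBall.measurableSet, smul_eq_mul]
      have j2 : V₁ * (w T * κ) ≤ ∫ x, w (s x) * (Real.exp (s x) * u x ^ 2) := by
        have := integral_mono i2 I1 hlow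
        rwa [integral_indicator_const _ Metric.isOpen_ball.measurableSet, smul_eq_mul] at this
      set I := ∫ x, w (s x) * (Real.exp (s x) * u x ^ 2) with hI
      have hI0 : 0 ≤ I := le_trans (by have := hwpos T; positivity) j2
      have j3 : τ ^ 3 * I ≤ 2 * Λ ^ 2 * I + V * (m * (G ^ 2 + 1) * w T) := hcarl.trans j1'
      have hτ3 : τ ≤ τ ^ 3 := le_self_pow₀ hτ1 (by norm_num)
      have j4 : τ / 2 * I ≤ V * (m * (G ^ 2 + 1) * w T) := by
        have k1 := mul_le_mul_of_nonneg_right hτ3 hI0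
        have k2 := mul_le_mul_of_nonneg_right hτΛ hI0
        linarith
      have j5 : τ / 2 * (V₁ * (w T * κ)) ≤ τ / 2 * I :=
        mul_le_mul_of_nonneg_left j2 (by linarith)
      refine le_of_mul_le_mul_right ?_ (hwpos T)
      linarith
    obtain ⟨τ, hτ⟩ : ∃ τ : ℝ, 1000 * C ^ 2 ≤ τ ∧ 4 * Λ ^ 2 ≤ τ ∧
        2 * (m * (G ^ 2 + 1) * V) / (κ * V₁) + 1 ≤ τ :=
      ⟨max (1000 * C ^ 2) (max (4 * Λ ^ 2) _), le_max_left _ _,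
        (le_max_left _ _).trans (le_max_right _ _), (le_max_right _ _).trans (le_max_right _ _)⟩
    have h1 := main τ hτ.1 hτ.2.1
    have h2 : 0 < κ * V₁ := by positivity
    have h3 : 2 * (m * (G ^ 2 + 1) * V) / (κ * V₁) < τ := by linarith [hτ.2.2]
    rw [div_lt_iff₀ h2] at h3
    linarith
  filter_upwards [hρ (Real.exp T / c₂) (by positivity)] with x hx
  by_cases hxx : x = x₀
  · rw [hxx, hfx₀]
  · refine key x hxx (Real.exp_lt_exp.1 ?_)
    rw [lt_div_iff₀ hc₂] at hx
    linarith [(hexp x hxx).2]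

end Riemann

/-! ### Nodal sets of elliptic equations -/

namespace Riemann

variable {d : ℕ}

/-- Iterated partial derivatives, in the directions given by a list. -/
def iterPderiv (f : Euc d → ℝ) : List (Fin d) → Euc d → ℝ
  | [] => f
  | i :: l => pderiv i (iterPderiv f l)

theorem contDiffAt_iterPderiv {f : Euc d → ℝ} {x : Euc d} (hf : ContDiffAt ℝ ∞ f x)
    (l : List (Fin d)) : ContDiffAt ℝ ∞ (iterPderiv f l) x := by
  induction l with
  | nil => exact hf
  | cons i l ih => exact contDiffAt_pderiv ih i

theorem iterPderiv_eventuallyEq_zero {f : Euc d → ℝ} {x : Euc d} (hf : f =ᶠ[nhds x] fun _ => 0)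
    (l : List (Fin d)) : iterPderiv f l =ᶠ[nhds x] fun _ => 0 := by
  induction l with
  | nil => exact hf
  | cons i l ih =>
    refine (eventuallyEq_pderiv ih i).trans (.of_forall fun y => ?_)
    exact pderiv_const 0 y i

theorem norm_fderiv_le_sum_pderiv (f : Euc d → ℝ) (x : Euc d) :
    ‖fderiv ℝ f x‖ ≤ ∑ i, |pderiv i f x| := by
  refine ContinuousLinearMap.opNorm_le_bound _
    (Finset.sum_nonneg fun i _ => abs_nonneg _) fun v => ?_
  have hv : v = ∑ i, v i • EuclideanSpace.single i (1 : ℝ) := by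
    ext j
    simp [Finset.sum_apply, Pi.single_apply]
  have : fderiv ℝ f x v = ∑ i, v i * pderiv i f x := by
    conv_lhs => rw [hv]
    simp [pderiv]
  rw [this, Finset.sum_mul]
  refine (norm_sum_le _ _).trans (Finset.sum_le_sum fun i _ => ?_)
  rw [norm_mul, mul_comm]
  exact mul_le_mul_of_nonneg_left (PiLp.norm_apply_le v i) (abs_nonneg _)

/-- The mean value inequality: a zero of the function raises the order of vanishing of the
derivatives by one. -/
theorem VanishesToOrder.succ_of_pderiv {x₀ : Euc d} {n : ℕ} {f : Euc d → ℝ}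
    (hf : ∀ᶠ x in nhds x₀, ContDiffAt ℝ ∞ f x) (h0 : f x₀ = 0)
    (h : ∀ i, VanishesToOrder x₀ n (pderiv i f)) : VanishesToOrder x₀ (n + 1) f := by
  obtain ⟨c, hc, hb⟩ := (VanishesToOrder.sum (t := Finset.univ) fun i => (h i).abs).exists_bound
  obtain ⟨r, hr, hball⟩ := Metric.eventually_nhds_iff_ball.1 (hf.and hb)
  refine Asymptotics.IsBigO.of_bound c ?_
  filter_upwards [Metric.ball_mem_nhds x₀ hr] with x hx
  have hsub : Metric.closedBall x₀ ‖x - x₀‖ ⊆ Metric.ball x₀ r :=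
    Metric.closedBall_subset_ball (by simpa [dist_eq_norm] using hx)
  have := (convex_closedBall x₀ ‖x - x₀‖).norm_image_sub_le_of_norm_fderiv_le (𝕜 := ℝ) (f := f)
    (C := c * ‖x - x₀‖ ^ n)
    (fun y hy => (hball y (hsub hy)).1.differentiableAt_infty)
    (fun y hy => by
      refine (norm_fderiv_le_sum_pderiv f y).trans ((le_abs_self _).trans
        ((hball y (hsub hy)).2.trans ?_))
      have : ‖y - x₀‖ ≤ ‖x - x₀‖ := by simpa [dist_eq_norm] using hy
      gcongr)
    (Metric.mem_closedBall_self (norm_nonneg _))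
    (show x ∈ Metric.closedBall x₀ ‖x - x₀‖ by simp [dist_eq_norm])
  rw [h0, sub_zero] at this
  simpa [pow_succ, mul_assoc] using this

/-- A smooth function all of whose derivatives vanish at a point vanishes there to infinite
order. -/
theorem vanishesToOrder_iterPderiv {x₀ : Euc d} {f : Euc d → ℝ}
    (hf : ∀ᶠ x in nhds x₀, ContDiffAt ℝ ∞ f x) (h0 : ∀ l, iterPderiv f l x₀ = 0) (n : ℕ) :
    ∀ l, VanishesToOrder x₀ n (iterPderiv f l) := by
  induction n with
  | zero => exact fun l => .of_continuousAt (contDiffAt_iterPderiv hf.self_of_nhds l).continuousAt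
  | succ n ih =>
    exact fun l => .succ_of_pderiv (hf.mono fun x hx => contDiffAt_iterPderiv hx l) (h0 l)
      fun i => ih (i :: l)

/-- The partial derivatives of a function vanish almost everywhere on a set where the function
vanishes. -/
theorem ae_pderiv_eq_zero {f : Euc d → ℝ} {S : Set (Euc d)} (hS : MeasurableSet S)
    (hf : ∀ x ∈ S, DifferentiableAt ℝ f x) (h0 : ∀ x ∈ S, f x = 0) (i : Fin d) :
    ∀ᵐ x ∂(volume.restrict S), pderiv i f x = 0 := by
  set e : Euc d := EuclideanSpace.single i (1 : ℝ) with he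
  -- On `S` the map `f • e` is approximated by `0` with error `0`, so its derivative is `0` at the
  -- density points of `S`.
  have happ : ApproximatesLinearOn (fun x => f x • e) (0 : Euc d →L[ℝ] Euc d) S 0 := by
    intro x hx y hy
    simp [h0 x hx, h0 y hy]
  have := happ.norm_fderiv_sub_le volume hS (fun x => (fderiv ℝ f x).smulRight e)
    fun x hx => ((hf x hx).hasFDerivAt.smul_const e).hasFDerivWithinAt
  filter_upwards [this] with x hx
  have h1 : (fderiv ℝ f x).smulRight e = 0 := by
    rw [sub_zero] at hx
    exact nnnorm_eq_zero.1 (le_antisymm hx zero_le)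
  have h2 : pderiv i f x • e = 0 := by
    have := congrArg (fun L : Euc d →L[ℝ] Euc d => L e) h1
    simpa [pderiv, he] using this
  refine (smul_eq_zero.1 h2).resolve_right ?_
  simp [he]

/-- At almost every zero of a smooth function, all its derivatives vanish. -/
theorem ae_iterPderiv_eq_zero {f : Euc d → ℝ} {Ω : Set (Euc d)} (hΩ : IsOpen Ω)
    (hf : ∀ x ∈ Ω, ContDiffAt ℝ ∞ f x) :
    ∀ᵐ x ∂(volume.restrict {x | x ∈ Ω ∧ f x = 0}), ∀ l, iterPderiv f l x = 0 := by
  have hmeas : ∀ l, MeasurableSet {x | x ∈ Ω ∧ iterPderiv f l x = 0} := fun l => by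
    have hopen : IsOpen (Ω ∩ iterPderiv f l ⁻¹' {0}ᶜ) :=
      ContinuousOn.isOpen_inter_preimage
        (fun x hx => (contDiffAt_iterPderiv (hf x hx) l).continuousAt.continuousWithinAt) hΩ
        isOpen_compl_singleton
    have : {x | x ∈ Ω ∧ iterPderiv f l x = 0} = Ω \ (Ω ∩ iterPderiv f l ⁻¹' {0}ᶜ) := by
      ext x
      simp only [Set.mem_ofPred_eq, Set.mem_sdiff, Set.mem_inter_iff, Set.mem_preimage,
        Set.mem_compl_iff, Set.mem_singleton_iff]
      tauto
    rw [this]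
    exact hΩ.measurableSet.diff hopen.measurableSet
  rw [ae_all_iff]
  intro l
  induction l with
  | nil => exact (ae_restrict_mem (hmeas [])).mono fun x hx => hx.2
  | cons i l ih =>
    have h1 := ae_pderiv_eq_zero ((hmeas []).inter (hmeas l))
      (fun x hx => (contDiffAt_iterPderiv (hf x hx.1.1) l).differentiableAt_infty)
      (fun x hx => hx.2.2) i
    rw [ae_restrict_iff' ((hmeas []).inter (hmeas l))] at h1
    have h2 := (ae_restrict_iff' (hmeas [])).1 ih
    refine (ae_restrict_iff' (hmeas [])).2 ?_
    filter_upwards [h1, h2] with x hx1 hx2 hx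
    exact hx1 ⟨hx, hx.1, hx2 hx⟩

/-- On the open set `Ω`, the function `f` is smooth, the symmetric matrix `A` is smooth and positive
definite, and `|div (A ∇f)|` is locally bounded by a multiple of `|f|`. -/
structure EllipticOn (A : Fin d → Fin d → Euc d → ℝ) (Ω : Set (Euc d)) (f : Euc d → ℝ) : Prop where
  isOpen : IsOpen Ω
  smooth_coeff : ∀ x ∈ Ω, ∀ i j, ContDiffAt ℝ ∞ (A i j) x
  posDef : ∀ x ∈ Ω, (Matrix.of fun i j => A i j x).PosDef
  smooth : ∀ x ∈ Ω, ContDiffAt ℝ ∞ f x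
  bound : ∀ x ∈ Ω, ∃ Λ, ∀ᶠ y in nhds x, |ellip A f y| ≤ Λ * |f y|

namespace EllipticOn

variable {A : Fin d → Fin d → Euc d → ℝ} {Ω : Set (Euc d)} {f : Euc d → ℝ}

theorem mono (h : EllipticOn A Ω f) {Ω' : Set (Euc d)} (h' : IsOpen Ω') (hsub : Ω' ⊆ Ω) :
    EllipticOn A Ω' f :=
  ⟨h', fun x hx => h.smooth_coeff x (hsub hx), fun x hx => h.posDef x (hsub hx),
    fun x hx => h.smooth x (hsub hx), fun x hx => h.bound x (hsub hx)⟩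

/-- Strong unique continuation at a point where all derivatives vanish. -/
theorem eventuallyEq_zero (h : EllipticOn A Ω f) {x : Euc d} (hx : x ∈ Ω)
    (h0 : ∀ l, iterPderiv f l x = 0) : f =ᶠ[nhds x] fun _ => 0 := by
  have hev := h.isOpen.mem_nhds hx
  obtain ⟨Λ, hΛ⟩ := h.bound x hx
  have hord := fun n => vanishesToOrder_iterPderiv
    (Filter.mem_of_superset hev fun y hy => h.smooth y hy) h0 n
  refine eventually_eq_zero_of_vanishesToOrder (A := A) ?_ ?_ (h.posDef x hx) ?_ hΛ
    (fun n => hord n []) (fun n i => hord n [i])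
  · exact Filter.mem_of_superset hev fun y hy => h.smooth_coeff y hy
  · refine Filter.mem_of_superset hev fun y hy i j => ?_
    simpa using ((h.posDef y hy).isHermitian.apply i j).symm
  · exact Filter.mem_of_superset hev fun y hy => h.smooth y hy

/-- **Unique continuation** on a connected open set. -/
theorem eq_zero_of_isPreconnected (h : EllipticOn A Ω f) (hΩ : IsPreconnected Ω) {x₀ : Euc d}
    (hx₀ : x₀ ∈ Ω) (h0 : f =ᶠ[nhds x₀] fun _ => 0) : ∀ x ∈ Ω, f x = 0 := by
  have hsub : Ω ⊆ {x | f =ᶠ[nhds x] fun _ => 0} := by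
    -- The set where `f` vanishes locally is closed in `Ω`, because all derivatives vanish on it.
    refine hΩ.subset_of_closure_inter_subset isOpen_setOfPred_eventually_nhds ⟨x₀, hx₀, h0⟩ ?_
    rintro x ⟨hxc, hxΩ⟩
    refine h.eventuallyEq_zero hxΩ fun l => ?_
    by_contra hne
    have := (contDiffAt_iterPderiv (h.smooth x hxΩ) l).continuousAt.eventually_ne hne
    obtain ⟨y, hy, hyu⟩ := mem_closure_iff_nhds.1 hxc _ this
    exact hy (iterPderiv_eventuallyEq_zero hyu l).eq_of_nhds
  exact fun x hx => (hsub hx).eq_of_nhds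

/-- If the zero set of `f` is not negligible, then `f` vanishes identically near one of its
points. -/
theorem exists_eventuallyEq_zero (h : EllipticOn A Ω f) (h0 : volume {x | x ∈ Ω ∧ f x = 0} ≠ 0) :
    ∃ x ∈ Ω, f =ᶠ[nhds x] fun _ => 0 := by
  have hne : (volume.restrict {x | x ∈ Ω ∧ f x = 0}) Set.univ ≠ 0 := by simpa using h0
  have hfull := ae_iterPderiv_eq_zero h.isOpen h.smooth
  have hmem : ∀ᵐ x ∂(volume.restrict {x | x ∈ Ω ∧ f x = 0}), x ∈ Ω := by
    have hle : volume.restrict {x | x ∈ Ω ∧ f x = 0} ≤ volume.restrict Ω :=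
      Measure.restrict_mono (fun x hx => hx.1) le_rfl
    exact (Measure.absolutelyContinuous_of_le hle).ae_le (ae_restrict_mem h.isOpen.measurableSet)
  have : (ae (volume.restrict {x | x ∈ Ω ∧ f x = 0})).NeBot :=
    ae_neBot.2 fun h => hne (by rw [h]; simp)
  obtain ⟨x, hx1, hx2⟩ := (hmem.and hfull).exists
  exact ⟨x, hx1, h.eventuallyEq_zero hx1 hx2⟩

end EllipticOn

end Riemann

/-! ### The metric in coordinates -/

namespace Riemann

variable {d : ℕ} {H : Type*} [TopologicalSpace H]
  {I : ModelWithCorners ℝ (EuclideanSpace ℝ (Fin d)) H}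
  {M : Type*} [TopologicalSpace M] [ChartedSpace H M] [IsManifold I ∞ M]

variable (I) in
theorem extChartAt_symm_mem_interior {x : M} {y : EuclideanSpace ℝ (Fin d)}
    (hy : y ∈ interior (extChartAt I x).target) : (extChartAt I x).symm y ∈ I.interior M := by
  have hyt := interior_subset hy
  have hs : (extChartAt I x).symm y ∈ (chartAt H x).source := by
    rw [← extChartAt_source I]
    exact (extChartAt I x).map_target hyt
  refine (I.isInteriorPoint_iff_of_mem_atlas (n := ∞) (by simp) (chart_mem_atlas H x) hs).2 ?_
  change extChartAt I x ((extChartAt I x).symm y) ∈ interior (extChartAt I x).target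
  rwa [(extChartAt I x).right_inv hyt]

variable (I) in
theorem extChartAt_mem_interior_target {x p : M} (hp : p ∈ (extChartAt I x).source)
    (hpi : p ∈ I.interior M) : extChartAt I x p ∈ interior (extChartAt I x).target := by
  rw [extChartAt_source] at hp
  exact (I.isInteriorPoint_iff_of_mem_atlas (n := ∞) (by simp) (chart_mem_atlas H x) hp).1 hpi

/-- The coordinate vector field is the tangent map of the inverse chart applied to a constant field,
hence smooth. -/
theorem contMDiffAt_coordVec (x : M) (i : Fin d) {y : EuclideanSpace ℝ (Fin d)}
    (hy : y ∈ interior (extChartAt I x).target) :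
    ContMDiffAt 𝓘(ℝ, EuclideanSpace ℝ (Fin d)) I.tangent ∞
      (fun z => (⟨(extChartAt I x).symm z, coordVec I x i z⟩ : TangentBundle I M)) y := by
  have hsymm : ContMDiffOn 𝓘(ℝ, EuclideanSpace ℝ (Fin d)) I ∞ (extChartAt I x).symm
      (interior (extChartAt I x).target) :=
    (contMDiffOn_extChartAt_symm x).mono interior_subset
  have htan := hsymm.contMDiffOn_tangentMapWithin (m := ∞) (by simp)
    isOpen_interior.uniqueMDiffOn
  have hsec : ContMDiffOn 𝓘(ℝ, EuclideanSpace ℝ (Fin d))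
      (𝓘(ℝ, EuclideanSpace ℝ (Fin d))).tangent ∞
      (fun z => (⟨z, (EuclideanSpace.single i (1 : ℝ) : EuclideanSpace ℝ (Fin d))⟩ :
        TangentBundle 𝓘(ℝ, EuclideanSpace ℝ (Fin d)) (EuclideanSpace ℝ (Fin d))))
      (interior (extChartAt I x).target) :=
    (contMDiffOn_vectorSpace_iff_contDiffOn
      (V := fun _ => (EuclideanSpace.single i (1 : ℝ) : EuclideanSpace ℝ (Fin d)))).2
      contDiffOn_const
  have hcomp := ContMDiffOn.comp htan hsec (fun z hz => hz)
  have hat := hcomp.contMDiffAt (isOpen_interior.mem_nhds hy)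
  refine hat.congr_of_eventuallyEq ?_
  filter_upwards [isOpen_interior.mem_nhds hy] with z hz
  have hr : Set.range I ∈ nhds z :=
    Filter.mem_of_superset (isOpen_interior.mem_nhds hz)
      (interior_subset.trans (extChartAt_target_subset_range x))
  have : mfderivWithin 𝓘(ℝ, EuclideanSpace ℝ (Fin d)) I (extChartAt I x).symm (Set.range I) z =
      mfderivWithin 𝓘(ℝ, EuclideanSpace ℝ (Fin d)) I (extChartAt I x).symm
        (interior (extChartAt I x).target) z := by
    rw [mfderivWithin_of_mem_nhds hr, mfderivWithin_of_mem_nhds (isOpen_interior.mem_nhds hz)]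
  simp only [coordVec, this]
  rfl

theorem contDiffAt_gram (g : Metric I M) (x : M) (i j : Fin d) {y : EuclideanSpace ℝ (Fin d)}
    (hy : y ∈ interior (extChartAt I x).target) : ContDiffAt ℝ ∞ (fun z => gram g x z i j) y := by
  rw [← contMDiffAt_iff_contDiffAt]
  have hb : ContMDiffAt 𝓘(ℝ, EuclideanSpace ℝ (Fin d)) I ∞ (extChartAt I x).symm y :=
    ((contMDiffOn_extChartAt_symm x).mono interior_subset).contMDiffAt
      (isOpen_interior.mem_nhds hy)
  have : ContMDiffAt 𝓘(ℝ, EuclideanSpace ℝ (Fin d)) (I.prod 𝓘(ℝ)) ∞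
      (fun z ↦ Bundle.TotalSpace.mk' ℝ (E := Bundle.Trivial M ℝ) ((extChartAt I x).symm z)
        (g.inner ((extChartAt I x).symm z) (coordVec I x i z) (coordVec I x j z))) y := by
    apply ContMDiffAt.clm_bundle_apply₂ (F₁ := EuclideanSpace ℝ (Fin d))
      (F₂ := EuclideanSpace ℝ (Fin d))
    · exact g.contMDiff.contMDiffAt.comp y hb
    · exact contMDiffAt_coordVec x i hy
    · exact contMDiffAt_coordVec x j hy
  simp only [Bundle.contMDiffAt_totalSpace] at this
  exact this.2

end Riemann

/-! ### Eigenfunctions in coordinates -/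

namespace Riemann

variable {d : ℕ} {H : Type*} [TopologicalSpace H]
  {I : ModelWithCorners ℝ (EuclideanSpace ℝ (Fin d)) H}
  {M : Type*} [TopologicalSpace M] [ChartedSpace H M] [IsManifold I ∞ M]

omit [IsManifold I ∞ M] in
/-- The derivative of the inverse chart, in terms of the coordinate vector fields. -/
theorem sum_smul_coordVec (x : M) (y : EuclideanSpace ℝ (Fin d)) (v : Fin d → ℝ) :
    ∑ i, v i • coordVec I x i y =
      mfderivWithin 𝓘(ℝ, EuclideanSpace ℝ (Fin d)) I (extChartAt I x).symm (Set.range I) y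
        (WithLp.toLp 2 v : EuclideanSpace ℝ (Fin d)) := by
  have : (WithLp.toLp 2 v : EuclideanSpace ℝ (Fin d)) =
      ∑ i, v i • (EuclideanSpace.single i (1 : ℝ) : EuclideanSpace ℝ (Fin d)) := by
    ext k
    simp [Finset.sum_apply, Pi.single_apply]
  rw [this]
  set L : EuclideanSpace ℝ (Fin d) →L[ℝ] TangentSpace I ((extChartAt I x).symm y) :=
    mfderivWithin 𝓘(ℝ, EuclideanSpace ℝ (Fin d)) I (extChartAt I x).symm (Set.range I) y
  change _ = L _
  rw [map_sum]
  refine Finset.sum_congr rfl fun i _ => ?_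
  rw [map_smul]
  rfl

theorem posDef_gram (g : Metric I M) (x : M) {y : EuclideanSpace ℝ (Fin d)}
    (hy : y ∈ (extChartAt I x).target) : (gram g x y).PosDef := by
  refine Matrix.PosDef.of_dotProduct_mulVec_pos ?_ fun v hv => ?_
  · ext i j
    exact g.symm _ (coordVec I x j y) (coordVec I x i y)
  · set p := (extChartAt I x).symm y with hp
    have hdot : star v ⬝ᵥ (gram g x y).mulVec v =
        g.inner p (∑ i, v i • coordVec I x i y) (∑ i, v i • coordVec I x i y) := by
      simp only [map_sum, map_smul, sum_apply, smul_apply, dotProduct, Matrix.mulVec, gram,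
        Matrix.of_apply, smul_eq_mul, Finset.mul_sum, star_trivial]
      rw [Finset.sum_comm]
      exact Finset.sum_congr rfl fun j _ => Finset.sum_congr rfl fun i _ => by ring
    rw [hdot]
    refine g.pos p _ ?_
    rw [sum_smul_coordVec]
    -- The derivative of the inverse chart is injective.
    obtain ⟨e, he⟩ := isInvertible_mfderivWithin_extChartAt_symm hy
    rw [← he]
    intro h0
    apply hv
    have := e.injective (h0.trans (map_zero e).symm)
    funext i
    exact congrArg (fun w : EuclideanSpace ℝ (Fin d) => w i) this

theorem _root_.contDiffAt_det {E : Type*} [NormedAddCommGroup E] [NormedSpace ℝ E] {ι : Type*}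
    [Fintype ι] [DecidableEq ι] {A : E → Matrix ι ι ℝ} {y : E}
    (h : ∀ i j, ContDiffAt ℝ ∞ (fun z => A z i j) y) :
    ContDiffAt ℝ ∞ (fun z => (A z).det) y := by
  simp only [Matrix.det_apply']
  refine ContDiffAt.sum fun σ _ => contDiffAt_const.mul ?_
  exact contDiffAt_prod fun i _ => h _ _

theorem _root_.contDiffAt_matrix_inv {E : Type*} [NormedAddCommGroup E] [NormedSpace ℝ E]
    {ι : Type*} [Fintype ι] [DecidableEq ι] {A : E → Matrix ι ι ℝ} {y : E}
    (h : ∀ i j, ContDiffAt ℝ ∞ (fun z => A z i j) y) (hy : (A y).det ≠ 0) (i j : ι) :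
    ContDiffAt ℝ ∞ (fun z => (A z)⁻¹ i j) y := by
  simp only [Matrix.inv_def, Matrix.smul_apply, Ring.inverse_eq_inv', smul_eq_mul,
    Matrix.adjugate_apply]
  refine ((contDiffAt_det h).inv hy).mul (contDiffAt_det fun k l => ?_)
  by_cases hk : k = j
  · subst hk
    simpa using contDiffAt_const
  · simpa [Matrix.updateRow_ne hk] using h k l

theorem density_pos (g : Metric I M) (x : M) {y : EuclideanSpace ℝ (Fin d)}
    (hy : y ∈ (extChartAt I x).target) : 0 < density g x y :=
  Real.sqrt_pos.2 (posDef_gram g x hy).det_pos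

theorem contDiffAt_density (g : Metric I M) (x : M) {y : EuclideanSpace ℝ (Fin d)}
    (hy : y ∈ interior (extChartAt I x).target) : ContDiffAt ℝ ∞ (density g x) y :=
  (contDiffAt_det fun i j => contDiffAt_gram g x i j hy).sqrt
    (posDef_gram g x (interior_subset hy)).det_pos.ne'

/-- The coefficients of the Laplace–Beltrami operator in divergence form in the chart around `x`. -/
def laplaceCoeff (g : Metric I M) (x : M) (i j : Fin d) (y : EuclideanSpace ℝ (Fin d)) : ℝ :=
  density g x y * (gram g x y)⁻¹ i j

theorem laplacian_eq (g : Metric I M) (x : M) (f : M → ℝ) (y : EuclideanSpace ℝ (Fin d)) :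
    laplacian g x f y =
      (density g x y)⁻¹ * ellip (laplaceCoeff g x) (fun z => f ((extChartAt I x).symm z)) y := by
  have (i : Fin d) : flux (laplaceCoeff g x) (fun z => f ((extChartAt I x).symm z)) i =
      fun z => density g x z *
        ∑ j, (gram g x z)⁻¹ i j * pderiv j (fun w => f ((extChartAt I x).symm w)) z := by
    funext z
    simp only [flux, laplaceCoeff, Finset.mul_sum, mul_assoc]
  simp only [laplacian, ellip, divg, this]

/-- In a chart the eigenvalue equation reads `div (A ∇f) = -λ √(det g) f`. -/
theorem IsEigenfunction.ellipticOn {g : Metric I M} {lam : ℝ} {f : M → ℝ}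
    (hf : IsEigenfunction g lam f) (x : M) :
    EllipticOn (laplaceCoeff g x) (interior (extChartAt I x).target)
      (fun y => f ((extChartAt I x).symm y)) where
  isOpen := isOpen_interior
  smooth_coeff := fun y hy i j => (contDiffAt_density g x hy).mul
    (contDiffAt_matrix_inv (fun i j => contDiffAt_gram g x i j hy)
      (posDef_gram g x (interior_subset hy)).det_pos.ne' i j)
  posDef := fun y hy => by
    have := (posDef_gram g x (interior_subset hy)).inv.smul (density_pos g x (interior_subset hy))
    exact this
  smooth := fun y hy => by
    rw [← contMDiffAt_iff_contDiffAt]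
    have hb : ContMDiffAt 𝓘(ℝ, EuclideanSpace ℝ (Fin d)) I ∞ (extChartAt I x).symm y :=
      ((contMDiffOn_extChartAt_symm x).mono interior_subset).contMDiffAt
        (isOpen_interior.mem_nhds hy)
    refine ContMDiffAt.comp y (hf.smooth.contMDiffAt ?_) hb
    exact (I.isOpen_interior (n := ∞) (by simp)).mem_nhds (extChartAt_symm_mem_interior I hy)
  bound := fun y hy => by
    have hc := (contDiffAt_density g x hy).continuousAt
    refine ⟨|lam| * (density g x y + 1), ?_⟩
    filter_upwards [isOpen_interior.mem_nhds hy, hc.eventually_lt_const (lt_add_one _)] with z hz hd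
    have hpos := density_pos g x (interior_subset hz)
    have he := hf.eigen x z hz
    rw [laplacian_eq] at he
    have : ellip (laplaceCoeff g x) (fun z => f ((extChartAt I x).symm z)) z =
        -(lam * density g x z * f ((extChartAt I x).symm z)) := by
      field_simp at he
      linarith
    rw [this, abs_neg, abs_mul, abs_mul, abs_of_pos hpos]
    gcongr

end Riemann

/-! ### Nodal sets of Laplacian eigenfunctions -/

namespace Riemann

variable {d : ℕ} {H : Type*} [TopologicalSpace H]
  {I : ModelWithCorners ℝ (EuclideanSpace ℝ (Fin d)) H}
  {M : Type*} [TopologicalSpace M] [ChartedSpace H M] [IsManifold I ∞ M]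

/-- Unique continuation up to the boundary: if `f` vanishes on the interior points near `q`, and `q`
is close enough to `p`, then `f` vanishes on the interior points near `p`. -/
theorem IsEigenfunction.exists_nhds {g : Metric I M} {lam : ℝ} {f : M → ℝ}
    (hf : IsEigenfunction g lam f) (p : M) :
    ∃ U ∈ nhds p, ∀ q ∈ U, (∀ᶠ r in nhds q, r ∈ I.interior M → f r = 0) →
      ∀ r ∈ U, r ∈ I.interior M → f r = 0 := by
  set c := extChartAt I p p with hc
  obtain ⟨ρ, hρ, hball⟩ := Metric.mem_nhdsWithin_iff.1 (extChartAt_target_mem_nhdsWithin (I := I) p)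
  -- The range of the model is convex, so `Ω` is a convex open set of interior coordinates.
  set Ω := Metric.ball c ρ ∩ interior (Set.range I) with hΩdef
  have hΩo : IsOpen Ω := Metric.isOpen_ball.inter isOpen_interior
  have hΩt : Ω ⊆ interior (extChartAt I p).target :=
    interior_maximal (fun z hz => hball ⟨hz.1, interior_subset hz.2⟩) hΩo
  have hΩc : IsPreconnected Ω :=
    ((convex_ball c ρ).inter I.convex_range.interior).isPreconnected
  have hmem : ∀ r ∈ (extChartAt I p).source, extChartAt I p r ∈ Metric.ball c ρ →
      r ∈ I.interior M → extChartAt I p r ∈ Ω := fun r hr hrb hri =>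
    ⟨hrb, interior_mono (extChartAt_target_subset_range p)
      (extChartAt_mem_interior_target I hr hri)⟩
  refine ⟨(extChartAt I p).source ∩ extChartAt I p ⁻¹' Metric.ball c ρ, ?_, ?_⟩
  · exact Filter.inter_mem (extChartAt_source_mem_nhds p)
      ((continuousAt_extChartAt p).preimage_mem_nhds (Metric.ball_mem_nhds c hρ))
  rintro q ⟨hqs, hqb⟩ hq r ⟨hrs, hrb⟩ hri
  -- Near the image of `q` there are points of `Ω` around which `f` vanishes.
  have hqt : extChartAt I p q ∈ (extChartAt I p).target := (extChartAt I p).map_source hqs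
  obtain ⟨W, hWsub, hWo, hqW⟩ := eventually_nhds_iff.1 hq
  have hsymm : ContinuousWithinAt (extChartAt I p).symm (Set.range I) (extChartAt I p q) :=
    (continuousAt_extChartAt_symm'' hqt).continuousWithinAt
  have hpre : (extChartAt I p).symm ⁻¹' W ∈ nhdsWithin (extChartAt I p q) (Set.range I) :=
    hsymm.preimage_mem_nhdsWithin
      (hWo.mem_nhds (by rwa [(extChartAt I p).left_inv hqs]))
  obtain ⟨O, hOo, hqO, hOW⟩ := mem_nhdsWithin.1 hpre
  have hcl : extChartAt I p q ∈ closure (interior (Set.range I)) := by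
    rw [I.convex_range.closure_interior_eq_closure_of_nonempty_interior I.nonempty_interior]
    exact subset_closure (extChartAt_target_subset_range p hqt)
  obtain ⟨z, ⟨hzO, hzb⟩, hzi⟩ :=
    mem_closure_iff.1 hcl (O ∩ Metric.ball c ρ) (hOo.inter Metric.isOpen_ball) ⟨hqO, hqb⟩
  have hzero : (fun y => f ((extChartAt I p).symm y)) =ᶠ[nhds z] fun _ => 0 := by
    filter_upwards [hΩo.mem_nhds ⟨hzb, hzi⟩, hOo.mem_nhds hzO] with y hyΩ hyO
    exact hWsub _ (hOW ⟨hyO, interior_subset hyΩ.2⟩) (extChartAt_symm_mem_interior I (hΩt hyΩ))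
  have := ((hf.ellipticOn p).mono hΩo hΩt).eq_zero_of_isPreconnected hΩc ⟨hzb, hzi⟩ hzero
    _ (hmem r hrs hrb hri)
  simpa only [(extChartAt I p).left_inv hrs] using this

/-- An eigenfunction on a connected manifold that vanishes on a nonempty open set vanishes in the
whole interior. -/
theorem IsEigenfunction.eq_zero_of_eventually [ConnectedSpace M] {g : Metric I M} {lam : ℝ}
    {f : M → ℝ} (hf : IsEigenfunction g lam f) {p₀ : M} (h0 : ∀ᶠ r in nhds p₀, f r = 0) :
    ∀ r ∈ I.interior M, f r = 0 := by
  -- The points near which `f` vanishes on the interior form a clopen set.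
  set V := {p : M | ∀ᶠ r in nhds p, r ∈ I.interior M → f r = 0} with hV
  have hopen : IsOpen V := isOpen_setOfPred_eventually_nhds
  have hclosed : IsClosed V := by
    refine isClosed_of_closure_subset fun p hp => ?_
    obtain ⟨U, hU, hUf⟩ := hf.exists_nhds p
    obtain ⟨q, hqU, hqV⟩ := mem_closure_iff_nhds.1 hp U hU
    exact Filter.mem_of_superset hU (hUf q hqU hqV)
  have huniv : V = Set.univ :=
    IsClopen.eq_univ ⟨hclosed, hopen⟩ ⟨p₀, h0.mono fun r hr _ => hr⟩
  intro r hr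
  have : r ∈ V := huniv ▸ Set.mem_univ r
  exact this.self_of_nhds hr

omit [IsManifold I ∞ M] in
/-- The boundary points of a chart form a null set of coordinates, because the range of the model
with corners is convex. -/
theorem ae_mem_interior_extChartAt_target (x : M) :
    ∀ᵐ y ∂(volume.restrict (extChartAt I x).target),
      y ∈ interior (extChartAt I x).target := by
  have ho : IsOpen (I.symm ⁻¹' (chartAt H x).target) :=
    (chartAt H x).open_target.preimage I.continuous_symm
  have hm : MeasurableSet (extChartAt I x).target := by
    rw [extChartAt_target]
    exact ho.measurableSet.inter I.isClosed_range.measurableSet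
  have hfr : volume (frontier (Set.range I)) = 0 := I.convex_range.addHaar_frontier volume
  rw [ae_restrict_iff' hm]
  filter_upwards [measure_eq_zero_iff_ae_notMem.1 hfr] with y hyf hy
  rw [extChartAt_target] at hy ⊢
  rw [interior_inter, ho.interior_eq]
  refine ⟨hy.1, by_contra fun hni => hyf ⟨subset_closure hy.2, hni⟩⟩

section Measure

variable [MeasurableSpace M]

/-- Whether a set is null for the volume of a chart can be tested on interior coordinates. -/
theorem chartVol_eq_zero {g : Metric I M} {x : M} {S : Set M} (hS : MeasurableSet S)
    (h : volume {y | y ∈ interior (extChartAt I x).target ∧ (extChartAt I x).symm y ∈ S} = 0) :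
    chartVol g x S = 0 := by
  by_cases hm : AEMeasurable (extChartAt I x).symm
    ((volume.restrict (extChartAt I x).target).withDensity
      (fun y => ENNReal.ofReal (density g x y)))
  · rw [chartVol, Measure.map_apply_of_aemeasurable hm hS]
    refine withDensity_absolutelyContinuous _ _ ?_
    rw [measure_eq_zero_iff_ae_notMem]
    filter_upwards [ae_mem_interior_extChartAt_target x,
      ae_restrict_of_ae (measure_eq_zero_iff_ae_notMem.1 h)] with y hy hyS hy'
    exact hyS ⟨hy, hy'⟩
  -- the push-forward is `0` if the inverse chart is not measurable
  · rw [chartVol, Measure.map_of_not_aemeasurable hm]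
    simp

/-- A set that is null in every chart is null for the Riemannian volume. -/
theorem vol_eq_zero {g : Metric I M} {S : Set M} (hS : MeasurableSet S)
    (h : ∀ x, chartVol g x S = 0) : vol g S = 0 := by
  -- The restriction of the volume to the complement of `S` is also above every chart volume.
  have hle : vol g ≤ (vol g).restrict Sᶜ := by
    refine iSup_le fun x => ?_
    have : chartVol g x = (chartVol g x).restrict Sᶜ :=
      (Measure.restrict_eq_self_of_ae_mem (measure_eq_zero_iff_ae_notMem.1 (h x))).symm
    rw [this]
    exact Measure.restrict_mono le_rfl (le_iSup (chartVol g) x)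
  refine le_antisymm ((hle S).trans ?_) zero_le
  rw [Measure.restrict_apply hS]
  simp

variable [BorelSpace M]

theorem ae_mem_interior (g : Metric I M) : ∀ᵐ p ∂(vol g), p ∈ I.interior M := by
  have ho : IsOpen (I.interior M) := I.isOpen_interior (n := ∞) (by simp)
  rw [ae_iff]
  refine vol_eq_zero ho.measurableSet.compl fun x => chartVol_eq_zero ho.measurableSet.compl ?_
  convert measure_empty (μ := volume)
  ext y
  simp only [Set.mem_ofPred_eq, Set.mem_empty_iff_false, iff_false, not_and]
  exact fun hy => not_not.2 (extChartAt_symm_mem_interior I hy)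

/-- The nodal set of an eigenfunction is null, unless the eigenfunction vanishes almost
everywhere. -/
theorem IsEigenfunction.ae_ne_zero [ConnectedSpace M] {g : Metric I M} {lam : ℝ} {f : M → ℝ}
    (hf : IsEigenfunction g lam f) (h : ¬ ∀ᵐ p ∂(vol g), f p = 0) : ∀ᵐ p ∂(vol g), f p ≠ 0 := by
  have ho : IsOpen (I.interior M) := I.isOpen_interior (n := ∞) (by simp)
  set S := I.interior M \ (I.interior M ∩ f ⁻¹' {0}ᶜ) with hS
  have hSm : MeasurableSet S := ho.measurableSet.diff
    (hf.smooth.continuousOn.isOpen_inter_preimage ho isOpen_compl_singleton).measurableSet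
  have hSiff : ∀ p, p ∈ S ↔ p ∈ I.interior M ∧ f p = 0 := fun p => by
    simp only [hS, Set.mem_sdiff, Set.mem_inter_iff, Set.mem_preimage, Set.mem_compl_iff,
      Set.mem_singleton_iff]
    tauto
  suffices hnull : vol g S = 0 by
    filter_upwards [ae_mem_interior g, measure_eq_zero_iff_ae_notMem.1 hnull] with p hp hpS h0
    exact hpS ((hSiff p).2 ⟨hp, h0⟩)
  by_contra hnull
  obtain ⟨x, hx⟩ : ∃ x, chartVol g x S ≠ 0 := by
    by_contra! hall
    exact hnull (vol_eq_zero hSm hall)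
  have hpos : volume {y | y ∈ interior (extChartAt I x).target ∧
      f ((extChartAt I x).symm y) = 0} ≠ 0 := fun h0 => hx <| chartVol_eq_zero hSm <| by
    convert h0 using 4 with y
    simp only [hSiff]
    exact ⟨fun hy => ⟨hy.1, hy.2.2⟩, fun hy => ⟨hy.1, extChartAt_symm_mem_interior I hy.1, hy.2⟩⟩
  obtain ⟨y, hy, hy0⟩ := (hf.ellipticOn x).exists_eventuallyEq_zero hpos
  refine h ?_
  have hyt := interior_subset hy
  have hev : ∀ᶠ r in nhds ((extChartAt I x).symm y), f r = 0 := by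
    have hs : (extChartAt I x).symm y ∈ (extChartAt I x).source := (extChartAt I x).map_target hyt
    have hcont := (continuousAt_extChartAt' hs)
    have h1 : ∀ᶠ r in nhds ((extChartAt I x).symm y),
        f ((extChartAt I x).symm (extChartAt I x r)) = 0 := by
      refine hcont.eventually (p := fun z => f ((extChartAt I x).symm z) = 0) ?_
      rwa [(extChartAt I x).right_inv hyt]
    filter_upwards [h1, extChartAt_source_mem_nhds' hs] with r hr hrs
    rwa [(extChartAt I x).left_inv hrs] at hr
  filter_upwards [ae_mem_interior g] with r hr
  exact hf.eq_zero_of_eventually hev r hr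

end Measure

end Riemann

end

theorem proposition1 {d : ℕ} {H : Type*} [TopologicalSpace H]
    (I : ModelWithCorners ℝ (EuclideanSpace ℝ (Fin d)) H)
    (M : Type*) [TopologicalSpace M] [ChartedSpace H M] [IsManifold I ∞ M]
    [T2Space M] [CompactSpace M] [ConnectedSpace M] [MeasurableSpace M] [BorelSpace M]
    (g : Riemann.Metric I M) (hvol : Riemann.vol g Set.univ = 1)
    (n : ℕ) (lam : Fin n → ℝ) (φ : Fin n → M → ℝ)
    (hφ : ∀ k, Riemann.IsEigenfunction g (lam k) (φ k))
    (hL2 : ∀ k, MemLp (φ k) 2 (Riemann.vol g))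
    (horth : ∀ j k, ∫ y, φ j y * φ k y ∂(Riemann.vol g) = if j = k then 1 else 0) :
    (∀ x : M, Integrable (fun y => signKernel φ x y ^ 2) (Riemann.vol g) ∧
      ∫ y, signKernel φ x y ^ 2 ∂(Riemann.vol g) ≤ n) ∧
    Integrable (fun p : M × M => signKernel φ p.1 p.2 ^ 2)
      ((Riemann.vol g).prod (Riemann.vol g)) ∧
    ∫ x, ∫ y, signKernel φ x y ^ 2 ∂(Riemann.vol g) ∂(Riemann.vol g) = n := by
  have : IsProbabilityMeasure (Riemann.vol g) := ⟨hvol⟩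
  refine signKernel_of_orthonormal_of_ae_ne_zero hL2 horth fun k => (hφ k).ae_ne_zero fun h0 => ?_
  have h1 : ∫ y, φ k y * φ k y ∂(Riemann.vol g) = 1 := by simpa using horth k k
  have h2 : ∫ y, φ k y * φ k y ∂(Riemann.vol g) = 0 :=
    integral_eq_zero_of_ae (h0.mono fun p hp => by simp [hp])
  exact one_ne_zero (h1.symm.trans h2)
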